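/- Consider Markov decision processes with state space $\{1,\dots,S\}$, action space $\{1,\dots,A\}$, transition model $P$ and mean rewards $r_{s,a}\in[0,1]$. A policy is a map $\pi$ from states to distributions on actions; $\rho_\pi(s)=\lim_{T\to\infty}\frac1T\mathbb E\big[\sum_{t=1}^{T}r_{s_t,a_t}\mid s_1=s\big]$ is its average reward and $\rho^*(s)=\max_\pi\rho_\pi(s)$. The diameter is $D=\max_{s\ne s'}\min_\pi T^\pi_{s\to s'}$, where $T^\pi_{s\to s'}$ is the expected number of steps to reach $s'$ from $s$ under $\pi$. A learning algorithm chooses, at each step, a distribution on the actions as a function of the past states and actions and the current state; its regret on a run started at $s_1=s_{start}$ is $\mathcal R(T)=T\rho^*(s_{start})-\sum_{t=1}^{T}r_{s_t,a_t}$. There are a polynomial $p_2$ in four variables, a constant $C$ and an integer $k\ge 0$ such that, for all $S,A\ge 20$ and all mean rewards $r$, there is a learning algorithm which is given $S,A,r$, the horizon $T$ and the confidence parameter $\delta$, but neither $P$ nor the diameter, with the following property. For every $P$ with finite diameter $D\ge 20$ (such an MDP is communicating, hence weakly communicating), every initial state $s_{start}$ and every $T$: (1) for every $\delta\in(0,1)$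 with $T\ge p_2(S,A,D,\log(1/\delta))$, the regret of the algorithm satisfies, with probability at least $1-\delta$, $$\mathcal R(T)\le 491\sqrt{SADT\,\log\!\Big(\frac{S^3A^2T\log T}{\delta}\Big)};$$ (2) if $T\ge p_2(S,A,D,\log T)$, the algorithm with $\delta=1/T$ satisfies $\mathbb E[\mathcal R(T)]\le C\sqrt{SADT}\,(\log T)^k$, that is, $\mathbb E[\mathcal R(T)]=\tilde O(\sqrt{SADT})$. -/

import Mathlib

open MeasureTheory ProbabilityTheory Filter Topology Finset
open scoped ENNReal

noncomputable section

/-- A transition model on the state space `Fin S` with action space `Fin A`: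
`P s a` is the law of the next state when action `a` is executed in state `s`. -/
abbrev Transition (S A : ℕ) : Type := Fin S → Fin A → PMF (Fin S)

/-- A (stationary, possibly randomized) policy: a map from states to distributions on actions. -/
abbrev Policy (S A : ℕ) : Type := Fin S → PMF (Fin A)

/-- A learning algorithm: at every step it maps the list of all previous (state, action) pairs
and the current state to a distribution on the actions. It has no access to the transition model
other than through the observed trajectory. -/
abbrev Learner (S A : ℕ) : Type :=
  (n : ℕ) → (Fin n → Fin S × Fin A) → Fin S → PMF (Fin A)

/-- A stationary policy, seen as the learner that ignores the past. -/
def Policy.toLearner {S A : ℕ} (π : Policy S A) : Learner S A := fun _ _ s => π s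

/-- The space of infinite trajectories `(s₀, a₀), (s₁, a₁), …`. -/
abbrev Trajectory (S A : ℕ) : Type := ℕ → Fin S × Fin A

/-- One round: given the trajectory up to time `n`, the environment draws the next state `s'` from
`P (s n) (a n)`, then the learner draws an action from the history and `s'`. -/
def stepLaw {S A : ℕ} (P : Transition S A) (L : Learner S A) (n : ℕ)
    (h : (i : Iic n) → Fin S × Fin A) : PMF (Fin S × Fin A) :=
  let last : Fin S × Fin A := h ⟨n, Finset.mem_Iic.2 le_rfl⟩
  let hist : Fin (n + 1) → Fin S × Fin A :=
    fun i => h ⟨i, Finset.mem_Iic.2 (Nat.lt_succ_iff.1 i.2)⟩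
  (P last.1 last.2).bind fun s' => (L (n + 1) hist s').map fun a => (s', a)

/-- The same round, as a Markov kernel. -/
def stepKernel {S A : ℕ} (P : Transition S A) (L : Learner S A) (n : ℕ) :
    Kernel ((i : Iic n) → Fin S × Fin A) (Fin S × Fin A) :=
  Kernel.ofFunOfCountable fun h => (stepLaw P L n h).toMeasure

instance {S A : ℕ} (P : Transition S A) (L : Learner S A) (n : ℕ) :
    IsMarkovKernel (stepKernel P L n) :=
  ⟨fun h => inferInstanceAs (IsProbabilityMeasure (stepLaw P L n h).toMeasure)⟩

/-- The law of the first (state, action) pair when the initial state is `s`. -/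
def initLaw {S A : ℕ} (L : Learner S A) (s : Fin S) : PMF (Fin S × Fin A) :=
  (L 0 Fin.elim0 s).map fun a => (s, a)

/-- The law of the trajectory produced by the learner `L` in the environment with transition model
`P`, started at `s`. -/
def trajLaw {S A : ℕ} (P : Transition S A) (L : Learner S A) (s : Fin S) :
    Measure (Trajectory S A) :=
  Kernel.trajMeasure (X := fun _ => Fin S × Fin A) (initLaw L s).toMeasure (stepKernel P L)

instance {S A : ℕ} (P : Transition S A) (L : Learner S A) (s : Fin S) :
    IsProbabilityMeasure (trajLaw P L s) :=
  inferInstanceAs (IsProbabilityMeasure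
    (Kernel.trajMeasure (X := fun _ => Fin S × Fin A) (initLaw L s).toMeasure (stepKernel P L)))

/-- The reward collected during the first `T` steps, `r s a` being the mean reward of `(s, a)`. -/
def totalReward {S A : ℕ} (r : Fin S → Fin A → ℝ) (T : ℕ) (ω : Trajectory S A) : ℝ :=
  ∑ t ∈ range T, r (ω t).1 (ω t).2

/-- `x` is the average reward of the stationary policy `π` started at `s`, that is
`x = lim_{T → ∞} (1 / T) 𝔼[∑_{t < T} r (s t) (a t)]`. -/
def HasAverageReward {S A : ℕ} (P : Transition S A) (r : Fin S → Fin A → ℝ) (π : Policy S A)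
    (s : Fin S) (x : ℝ) : Prop :=
  Tendsto (fun T : ℕ => (1 / (T : ℝ)) * ∫ ω, totalReward r T ω ∂(trajLaw P π.toLearner s))
    atTop (𝓝 x)

/-- The optimal average reward from `s`: the best average reward of a stationary policy. -/
def optAverageReward {S A : ℕ} (P : Transition S A) (r : Fin S → Fin A → ℝ) (s : Fin S) : ℝ :=
  sSup {x : ℝ | ∃ π : Policy S A, HasAverageReward P r π s x}

/-- The regret of a trajectory started at `s`, after `T` steps. -/
def regret {S A : ℕ} (P : Transition S A) (r : Fin S → Fin A → ℝ) (s : Fin S) (T : ℕ)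
    (ω : Trajectory S A) : ℝ :=
  T * optAverageReward P r s - totalReward r T ω

/-- The first time at which the trajectory is in state `y` (`∞` if there is none). -/
def hittingSteps {S A : ℕ} (y : Fin S) (ω : Trajectory S A) : ℝ≥0∞ :=
  ⨅ n : ℕ, ⨅ _ : (ω n).1 = y, (n : ℝ≥0∞)

/-- The expected number of steps to reach `y` from `x` under the stationary policy `π`. -/
def expectedTravelTime {S A : ℕ} (P : Transition S A) (π : Policy S A) (x y : Fin S) : ℝ≥0∞ :=
  ∫⁻ ω, hittingSteps y ω ∂(trajLaw P π.toLearner x)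

/-- The diameter: the largest, over ordered pairs of distinct states, of the smallest expected
travel time over stationary policies. -/
def diameter {S A : ℕ} (P : Transition S A) : ℝ≥0∞ :=
  ⨆ x : Fin S, ⨆ y : Fin S, ⨆ _ : x ≠ y, ⨅ π : Policy S A, expectedTravelTime P π x y

end

/-!
The learner is optimistic and model-based. From its observations it forms empirical transition
probabilities `p̂` and looks, among the pairs `(ρ, h)` with `0 ≤ h ≤ H` that satisfy
`h s + ρ ≤ max_a (r s a + p̂ h + bonus)`, for one with nearly maximal gain `ρ`; it then plays an
action that realizes this maximum. The bonus is an empirical Bernstein bound for the single function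
`h`. The cap `H` on the span is a small power of the horizon `T`; it exceeds the unknown diameter
`D` once `T` is larger than a polynomial in the parameters, and it only enters lower-order terms.

Let `(ρ*, h*)` solve the optimality equation, with `0 ≤ h* ≤ D` (`exists_isOptimalPair`, by the
vanishing discount method). Since `h*` does not depend on the data, Bernstein's inequality shows
without any covering argument that `(ρ*, h*)` is among the admissible pairs, so the learner is
optimistic (`IsGood.isPlausible`). The gap of its action in the optimality equation is therefore at
most the drift `P g - g` of the bias error `g = h - h*`, plus the width of the confidence interval
(`IsGood.gap_le`), and this width is of order `√(Var h* x / n) + S √(Var g x / n)` after `n` visits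
(`IsClose.abs_wmean_sub_add_bonus_le`), where `x` is the logarithmic factor.

It remains to sum over time. For `h*`, the identity `Var h = (P h² - h²) + (h - P h) (h + P h)` gives
a total variance of order `D T` rather than `D² T` (`IsOptimalPair.sum_kvar_le`), and summing over
the visits to each pair turns this into `√(S A D T x)`. The data-dependent bias error `g`, which
costs the factor `S`, is handled by the same identity (`sum_kvar_le_of_drift`): because the
statistics are updated only logarithmically often, `g` changes rarely, the drift telescopes, and by
the gap inequality the negative part of the drift is dominated by the widths. A crude bound on the
widths then shows that the total variance of `g` is only of order `√T` up to small powers of `T`, so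
the contribution of `g` to the regret is of lower order (`RegretSystem.regret_le`).

All the probabilistic estimates are instances of one exponential inequality (`freedman`).
-/

noncomputable section

/-! ### One-step integration against the law of the trajectory -/

/-- Mean of `f` at the state that follows the state-action pair `z`. -/
def kmean {S A : ℕ} (P : Transition S A) (z : Fin S × Fin A) (f : Fin S → ℝ) : ℝ :=
  ∑ s', (P z.1 z.2 s').toReal * f s'

/-- Variance of `f` at the state that follows the state-action pair `z`. -/
def kvar {S A : ℕ} (P : Transition S A) (z : Fin S × Fin A) (f : Fin S → ℝ) : ℝ :=
  ∑ s', (P z.1 z.2 s').toReal * (f s' - kmean P z f) ^ 2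

theorem PMF.sum_toReal_eq_one {α : Type*} [Fintype α] (p : PMF α) : ∑ a, (p a).toReal = 1 := by
  rw [← ENNReal.toReal_sum (fun a _ => p.apply_ne_top a), ← tsum_fintype (L := .unconditional _),
    p.tsum_coe, ENNReal.toReal_one]

theorem stepLaw_apply {S A : ℕ} (P : Transition S A) (L : Learner S A) (n : ℕ)
    (h : (i : Iic n) → Fin S × Fin A) (z : Fin S × Fin A) :
    stepLaw P L n h z =
      P (h ⟨n, Finset.mem_Iic.2 le_rfl⟩).1 (h ⟨n, Finset.mem_Iic.2 le_rfl⟩).2 z.1 *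
        L (n + 1) (fun i => h ⟨i, Finset.mem_Iic.2 (Nat.lt_succ_iff.1 i.2)⟩) z.1 z.2 := by
  obtain ⟨s', a'⟩ := z
  simp only [stepLaw, PMF.bind_apply, PMF.map_apply, tsum_fintype]
  rw [Finset.sum_eq_single s']
  · congr 1
    rw [Finset.sum_eq_single a']
    · simp
    · intro b _ hb
      simp [Ne.symm hb]
    · simp
  · intro b _ hb
    simp [Ne.symm hb]
  · simp

/-- Extension of a finite trajectory, constant after its last entry. -/
def extendTraj {S A : ℕ} (n : ℕ) (h : (i : Iic n) → Fin S × Fin A) : Trajectory S A :=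
  fun i => h ⟨min i n, Finset.mem_Iic.2 (min_le_right _ _)⟩

theorem extendTraj_apply {S A : ℕ} {n i : ℕ} (hi : i ≤ n) (h : (i : Iic n) → Fin S × Fin A) :
    extendTraj n h i = h ⟨i, Finset.mem_Iic.2 hi⟩ := by
  simp [extendTraj, hi]

theorem DependsOn.eq_extendTraj {S A : ℕ} {α : Type*} {n : ℕ} {F : Trajectory S A → α}
    (hF : DependsOn F (Set.Iic n)) (ω : Trajectory S A) :
    F ω = F (extendTraj n (Preorder.frestrictLe n ω)) := by
  apply hF
  intro i hi
  rw [extendTraj_apply hi]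
  rfl

theorem DependsOn.measurable_traj {S A : ℕ} {α : Type*} [MeasurableSpace α] {n : ℕ}
    {F : Trajectory S A → α} (hF : DependsOn F (Set.Iic n)) : Measurable F := by
  have : F = (fun h => F (extendTraj n h)) ∘ Preorder.frestrictLe n := by
    funext ω
    exact hF.eq_extendTraj ω
  rw [this]
  exact (measurable_of_countable _).comp (Preorder.measurable_frestrictLe n)

/-- A real function of finitely many coordinates takes finitely many values, hence is integrable. -/
theorem DependsOn.integrable_traj {S A : ℕ} {n : ℕ} {F : Trajectory S A → ℝ}
    (hF : DependsOn F (Set.Iic n)) (μ : Measure (Trajectory S A)) [IsFiniteMeasure μ] :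
    Integrable F μ := by
  obtain ⟨C, hC⟩ := (Set.finite_range
    (fun h : (i : Iic n) → Fin S × Fin A => ‖F (extendTraj n h)‖)).bddAbove
  refine Integrable.of_bound hF.measurable_traj.aestronglyMeasurable C (ae_of_all _ fun ω => ?_)
  rw [hF.eq_extendTraj ω]
  exact hC ⟨_, rfl⟩

/-- The Markov property in integrated form: given the trajectory up to time `n`, the next state has
law `P (ω n)` and the next action is drawn by the learner. -/
theorem integral_step {S A : ℕ} (P : Transition S A) (L : Learner S A) (s : Fin S) (n : ℕ)
    (F : Trajectory S A → Fin S × Fin A → ℝ)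
    (hF : ∀ z, DependsOn (fun ω => F ω z) (Set.Iic n)) :
    ∫ ω, F ω (ω (n + 1)) ∂(trajLaw P L s) =
      ∫ ω, ∑ s', (P (ω n).1 (ω n).2 s').toReal *
        ∑ a', (L (n + 1) (fun i => ω i) s' a').toReal * F ω (s', a') ∂(trajLaw P L s) := by
  set μ := trajLaw P L s with hμ
  have key : μ.map (Preorder.frestrictLe n) ⊗ₘ (stepKernel P L n) =
      μ.map (fun x => (Preorder.frestrictLe n x, x (n + 1))) :=
    Kernel.map_frestrictLe_trajMeasure_compProd_eq_map_trajMeasure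
      (X := fun _ => Fin S × Fin A) (κ := stepKernel P L) (μ₀ := (initLaw L s).toMeasure) (a := n)
  let f : ((i : Iic n) → Fin S × Fin A) × (Fin S × Fin A) → ℝ := fun p => F (extendTraj n p.1) p.2
  have hf : ∀ ω z, F ω z = f (Preorder.frestrictLe n ω, z) := fun ω z => (hF z).eq_extendTraj ω
  have hmeas : Measurable (fun x : Trajectory S A => (Preorder.frestrictLe n x, x (n + 1))) :=
    (Preorder.measurable_frestrictLe n).prodMk (measurable_pi_apply _)
  have : IsProbabilityMeasure (μ.map (Preorder.frestrictLe n)) :=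
    Measure.isProbabilityMeasure_map (Preorder.measurable_frestrictLe n).aemeasurable
  calc ∫ ω, F ω (ω (n + 1)) ∂μ
      = ∫ ω, f (Preorder.frestrictLe n ω, ω (n + 1)) ∂μ := by simp_rw [hf]
    _ = ∫ p, f p ∂(μ.map (fun x => (Preorder.frestrictLe n x, x (n + 1)))) :=
        (integral_map hmeas.aemeasurable
          (measurable_of_countable f).aestronglyMeasurable).symm
    _ = ∫ h, ∫ z, f (h, z) ∂(stepKernel P L n h) ∂(μ.map (Preorder.frestrictLe n)) := by
        rw [← key]
        exact Measure.integral_compProd Integrable.of_finite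
    _ = ∫ ω, ∫ z, f (Preorder.frestrictLe n ω, z) ∂(stepKernel P L n (Preorder.frestrictLe n ω)) ∂μ :=
        integral_map (Preorder.measurable_frestrictLe n).aemeasurable
          (measurable_of_countable _).aestronglyMeasurable
    _ = _ := by
        congr 1
        funext ω
        have : stepKernel P L n (Preorder.frestrictLe n ω) =
            (stepLaw P L n (Preorder.frestrictLe n ω)).toMeasure := rfl
        rw [this, PMF.integral_eq_sum, Fintype.sum_prod_type]
        refine Finset.sum_congr rfl fun s' _ => ?_
        rw [Finset.mul_sum]
        refine Finset.sum_congr rfl fun a' _ => ?_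
        rw [stepLaw_apply, ENNReal.toReal_mul, ← hf, smul_eq_mul, mul_assoc]
        rfl

/-- `integral_step` for functions of the next state only. -/
theorem integral_step_state {S A : ℕ} (P : Transition S A) (L : Learner S A) (s : Fin S) (n : ℕ)
    (g : Trajectory S A → Fin S → ℝ)
    (hg : DependsOn g (Set.Iic n)) :
    ∫ ω, g ω (ω (n + 1)).1 ∂(trajLaw P L s) = ∫ ω, kmean P (ω n) (g ω) ∂(trajLaw P L s) := by
  rw [integral_step P L s n (fun ω z => g ω z.1)
    (fun z ω ω' h => by simp only [hg h])]
  congr 1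
  funext ω
  refine Finset.sum_congr rfl fun s' _ => ?_
  simp only [← Finset.sum_mul, PMF.sum_toReal_eq_one, one_mul]

theorem map_zero_trajLaw {S A : ℕ} (P : Transition S A) (L : Learner S A) (s : Fin S) :
    (trajLaw P L s).map (fun ω => ω 0) = (initLaw L s).toMeasure := by
  have h1 : (trajLaw P L s).map (Preorder.frestrictLe 0) = (initLaw L s).toMeasure.map
      (MeasurableEquiv.piUnique (fun _ : Iic 0 => Fin S × Fin A)).symm := by
    rw [trajLaw, Kernel.trajMeasure, Measure.map_comp _ _ (by fun_prop),
      Kernel.traj_map_frestrictLe, Kernel.partialTraj_self]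
    exact Measure.id_comp
  have h2 : (fun ω : Trajectory S A => ω 0) =
      (fun h : (i : Iic 0) → Fin S × Fin A => h ⟨0, Finset.mem_Iic.2 le_rfl⟩) ∘
        Preorder.frestrictLe 0 := rfl
  rw [h2, ← Measure.map_map (by fun_prop) (by fun_prop), h1, Measure.map_map (by fun_prop)
    (MeasurableEquiv.measurable _)]
  exact Measure.map_id

theorem ae_fst_zero {S A : ℕ} (P : Transition S A) (L : Learner S A) (s : Fin S) :
    ∀ᵐ ω ∂(trajLaw P L s), (ω 0).1 = s := by
  have : ∀ᵐ z ∂((trajLaw P L s).map (fun ω => ω 0)), z.1 = s := by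
    rw [map_zero_trajLaw, ae_iff, PMF.toMeasure_apply_eq_zero_iff _ (MeasurableSet.of_discrete)]
    rw [Set.disjoint_left]
    intro z hz hz'
    simp [initLaw] at hz
    obtain ⟨a, _, rfl⟩ := hz
    simp at hz'
  exact ae_of_ae_map (measurable_pi_apply 0).aemeasurable this

/-- A learner whose decisions are deterministic takes them almost surely. -/
theorem ae_action_eq {S A : ℕ} (P : Transition S A)
    (act : (n : ℕ) → (Fin n → Fin S × Fin A) → Fin S → Fin A) (s : Fin S) :
    ∀ᵐ ω ∂(trajLaw P (fun n h s => PMF.pure (act n h s)) s), ∀ t : ℕ,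
      (ω t).2 = act t (fun i => ω i) (ω t).1 := by
  classical
  rw [ae_all_iff]
  intro t
  cases t with
  | zero =>
    have : ∀ᵐ z ∂((trajLaw P (fun n h s => PMF.pure (act n h s)) s).map (fun ω => ω 0)),
        z.2 = act 0 Fin.elim0 z.1 := by
      rw [map_zero_trajLaw, ae_iff,
        PMF.toMeasure_apply_eq_zero_iff _ (MeasurableSet.of_discrete), Set.disjoint_left]
      intro z hz hz'
      simp only [initLaw, PMF.pure_map, PMF.mem_support_pure_iff] at hz
      subst hz
      simp at hz'
    filter_upwards [ae_of_ae_map (measurable_pi_apply 0).aemeasurable this] with ω hω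
    rw [hω]
    congr 1
    funext i
    exact i.elim0
  | succ n =>
    set L : Learner S A := fun n h s => PMF.pure (act n h s)
    let F : Trajectory S A → Fin S × Fin A → ℝ := fun ω z =>
      if z.2 = act (n + 1) (fun i => ω i) z.1 then 0 else 1
    have hF : ∀ z, DependsOn (fun ω => F ω z) (Set.Iic n) := by
      intro z ω ω' h
      have : (fun i : Fin (n + 1) => ω i) = fun i : Fin (n + 1) => ω' i :=
        funext fun i => h i (Nat.lt_succ_iff.1 i.2)
      simp only [F, this]
    have h0 : ∫ ω, F ω (ω (n + 1)) ∂(trajLaw P L s) = 0 := by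
      rw [integral_step P L s n F hF]
      have : ∀ ω : Trajectory S A, ∑ s', (P (ω n).1 (ω n).2 s').toReal *
        ∑ a', (L (n + 1) (fun i => ω i) s' a').toReal * F ω (s', a') = 0 := by
        intro ω
        refine Finset.sum_eq_zero fun s' _ => ?_
        rw [Finset.sum_eq_zero, mul_zero]
        intro a' _
        by_cases h : a' = act (n + 1) (fun i => ω i) s'
        · simp [F, h]
        · simp [L, h]
      simp_rw [this, integral_zero]
    have hdep : DependsOn (fun ω => F ω (ω (n + 1))) (Set.Iic (n + 1)) := by
      intro ω ω' h
      have := hF (ω (n + 1)) (fun i hi => h i (le_trans hi (Nat.le_succ n)))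
      simp only at this ⊢
      rw [this, h (n + 1) (Set.mem_Iic.2 le_rfl)]
    rw [integral_eq_zero_iff_of_nonneg (fun ω => by simp only [F]; split_ifs <;> simp)
      (hdep.integrable_traj _)] at h0
    filter_upwards [h0] with ω hω
    by_contra hne
    simp [F, hne] at hω

/-! ### An exponential inequality for martingale sums -/

theorem kmean_const {S A : ℕ} (P : Transition S A) (z : Fin S × Fin A) (c : ℝ) :
    kmean P z (fun _ => c) = c := by
  simp [kmean, ← Finset.sum_mul, PMF.sum_toReal_eq_one]

theorem kmean_add {S A : ℕ} (P : Transition S A) (z : Fin S × Fin A) (f g : Fin S → ℝ) :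
    kmean P z (fun s => f s + g s) = kmean P z f + kmean P z g := by
  simp [kmean, mul_add, Finset.sum_add_distrib]

theorem kmean_sub {S A : ℕ} (P : Transition S A) (z : Fin S × Fin A) (f g : Fin S → ℝ) :
    kmean P z (fun s => f s - g s) = kmean P z f - kmean P z g := by
  simp [kmean, mul_sub, Finset.sum_sub_distrib]

theorem kmean_const_mul {S A : ℕ} (P : Transition S A) (z : Fin S × Fin A) (c : ℝ)
    (f : Fin S → ℝ) : kmean P z (fun s => c * f s) = c * kmean P z f := by
  simp only [kmean, Finset.mul_sum]
  exact Finset.sum_congr rfl fun _ _ => by ring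

theorem kmean_neg {S A : ℕ} (P : Transition S A) (z : Fin S × Fin A)
    (f : Fin S → ℝ) : kmean P z (fun s => - f s) = - kmean P z f := by
  simp [kmean]

theorem kmean_mono {S A : ℕ} (P : Transition S A) (z : Fin S × Fin A) {f g : Fin S → ℝ}
    (h : ∀ s, f s ≤ g s) : kmean P z f ≤ kmean P z g :=
  Finset.sum_le_sum fun s _ => mul_le_mul_of_nonneg_left (h s) ENNReal.toReal_nonneg

theorem kvar_eq {S A : ℕ} (P : Transition S A) (z : Fin S × Fin A) (f : Fin S → ℝ) :
    kvar P z f = kmean P z (fun s => (f s - kmean P z f) ^ 2) := rfl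

theorem kvar_eq_sub {S A : ℕ} (P : Transition S A) (z : Fin S × Fin A) (f : Fin S → ℝ) :
    kvar P z f = kmean P z (fun s => f s ^ 2) - kmean P z f ^ 2 := by
  set m := kmean P z f with hm
  have h : (fun s => (f s - m) ^ 2) = fun s => (f s ^ 2 - (2 * m) * f s) + m ^ 2 := by
    funext s; ring
  rw [kvar_eq, ← hm, h, kmean_add, kmean_sub, kmean_const_mul, kmean_const, ← hm]
  ring

theorem kvar_nonneg {S A : ℕ} (P : Transition S A) (z : Fin S × Fin A) (f : Fin S → ℝ) :
    0 ≤ kvar P z f :=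
  Finset.sum_nonneg fun _ _ => mul_nonneg ENNReal.toReal_nonneg (sq_nonneg _)

theorem kvar_neg {S A : ℕ} (P : Transition S A) (z : Fin S × Fin A) (f : Fin S → ℝ) :
    kvar P z (fun s => - f s) = kvar P z f := by
  simp [kvar_eq_sub, kmean_neg]

theorem abs_sub_kmean_le {S A : ℕ} (P : Transition S A) (z : Fin S × Fin A) {f : Fin S → ℝ}
    {B : ℝ} (h : ∀ s s', |f s - f s'| ≤ B) (s : Fin S) : |f s - kmean P z f| ≤ B := by
  rw [abs_le]
  constructor
  · have := kmean_mono P z (f := f) (g := fun _ => f s + B) (fun s' => by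
      have := (abs_le.1 (h s' s)).2; linarith)
    rw [kmean_const] at this
    linarith
  · have := kmean_mono P z (f := fun _ => f s - B) (g := f) (fun s' => by
      have := (abs_le.1 (h s s')).2; linarith)
    rw [kmean_const] at this
    linarith

theorem kvar_le_sq {S A : ℕ} (P : Transition S A) (z : Fin S × Fin A) {f : Fin S → ℝ}
    {B : ℝ} (h : ∀ s s', |f s - f s'| ≤ B) : kvar P z f ≤ B ^ 2 := by
  rw [kvar_eq, ← kmean_const P z (B ^ 2)]
  exact kmean_mono P z fun s => sq_le_sq.2 ((abs_sub_kmean_le P z h s).trans (le_abs_self B))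

theorem kmean_exp_le {S A : ℕ} (P : Transition S A) (z : Fin S × Fin A) (f : Fin S → ℝ) (l : ℝ)
    (h : ∀ s, |l * (f s - kmean P z f)| ≤ 1) :
    kmean P z (fun s => Real.exp (l * (f s - kmean P z f) - l ^ 2 * kvar P z f)) ≤ 1 := by
  have h1 : kmean P z (fun s => Real.exp (l * (f s - kmean P z f))) ≤ 1 + l ^ 2 * kvar P z f := by
    calc kmean P z (fun s => Real.exp (l * (f s - kmean P z f)))
        ≤ kmean P z (fun s => (1 + l * (f s - kmean P z f)) + l ^ 2 * (f s - kmean P z f) ^ 2) := by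
          apply kmean_mono
          intro s
          have := (abs_le.1 (Real.abs_exp_sub_one_sub_id_le (h s))).2
          nlinarith
      _ = 1 + l ^ 2 * kvar P z f := by
          rw [kmean_add, kmean_add, kmean_const_mul, kmean_const_mul, kmean_sub, kmean_const,
            kmean_const, kvar_eq]
          ring
  have h2 : (fun s => Real.exp (l * (f s - kmean P z f) - l ^ 2 * kvar P z f)) =
      fun s => Real.exp (-(l ^ 2 * kvar P z f)) * Real.exp (l * (f s - kmean P z f)) := by
    funext s
    rw [← Real.exp_add]
    congr 1
    ring
  rw [h2, kmean_const_mul]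
  calc Real.exp (-(l ^ 2 * kvar P z f)) * kmean P z (fun s => Real.exp (l * (f s - kmean P z f)))
      ≤ Real.exp (-(l ^ 2 * kvar P z f)) * Real.exp (l ^ 2 * kvar P z f) := by
        apply mul_le_mul_of_nonneg_left _ (Real.exp_pos _).le
        have := Real.add_one_le_exp (l ^ 2 * kvar P z f)
        linarith
    _ = 1 := by rw [← Real.exp_add]; simp

/-- The martingale difference `φ_t(s_{t+1}) - 𝔼[φ_t(s_{t+1}) | s_t, a_t]`. -/
def mdiff {S A : ℕ} (P : Transition S A) (φ : ℕ → Trajectory S A → Fin S → ℝ) (t : ℕ)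
    (ω : Trajectory S A) : ℝ := φ t ω (ω (t + 1)).1 - kmean P (ω t) (φ t ω)

theorem integral_exp_le_one {S A : ℕ} (P : Transition S A) (L : Learner S A) (s : Fin S)
    (φ : ℕ → Trajectory S A → Fin S → ℝ) (hφ : ∀ t, DependsOn (φ t) (Set.Iic t)) (l : ℝ)
    (hl : ∀ t ω s', |l * (φ t ω s' - kmean P (ω t) (φ t ω))| ≤ 1) (T : ℕ) :
    DependsOn (fun ω => Real.exp (∑ t ∈ range T,
      (l * mdiff P φ t ω - l ^ 2 * kvar P (ω t) (φ t ω)))) (Set.Iic T) ∧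
    ∫ ω, Real.exp (∑ t ∈ range T,
      (l * mdiff P φ t ω - l ^ 2 * kvar P (ω t) (φ t ω))) ∂(trajLaw P L s) ≤ 1 := by
  have hdep : ∀ T, DependsOn (fun ω => Real.exp (∑ t ∈ range T,
      (l * mdiff P φ t ω - l ^ 2 * kvar P (ω t) (φ t ω)))) (Set.Iic T) := by
    intro T ω ω' h
    simp only
    congr 1
    refine Finset.sum_congr rfl fun t ht => ?_
    have ht' := Finset.mem_range.1 ht
    have e1 : φ t ω = φ t ω' := hφ t fun i hi => h i (le_trans hi ht'.le)
    have e2 : ω t = ω' t := h t ht'.le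
    have e3 : ω (t + 1) = ω' (t + 1) := h (t + 1) ht'
    rw [mdiff, mdiff, e1, e2, e3]
  refine ⟨hdep T, ?_⟩
  induction T with
  | zero => simp
  | succ n ih =>
    let G : Trajectory S A → ℝ := fun ω => Real.exp (∑ t ∈ range n,
      (l * mdiff P φ t ω - l ^ 2 * kvar P (ω t) (φ t ω)))
    let g : Trajectory S A → Fin S → ℝ := fun ω s' => G ω *
      Real.exp (l * (φ n ω s' - kmean P (ω n) (φ n ω)) - l ^ 2 * kvar P (ω n) (φ n ω))
    have hg : DependsOn g (Set.Iic n) := by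
      intro ω ω' h
      have e1 : φ n ω = φ n ω' := hφ n h
      have e2 : ω n = ω' n := h n (Set.mem_Iic.2 le_rfl)
      have e3 : G ω = G ω' := hdep n h
      simp only [g, e1, e2, e3]
    have heq : (fun ω => Real.exp (∑ t ∈ range (n + 1),
      (l * mdiff P φ t ω - l ^ 2 * kvar P (ω t) (φ t ω)))) = fun ω => g ω (ω (n + 1)).1 := by
      funext ω
      rw [Finset.sum_range_succ, Real.exp_add]
      rfl
    rw [heq, integral_step_state P L s n g hg]
    refine le_trans (integral_mono ?_ ((hdep n).integrable_traj _) fun ω => ?_) ih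
    · apply DependsOn.integrable_traj (n := n)
      intro ω ω' h
      have e2 : ω n = ω' n := h n (Set.mem_Iic.2 le_rfl)
      simp only [hg h, e2]
    · simp only [g]
      rw [kmean_const_mul]
      exact mul_le_of_le_one_right (Real.exp_pos _).le (kmean_exp_le P (ω n) (φ n ω) l (hl n ω))

/-- Freedman's inequality with a fixed tilting parameter `l`: off an event of probability `e^{-x}`
a martingale sum is at most `l` times its predictable quadratic variation plus `x / l`. -/
theorem freedman {S A : ℕ} (P : Transition S A) (L : Learner S A) (s : Fin S)
    (φ : ℕ → Trajectory S A → Fin S → ℝ) (hφ : ∀ t, DependsOn (φ t) (Set.Iic t)) (l B x : ℝ)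
    (hl0 : 0 < l) (hlB : l * B ≤ 1) (hB : ∀ t ω s s', |φ t ω s - φ t ω s'| ≤ B) (T : ℕ) :
    (trajLaw P L s).real {ω | ¬ ∑ t ∈ range T, mdiff P φ t ω ≤
      l * ∑ t ∈ range T, kvar P (ω t) (φ t ω) + x / l} ≤ Real.exp (-x) := by
  obtain ⟨hdep, hint⟩ := integral_exp_le_one P L s φ hφ l (fun t ω s' => by
    rw [abs_mul, abs_of_pos hl0]
    exact (mul_le_mul_of_nonneg_left (abs_sub_kmean_le P (ω t) (hB t ω) s') hl0.le).trans hlB) T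
  have hmk := mul_meas_ge_le_integral_of_nonneg (μ := trajLaw P L s)
    (ae_of_all _ fun ω => (Real.exp_pos _).le) (hdep.integrable_traj _) (Real.exp x)
  have hsub : {ω | ¬ ∑ t ∈ range T, mdiff P φ t ω ≤
      l * ∑ t ∈ range T, kvar P (ω t) (φ t ω) + x / l} ⊆ {ω | Real.exp x ≤
        Real.exp (∑ t ∈ range T, (l * mdiff P φ t ω - l ^ 2 * kvar P (ω t) (φ t ω)))} := by
    intro ω hω
    simp only [Set.mem_ofPred_eq, not_le] at hω ⊢
    rw [Real.exp_le_exp, Finset.sum_sub_distrib, ← Finset.mul_sum, ← Finset.mul_sum]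
    have h1 := mul_lt_mul_of_pos_left hω hl0
    have h2 : l * (l * ∑ t ∈ range T, kvar P (ω t) (φ t ω) + x / l) =
      l ^ 2 * ∑ t ∈ range T, kvar P (ω t) (φ t ω) + x := by
      field_simp
    linarith
  have h3 := measureReal_mono (μ := trajLaw P L s) hsub
  rw [Real.exp_neg, ← one_div, le_div_iff₀ (Real.exp_pos x), mul_comm]
  calc Real.exp x * _ ≤ _ := mul_le_mul_of_nonneg_left h3 (Real.exp_pos x).le
    _ ≤ 1 := hmk.trans hint

/-! ### The optimality equation of a communicating process -/

/-- The optimal Bellman operator with discount factor `γ`. -/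
def bellman {S A : ℕ} [Nonempty (Fin A)] (P : Transition S A) (r : Fin S → Fin A → ℝ) (γ : ℝ)
    (V : Fin S → ℝ) (s : Fin S) : ℝ :=
  univ.sup' univ_nonempty fun a => r s a + γ * kmean P (s, a) V

theorem le_bellman {S A : ℕ} [Nonempty (Fin A)] (P : Transition S A) (r : Fin S → Fin A → ℝ)
    (γ : ℝ) (V : Fin S → ℝ) (s : Fin S) (a : Fin A) :
    r s a + γ * kmean P (s, a) V ≤ bellman P r γ V s :=
  Finset.le_sup' (fun a => r s a + γ * kmean P (s, a) V) (mem_univ a)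

theorem exists_bellman_eq {S A : ℕ} [Nonempty (Fin A)] (P : Transition S A)
    (r : Fin S → Fin A → ℝ) (γ : ℝ) (V : Fin S → ℝ) (s : Fin S) :
    ∃ a, bellman P r γ V s = r s a + γ * kmean P (s, a) V := by
  obtain ⟨a, _, ha⟩ := Finset.exists_mem_eq_sup' (univ_nonempty (α := Fin A))
    fun a => r s a + γ * kmean P (s, a) V
  exact ⟨a, ha⟩

theorem bellman_sub_le {S A : ℕ} [Nonempty (Fin A)] (P : Transition S A) (r : Fin S → Fin A → ℝ)
    {γ : ℝ} (hγ : 0 ≤ γ) (V W : Fin S → ℝ) (s : Fin S) :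
    bellman P r γ V s - bellman P r γ W s ≤ γ * dist V W := by
  obtain ⟨a, ha⟩ := exists_bellman_eq P r γ V s
  have h1 := le_bellman P r γ W s a
  have h2 : kmean P (s, a) V ≤ kmean P (s, a) W + dist V W := by
    rw [← kmean_const P (s, a) (dist V W), ← kmean_add]
    refine kmean_mono P _ fun s' => ?_
    have := (le_abs_self _).trans ((Real.dist_eq (V s') (W s')).symm.le.trans (dist_le_pi_dist V W s'))
    linarith
  have h3 := mul_le_mul_of_nonneg_left h2 hγ
  rw [ha]
  linarith

theorem exists_discounted_value {S A : ℕ} [Nonempty (Fin A)] (P : Transition S A)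
    (r : Fin S → Fin A → ℝ) {γ : ℝ} (hγ : 0 ≤ γ) (hγ1 : γ < 1) :
    ∃ V : Fin S → ℝ, ∀ s, bellman P r γ V s = V s := by
  have hc : ContractingWith ⟨γ, hγ⟩ (bellman P r γ) := by
    refine ⟨by exact_mod_cast hγ1, LipschitzWith.of_dist_le_mul fun V W => ?_⟩
    refine (dist_pi_le_iff (mul_nonneg hγ dist_nonneg)).2 fun s => ?_
    rw [Real.dist_eq, abs_le]
    have h1 := bellman_sub_le P r hγ V W s
    have h2 := bellman_sub_le P r hγ W V s
    rw [dist_comm W V] at h2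
    change -(γ * dist V W) ≤ _ ∧ _ ≤ γ * dist V W
    exact ⟨by linarith, by linarith⟩
  exact ⟨hc.fixedPoint, fun s => congrFun hc.fixedPoint_isFixedPt s⟩

theorem discounted_value_nonneg {S A : ℕ} [Nonempty (Fin S)] [Nonempty (Fin A)]
    {P : Transition S A} {r : Fin S → Fin A → ℝ} (hr : ∀ s a, r s a ∈ Set.Icc (0 : ℝ) 1)
    {γ : ℝ} (hγ : 0 ≤ γ) (hγ1 : γ < 1) {V : Fin S → ℝ} (hV : ∀ s, bellman P r γ V s = V s)
    (s : Fin S) : 0 ≤ V s := by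
  obtain ⟨m, hm⟩ := Finite.exists_min V
  have a : Fin A := Classical.arbitrary _
  have h1 := le_bellman P r γ V m a
  rw [hV] at h1
  have h2 := kmean_mono P (m, a) (f := fun _ => V m) (g := V) hm
  rw [kmean_const] at h2
  have h3 := (hr m a).1
  have h4 := mul_le_mul_of_nonneg_left h2 hγ
  have : 0 ≤ V m := by nlinarith
  exact this.trans (hm s)

theorem discounted_value_le {S A : ℕ} [Nonempty (Fin S)] [Nonempty (Fin A)]
    {P : Transition S A} {r : Fin S → Fin A → ℝ} (hr : ∀ s a, r s a ∈ Set.Icc (0 : ℝ) 1)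
    {γ : ℝ} (hγ : 0 ≤ γ) (hγ1 : γ < 1) {V : Fin S → ℝ} (hV : ∀ s, bellman P r γ V s = V s)
    (s : Fin S) : (1 - γ) * V s ≤ 1 := by
  obtain ⟨m, hm⟩ := Finite.exists_max V
  obtain ⟨a, h1⟩ := exists_bellman_eq P r γ V m
  rw [hV] at h1
  have h2 := kmean_mono P (m, a) (f := V) (g := fun _ => V m) hm
  rw [kmean_const] at h2
  have h3 := (hr m a).2
  have h4 := mul_le_mul_of_nonneg_left h2 hγ
  have h5 := mul_le_mul_of_nonneg_left (hm s) (sub_pos.2 hγ1).le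
  nlinarith

/-- Indicator that the state `x` is not visited at the times `0, …, k`. -/
def notHit {S A : ℕ} (x : Fin S) (k : ℕ) (ω : Trajectory S A) : ℝ :=
  if ∀ u ≤ k, (ω u).1 ≠ x then 1 else 0

theorem dependsOn_notHit {S A : ℕ} (x : Fin S) (k : ℕ) :
    DependsOn (notHit (A := A) x k) (Set.Iic k) := by
  intro ω ω' h
  have : (∀ u ≤ k, (ω u).1 ≠ x) ↔ ∀ u ≤ k, (ω' u).1 ≠ x :=
    forall₂_congr fun u hu => by rw [h u hu]
  simp only [notHit, this]

theorem sum_notHit_le {S A : ℕ} (x : Fin S) (n : ℕ) (ω : Trajectory S A) :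
    ENNReal.ofReal (∑ k ∈ range n, notHit x k ω) ≤ hittingSteps x ω := by
  refine le_iInf₂ fun m hm => ?_
  have h : ∑ k ∈ range n, notHit x k ω ≤ m := by
    calc ∑ k ∈ range n, notHit x k ω ≤ ∑ k ∈ range n, if k < m then (1 : ℝ) else 0 := by
          refine Finset.sum_le_sum fun k _ => ?_
          unfold notHit
          split_ifs with h1 h2 h2
          · exact le_rfl
          · exact absurd hm (h1 m (not_lt.1 h2))
          · exact zero_le_one
          · exact le_rfl
      _ = ((range n).filter (· < m)).card := by simp
      _ ≤ ((range m).card : ℝ) := by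
          exact_mod_cast Finset.card_le_card fun k hk => by
            simp only [Finset.mem_filter, Finset.mem_range] at hk ⊢
            exact hk.2
      _ = m := by simp
  exact (ENNReal.ofReal_le_ofReal h).trans (by simp)

/-- Travelling from `y` to `x` costs at most one unit of discounted reward per step. -/
theorem discounted_value_sub_le {S A : ℕ} [Nonempty (Fin S)] [Nonempty (Fin A)]
    {P : Transition S A} {r : Fin S → Fin A → ℝ} (hr : ∀ s a, r s a ∈ Set.Icc (0 : ℝ) 1)
    {γ : ℝ} (hγ : 0 ≤ γ) (hγ1 : γ < 1) {V : Fin S → ℝ} (hV : ∀ s, bellman P r γ V s = V s)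
    (π : Policy S A) (x y : Fin S) {c : ℝ} (hc : 0 ≤ c)
    (hπ : expectedTravelTime P π y x ≤ ENNReal.ofReal c) : V x - V y ≤ c := by
  have hV0 := discounted_value_nonneg hr hγ hγ1 hV
  have hV1 := discounted_value_le hr hγ hγ1 hV
  set μ := trajLaw P π.toLearner y with hμ
  let w : ℕ → Trajectory S A → ℝ := fun k ω => (if ∀ u < k, (ω u).1 ≠ x then 1 else 0)
  have hw : ∀ k ω, w (k + 1) ω = notHit x k ω := fun k ω => by
    simp only [w, notHit, Nat.lt_succ_iff]
  let b : ℕ → Trajectory S A → ℝ := fun k ω => w k ω * (γ ^ k * (V x - V (ω k).1))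
  have hwdep : ∀ k, DependsOn (w k) (Set.Iic k) := by
    intro k ω ω' h
    have : (∀ u < k, (ω u).1 ≠ x) ↔ ∀ u < k, (ω' u).1 ≠ x :=
      forall₂_congr fun u hu => by rw [h u (Set.mem_Iic.2 hu.le)]
    simp only [w, this]
  have hbdep : ∀ k, DependsOn (b k) (Set.Iic k) := by
    intro k ω ω' h
    simp only [b, hwdep k h, h k (Set.mem_Iic.2 le_rfl)]
  have hstep : ∀ k, ∫ ω, b k ω ∂μ ≤ ∫ ω, b (k + 1) ω ∂μ + ∫ ω, notHit x k ω ∂μ := by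
    intro k
    let g : Trajectory S A → Fin S → ℝ := fun ω s' => notHit x k ω * (γ ^ (k + 1) * (V x - V s'))
    have hg : DependsOn g (Set.Iic k) := by
      intro ω ω' h
      simp only [g, dependsOn_notHit x k h]
    have h1 : ∫ ω, b (k + 1) ω ∂μ = ∫ ω, kmean P (ω k) (g ω) ∂μ := by
      rw [← integral_step_state P _ y k g hg]
      simp only [b, hw, g]
      rfl
    have hkdep : DependsOn (fun ω => kmean P (ω k) (g ω)) (Set.Iic k) := by
      intro ω ω' h
      simp only [hg h, h k (Set.mem_Iic.2 le_rfl)]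
    rw [h1, ← integral_add (hkdep.integrable_traj μ) ((dependsOn_notHit x k).integrable_traj μ)]
    refine integral_mono ((hbdep k).integrable_traj μ) ((hkdep.integrable_traj μ).add
      ((dependsOn_notHit x k).integrable_traj μ)) fun ω => ?_
    have e1 : kmean P (ω k) (g ω) = notHit x k ω * (γ ^ (k + 1) * (V x - kmean P (ω k) V)) := by
      simp only [g]
      rw [kmean_const_mul, kmean_const_mul, kmean_sub, kmean_const]
    rw [e1]
    have hpow : γ ^ k ≤ 1 := pow_le_one₀ hγ hγ1.le
    have hpow0 : 0 ≤ γ ^ k := pow_nonneg hγ k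
    by_cases hh : ∀ u ≤ k, (ω u).1 ≠ x
    · have hh' : ∀ u < k, (ω u).1 ≠ x := fun u hu => hh u hu.le
      simp only [b, w, notHit, if_pos hh, if_pos hh', one_mul]
      have h2 := le_bellman P r γ V (ω k).1 (ω k).2
      rw [hV] at h2
      have h3 := (hr (ω k).1 (ω k).2).1
      have h4 : V x - V (ω k).1 ≤ γ * (V x - kmean P (ω k) V) + (1 - γ) * V x := by linarith
      have h5 := mul_le_mul_of_nonneg_left h4 hpow0
      have h6 : γ ^ k * ((1 - γ) * V x) ≤ 1 :=
        mul_le_one₀ hpow (mul_nonneg (sub_pos.2 hγ1).le (hV0 x)) (hV1 x)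
      rw [pow_succ]
      nlinarith
    · simp only [notHit, if_neg hh, b, w, zero_mul, add_zero]
      by_cases hh' : ∀ u < k, (ω u).1 ≠ x
      · have : (ω k).1 = x := by
          by_contra hne
          exact hh fun u hu => (lt_or_eq_of_le hu).elim (hh' u) fun e => e ▸ hne
        rw [this]
        simp
      · rw [if_neg hh', zero_mul]
  have hiter : ∀ n, ∫ ω, b 0 ω ∂μ ≤ ∫ ω, b n ω ∂μ + ∑ k ∈ range n, ∫ ω, notHit x k ω ∂μ := by
    intro n
    induction n with
    | zero => simp
    | succ n ih =>
      rw [Finset.sum_range_succ]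
      linarith [hstep n]
  have h0 : ∫ ω, b 0 ω ∂μ = V x - V y := by
    have : b 0 =ᵐ[μ] fun _ => V x - V y := by
      filter_upwards [ae_fst_zero P π.toLearner y] with ω hω
      simp [b, w, hω]
    rw [integral_congr_ae this]
    simp
  have hsum : ∀ n, ∑ k ∈ range n, ∫ ω, notHit x k ω ∂μ ≤ c := by
    intro n
    rw [← integral_finsetSum _ fun k _ => (dependsOn_notHit x k).integrable_traj μ]
    have hnn : ∀ ω : Trajectory S A, 0 ≤ ∑ k ∈ range n, notHit x k ω := fun ω =>
      Finset.sum_nonneg fun k _ => by unfold notHit; split_ifs <;> simp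
    have hint : Integrable (fun ω => ∑ k ∈ range n, notHit x k ω) μ :=
      integrable_finsetSum _ fun k _ => (dependsOn_notHit x k).integrable_traj μ
    rw [integral_eq_lintegral_of_nonneg_ae (ae_of_all _ hnn) hint.aestronglyMeasurable]
    refine ENNReal.toReal_le_of_le_ofReal hc (le_trans ?_ hπ)
    exact lintegral_mono fun ω => sum_notHit_le x n ω
  have hbn : ∀ n, ∫ ω, b n ω ∂μ ≤ γ ^ n * V x := by
    intro n
    calc ∫ ω, b n ω ∂μ ≤ ∫ _, γ ^ n * V x ∂μ := by
          refine integral_mono ((hbdep n).integrable_traj μ) (integrable_const _) fun ω => ?_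
          have h1 : 0 ≤ γ ^ n := pow_nonneg hγ n
          simp only [b, w]
          split_ifs
          · rw [one_mul]
            exact mul_le_mul_of_nonneg_left (by linarith [hV0 (ω n).1]) h1
          · rw [zero_mul]
            exact mul_nonneg h1 (hV0 x)
      _ = γ ^ n * V x := by simp
  have hlim : Tendsto (fun n : ℕ => γ ^ n * V x + c) atTop (𝓝 (0 * V x + c)) :=
    ((tendsto_pow_atTop_nhds_zero_of_lt_one hγ hγ1).mul_const _).add_const _
  rw [zero_mul, zero_add] at hlim
  refine ge_of_tendsto' hlim fun n => ?_
  have := hiter n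
  rw [h0] at this
  linarith [hsum n, hbn n]

/-- The span of the discounted value functions is at most the diameter, whatever the discount
factor. -/
theorem discounted_value_span_le {S A : ℕ} [Nonempty (Fin S)] [Nonempty (Fin A)]
    {P : Transition S A} {r : Fin S → Fin A → ℝ} (hr : ∀ s a, r s a ∈ Set.Icc (0 : ℝ) 1)
    {γ : ℝ} (hγ : 0 ≤ γ) (hγ1 : γ < 1) {V : Fin S → ℝ} (hV : ∀ s, bellman P r γ V s = V s)
    {D : ℝ} (hD0 : 0 ≤ D) (hD : diameter P = ENNReal.ofReal D) (x y : Fin S) :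
    V x - V y ≤ D := by
  by_cases hxy : y = x
  · simp [hxy, hD0]
  refine le_of_forall_pos_le_add fun ε hε => ?_
  have h1 : ⨅ π : Policy S A, expectedTravelTime P π y x < ENNReal.ofReal (D + ε) := by
    refine lt_of_le_of_lt ?_ ((ENNReal.ofReal_lt_ofReal_iff (by linarith)).2
      (lt_add_of_pos_right D hε))
    rw [← hD]
    exact le_iSup_of_le y (le_iSup_of_le x (le_iSup_of_le hxy le_rfl))
  obtain ⟨π, hπ⟩ := iInf_lt_iff.1 h1
  exact discounted_value_sub_le hr hγ hγ1 hV π x y (by linarith) hπ.le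

theorem continuous_kmean {S A : ℕ} (P : Transition S A) (z : Fin S × Fin A) :
    Continuous (kmean P z) := by
  unfold kmean
  fun_prop

/-- A pair made of a gain `ρ` and a bias function `h` solving the average-reward optimality
equation, normalized so that `h` takes values in `[0, D]`. -/
structure IsOptimalPair {S A : ℕ} (P : Transition S A) (r : Fin S → Fin A → ℝ) (D : ℝ) (ρ : ℝ)
    (h : Fin S → ℝ) : Prop where
  gain_nonneg : 0 ≤ ρ
  gain_le : ρ ≤ 1
  nonneg : ∀ s, 0 ≤ h s
  le : ∀ s, h s ≤ D
  ge_action : ∀ s a, r s a + kmean P (s, a) h ≤ h s + ρ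
  exists_action : ∀ s, ∃ a, h s + ρ ≤ r s a + kmean P (s, a) h

/-- Existence of an optimal pair by the vanishing discount method. -/
theorem exists_isOptimalPair {S A : ℕ} [Nonempty (Fin S)] [Nonempty (Fin A)]
    (P : Transition S A) {r : Fin S → Fin A → ℝ} (hr : ∀ s a, r s a ∈ Set.Icc (0 : ℝ) 1)
    {D : ℝ} (hD0 : 0 ≤ D) (hD : diameter P = ENNReal.ofReal D) :
    ∃ ρ h, IsOptimalPair P r D ρ h := by
  let γ : ℕ → ℝ := fun n => 1 - 1 / ((n : ℝ) + 1)
  have hγ : ∀ n, 0 ≤ γ n := fun n => by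
    have : 1 / ((n : ℝ) + 1) ≤ 1 := by
      rw [div_le_one (by positivity)]
      linarith [(Nat.cast_nonneg n : (0 : ℝ) ≤ n)]
    simp only [γ]; linarith
  have hγ1 : ∀ n, γ n < 1 := fun n => by
    have : 0 < 1 / ((n : ℝ) + 1) := by positivity
    simp only [γ]; linarith
  choose V hV using fun n => exists_discounted_value P r (hγ n) (hγ1 n)
  choose m hm using fun n => Finite.exists_min (V n)
  let ρ : ℕ → ℝ := fun n => (1 - γ n) * V n (m n)
  let h : ℕ → Fin S → ℝ := fun n s => V n s - V n (m n)
  have hmem : ∀ n, (ρ n, h n) ∈ Set.Icc (0 : ℝ) 1 ×ˢ Set.Icc (0 : Fin S → ℝ) (fun _ => D) := by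
    intro n
    refine ⟨⟨mul_nonneg (sub_pos.2 (hγ1 n)).le
      (discounted_value_nonneg hr (hγ n) (hγ1 n) (hV n) _),
      discounted_value_le hr (hγ n) (hγ1 n) (hV n) _⟩, fun s => sub_nonneg.2 (hm n s), fun s =>
      discounted_value_span_le hr (hγ n) (hγ1 n) (hV n) hD0 hD s (m n)⟩
  obtain ⟨⟨ρ', h'⟩, hmem', φ, hφ, hlim⟩ :=
    (isCompact_Icc.prod isCompact_Icc).tendsto_subseq hmem
  have hρ : Tendsto (fun n => ρ (φ n)) atTop (𝓝 ρ') := (continuous_fst.tendsto _).comp hlim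
  have hh : Tendsto (fun n => h (φ n)) atTop (𝓝 h') := (continuous_snd.tendsto _).comp hlim
  have hγlim : Tendsto (fun n => γ (φ n)) atTop (𝓝 1) := by
    have h1 : Tendsto γ atTop (𝓝 (1 - 0)) :=
      tendsto_const_nhds.sub tendsto_one_div_add_atTop_nhds_zero_nat
    rw [sub_zero] at h1
    exact h1.comp hφ.tendsto_atTop
  have hl : ∀ s, Tendsto (fun n => h (φ n) s + ρ (φ n)) atTop (𝓝 (h' s + ρ')) := fun s =>
    (((continuous_apply s).tendsto _).comp hh).add hρ
  have hrr : ∀ s a, Tendsto (fun n => r s a + γ (φ n) * kmean P (s, a) (h (φ n))) atTop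
      (𝓝 (r s a + kmean P (s, a) h')) := fun s a => by
    have := (hγlim.mul (((continuous_kmean P (s, a)).tendsto _).comp hh)).const_add (r s a)
    rwa [one_mul] at this
  have hk : ∀ n s a, kmean P (s, a) (h n) = kmean P (s, a) (V n) - V n (m n) := fun n s a => by
    simp only [h]
    rw [kmean_sub, kmean_const]
  refine ⟨ρ', h', hmem'.1.1, hmem'.1.2, hmem'.2.1, hmem'.2.2, fun s a => ?_, fun s => ?_⟩
  · refine le_of_tendsto_of_tendsto' (hrr s a) (hl s) fun n => ?_
    have := le_bellman P r (γ (φ n)) (V (φ n)) s a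
    rw [hV] at this
    rw [hk]
    simp only [h, ρ]
    linarith
  · by_contra hne
    push Not at hne
    have hev : ∀ᶠ n in atTop, ∀ a, r s a + γ (φ n) * kmean P (s, a) (h (φ n)) <
        h (φ n) s + ρ (φ n) :=
      eventually_all.2 fun a => (hrr s a).eventually_lt (hl s) (hne a)
    obtain ⟨n, hn⟩ := hev.exists
    obtain ⟨a, ha⟩ := exists_bellman_eq P r (γ (φ n)) (V (φ n)) s
    rw [hV] at ha
    have := hn a
    rw [hk] at this
    simp only [h, ρ] at this
    linarith

/-- No learner does better than the gain of an optimal pair, up to the span of its bias. -/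
theorem IsOptimalPair.integral_totalReward_le {S A : ℕ} {P : Transition S A}
    {r : Fin S → Fin A → ℝ} {D ρ : ℝ} {h : Fin S → ℝ} (hp : IsOptimalPair P r D ρ h)
    (L : Learner S A) (s : Fin S) (T : ℕ) :
    ∫ ω, totalReward r T ω ∂(trajLaw P L s) ≤ T * ρ + D := by
  set μ := trajLaw P L s
  have hdh : ∀ t : ℕ, DependsOn (fun ω : Trajectory S A => h (ω t).1) (Set.Iic t) :=
    fun t ω ω' e => by simp only [e t (Set.mem_Iic.2 le_rfl)]
  have hdk : ∀ t : ℕ, DependsOn (fun ω : Trajectory S A => kmean P (ω t) h) (Set.Iic t) :=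
    fun t ω ω' e => by simp only [e t (Set.mem_Iic.2 le_rfl)]
  have hdr : ∀ t : ℕ, DependsOn (fun ω : Trajectory S A => r (ω t).1 (ω t).2) (Set.Iic t) :=
    fun t ω ω' e => by simp only [e t (Set.mem_Iic.2 le_rfl)]
  have key : ∀ T : ℕ, ∫ ω, totalReward r T ω ∂μ ≤
      T * ρ + ∫ ω, h (ω 0).1 ∂μ - ∫ ω, h (ω T).1 ∂μ := by
    intro T
    induction T with
    | zero => simp [totalReward]
    | succ n ih =>
      have e1 : ∫ ω, totalReward r (n + 1) ω ∂μ =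
          ∫ ω, totalReward r n ω ∂μ + ∫ ω, r (ω n).1 (ω n).2 ∂μ := by
        rw [← integral_add]
        · simp only [totalReward, Finset.sum_range_succ]
        · exact integrable_finsetSum _ fun t _ => (hdr t).integrable_traj μ
        · exact (hdr n).integrable_traj μ
      have e2 : ∫ ω, r (ω n).1 (ω n).2 ∂μ ≤
          ρ + ∫ ω, h (ω n).1 ∂μ - ∫ ω, h (ω (n + 1)).1 ∂μ := by
        have e3 : ∫ ω, h (ω (n + 1)).1 ∂μ = ∫ ω, kmean P (ω n) h ∂μ :=
          integral_step_state P L s n (fun _ => h) (fun _ _ _ => rfl)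
        have i1 : Integrable (fun ω : Trajectory S A => ρ + h (ω n).1) μ :=
          (integrable_const _).add ((hdh n).integrable_traj μ)
        calc ∫ ω, r (ω n).1 (ω n).2 ∂μ
            ≤ ∫ ω, (ρ + h (ω n).1 - kmean P (ω n) h) ∂μ := by
              refine integral_mono ((hdr n).integrable_traj μ)
                (i1.sub ((hdk n).integrable_traj μ)) fun ω => ?_
              have := hp.ge_action (ω n).1 (ω n).2
              simp only
              linarith
          _ = ρ + ∫ ω, h (ω n).1 ∂μ - ∫ ω, h (ω (n + 1)).1 ∂μ := by
              rw [integral_sub i1 ((hdk n).integrable_traj μ),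
                integral_add (integrable_const _) ((hdh n).integrable_traj μ), e3]
              simp
      rw [e1]
      push_cast
      linarith
  have h0 : ∫ ω, h (ω 0).1 ∂μ ≤ D := by
    calc ∫ ω, h (ω 0).1 ∂μ ≤ ∫ _, D ∂μ :=
          integral_mono ((hdh 0).integrable_traj μ) (integrable_const _) fun ω => hp.le _
      _ = D := by simp
  have h1 : 0 ≤ ∫ ω, h (ω T).1 ∂μ := integral_nonneg fun ω => hp.nonneg _
  linarith [key T]

theorem IsOptimalPair.optAverageReward_le {S A : ℕ} {P : Transition S A}
    {r : Fin S → Fin A → ℝ} {D ρ : ℝ} {h : Fin S → ℝ} (hp : IsOptimalPair P r D ρ h)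
    (s : Fin S) : optAverageReward P r s ≤ ρ := by
  refine Real.sSup_le ?_ hp.gain_nonneg
  rintro x ⟨π, hπ⟩
  have hlim : Tendsto (fun T : ℕ => ρ + D * (1 / (T : ℝ))) atTop (𝓝 (ρ + D * 0)) :=
    tendsto_const_nhds.add (tendsto_one_div_atTop_nhds_zero_nat.const_mul D)
  rw [mul_zero, add_zero] at hlim
  refine le_of_tendsto_of_tendsto hπ hlim ?_
  filter_upwards [eventually_gt_atTop 0] with T hT
  have hT' : (0 : ℝ) < T := by exact_mod_cast hT
  have := mul_le_mul_of_nonneg_left (hp.integral_totalReward_le π.toLearner s T)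
    (one_div_pos.2 hT').le
  refine this.trans (le_of_eq ?_)
  field_simp

/-! ### Means and variances under close weights -/

/-- Mean of `f` under the weights `p`. -/
def wmean {S : ℕ} (p f : Fin S → ℝ) : ℝ := ∑ s, p s * f s

/-- Variance of `f` under the weights `p`. -/
def wvar {S : ℕ} (p f : Fin S → ℝ) : ℝ := ∑ s, p s * (f s - wmean p f) ^ 2

theorem wvar_nonneg {S : ℕ} {p : Fin S → ℝ} (hp : ∀ s, 0 ≤ p s) (f : Fin S → ℝ) :
    0 ≤ wvar p f := Finset.sum_nonneg fun s _ => mul_nonneg (hp s) (sq_nonneg _)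

theorem wmean_add {S : ℕ} (p f g : Fin S → ℝ) :
    wmean p (fun s => f s + g s) = wmean p f + wmean p g := by
  simp [wmean, mul_add, Finset.sum_add_distrib]

theorem wvar_le_of_sum_eq_one {S : ℕ} {p : Fin S → ℝ} (h1 : ∑ s, p s = 1)
    (f : Fin S → ℝ) (c : ℝ) : wvar p f ≤ ∑ s, p s * (f s - c) ^ 2 := by
  have : ∑ s, p s * (f s - c) ^ 2 = wvar p f + (wmean p f - c) ^ 2 := by
    have h2 : ∀ s, p s * (f s - c) ^ 2 = p s * (f s - wmean p f) ^ 2 +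
        (2 * (wmean p f - c)) * (p s * f s) +
        p s * ((wmean p f - c) ^ 2 - 2 * (wmean p f - c) * wmean p f) := fun s => by ring
    rw [Finset.sum_congr rfl fun s _ => h2 s, Finset.sum_add_distrib, Finset.sum_add_distrib,
      ← Finset.mul_sum, ← Finset.sum_mul, h1, wvar]
    have : ∑ s, p s * f s = wmean p f := rfl
    rw [this]
    ring
  rw [this]
  linarith [sq_nonneg (wmean p f - c)]

theorem wmean_mem_Icc {S : ℕ} {p : Fin S → ℝ} (hp : ∀ s, 0 ≤ p s) (h1 : ∑ s, p s = 1)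
    {f : Fin S → ℝ} {a b : ℝ} (hf : ∀ s, f s ∈ Set.Icc a b) : wmean p f ∈ Set.Icc a b := by
  constructor
  · calc a = ∑ s, p s * a := by rw [← Finset.sum_mul, h1, one_mul]
      _ ≤ _ := Finset.sum_le_sum fun s _ => mul_le_mul_of_nonneg_left (hf s).1 (hp s)
  · calc wmean p f ≤ ∑ s, p s * b :=
        Finset.sum_le_sum fun s _ => mul_le_mul_of_nonneg_left (hf s).2 (hp s)
      _ = b := by rw [← Finset.sum_mul, h1, one_mul]

/-- If the weights `p` are at most `2 q + a` then variances compare likewise. -/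
theorem wvar_le_two_mul_wvar {S : ℕ} {p q : Fin S → ℝ} (h1 : ∑ s, p s = 1)
    (hq : ∀ s, 0 ≤ q s) (hq1 : ∑ s, q s = 1) {a B : ℝ} (ha : 0 ≤ a)
    (hpq : ∀ s, p s ≤ 2 * q s + a) {f : Fin S → ℝ} (hf : ∀ s, f s ∈ Set.Icc 0 B) :
    wvar p f ≤ 2 * wvar q f + S * a * B ^ 2 := by
  have hm := wmean_mem_Icc hq hq1 hf
  calc wvar p f ≤ ∑ s, p s * (f s - wmean q f) ^ 2 := wvar_le_of_sum_eq_one h1 f _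
    _ ≤ ∑ s, (2 * (q s * (f s - wmean q f) ^ 2) + a * B ^ 2) := by
        refine Finset.sum_le_sum fun s _ => ?_
        have h2 := mul_le_mul_of_nonneg_right (hpq s) (sq_nonneg (f s - wmean q f))
        have h3 : (f s - wmean q f) ^ 2 ≤ B ^ 2 :=
          sq_le_sq' (by linarith [(hf s).1, hm.2]) (by linarith [(hf s).2, hm.1])
        have h4 := mul_le_mul_of_nonneg_left h3 ha
        linarith
    _ = 2 * wvar q f + S * a * B ^ 2 := by
        rw [Finset.sum_add_distrib, ← Finset.mul_sum]
        simp [wvar, mul_assoc]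

theorem wvar_add_le {S : ℕ} {p : Fin S → ℝ} (hp : ∀ s, 0 ≤ p s) (f g : Fin S → ℝ) :
    wvar p (fun s => f s + g s) ≤ 2 * wvar p f + 2 * wvar p g := by
  rw [wvar, wmean_add, wvar, wvar, Finset.mul_sum, Finset.mul_sum, ← Finset.sum_add_distrib]
  refine Finset.sum_le_sum fun s _ => ?_
  have : (f s + g s - (wmean p f + wmean p g)) ^ 2 ≤
      2 * (f s - wmean p f) ^ 2 + 2 * (g s - wmean p g) ^ 2 := by
    nlinarith [sq_nonneg ((f s - wmean p f) - (g s - wmean p g))]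
  have := mul_le_mul_of_nonneg_left this (hp s)
  linarith

theorem two_mul_sqrt_mul_le {x y : ℝ} (hx : 0 ≤ x) (hy : 0 ≤ y) (c : ℝ) (hc : 0 < c) :
    2 * √(x * y) ≤ c * x + y / c := by
  rw [Real.sqrt_mul hx]
  have h1 := Real.sq_sqrt hx
  have h2 := Real.sq_sqrt hy
  have h3 := sq_nonneg (c * √x - √y)
  have h4 : c * x + y / c - 2 * (√x * √y) = (c * √x - √y) ^ 2 / c := by
    field_simp
    nlinarith
  have h5 : 0 ≤ (c * √x - √y) ^ 2 / c := by positivity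
  linarith

theorem sqrt_add_le_add {x y : ℝ} (hx : 0 ≤ x) (hy : 0 ≤ y) : √(x + y) ≤ √x + √y := by
  rw [Real.sqrt_le_left (by positivity)]
  nlinarith [Real.sq_sqrt hx, Real.sq_sqrt hy, Real.sqrt_nonneg x, Real.sqrt_nonneg y]

/-- The weights `q` are estimates of the weights `p` with Bernstein accuracy `κ`. -/
structure IsClose {S : ℕ} (p q : Fin S → ℝ) (κ : ℝ) : Prop where
  nonneg : ∀ s, 0 ≤ p s
  sum_eq_one : ∑ s, p s = 1
  est_nonneg : ∀ s, 0 ≤ q s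
  est_sum_eq_one : ∑ s, q s = 1
  acc_nonneg : 0 ≤ κ
  abs_sub_le : ∀ s, |q s - p s| ≤ 2 * √(p s * κ) + κ

namespace IsClose

variable {S : ℕ} {p q : Fin S → ℝ} {κ : ℝ}

theorem est_le (h : IsClose p q κ) (s : Fin S) : q s ≤ 2 * p s + 2 * κ := by
  have h1 := (abs_le.1 (h.abs_sub_le s)).2
  have h2 := two_mul_sqrt_mul_le (h.nonneg s) h.acc_nonneg 1 one_pos
  linarith

theorem le_est (h : IsClose p q κ) (s : Fin S) : p s ≤ 2 * q s + 6 * κ := by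
  have h1 := (abs_le.1 (h.abs_sub_le s)).1
  have h2 := two_mul_sqrt_mul_le (h.nonneg s) h.acc_nonneg (1 / 2) (by norm_num)
  linarith

/-- The estimation error of the mean of an arbitrary function, with a factor `√S` since the
function may depend on the data. -/
theorem abs_wmean_sub_le (h : IsClose p q κ) {g : Fin S → ℝ} {B : ℝ}
    (hg : ∀ s, |g s - wmean p g| ≤ B) :
    |wmean q g - wmean p g| ≤ 2 * √(S * (κ * wvar p g)) + S * B * κ := by
  set m := wmean p g with hm
  have e : wmean q g - m = ∑ s, (q s - p s) * (g s - m) := by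
    have h2 : ∀ s, (q s - p s) * (g s - m) = q s * g s - p s * g s - q s * m + p s * m :=
      fun s => by ring
    rw [Finset.sum_congr rfl fun s _ => h2 s, Finset.sum_add_distrib, Finset.sum_sub_distrib,
      Finset.sum_sub_distrib, ← Finset.sum_mul, ← Finset.sum_mul, h.sum_eq_one, h.est_sum_eq_one]
    have : ∑ s, p s * g s = m := rfl
    rw [this, wmean]
    ring
  have h1 : |wmean q g - m| ≤ ∑ s, (2 * √(p s * κ) * |g s - m| + B * κ) := by
    rw [e]
    refine (Finset.abs_sum_le_sum_abs _ _).trans (Finset.sum_le_sum fun s _ => ?_)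
    rw [abs_mul]
    calc |q s - p s| * |g s - m| ≤ (2 * √(p s * κ) + κ) * |g s - m| :=
          mul_le_mul_of_nonneg_right (h.abs_sub_le s) (abs_nonneg _)
      _ ≤ _ := by
          have := mul_le_mul_of_nonneg_right (hg s) h.acc_nonneg
          linarith
  have h2 : ∑ s, √(p s * κ) * |g s - m| ≤ √(S * (κ * wvar p g)) := by
    apply Real.le_sqrt_of_sq_le
    have h3 := sq_sum_le_card_mul_sum_sq (s := univ) (f := fun s => √(p s * κ) * |g s - m|)
    refine h3.trans (le_of_eq ?_)
    simp only [Finset.card_univ, Fintype.card_fin]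
    congr 1
    rw [wvar, Finset.mul_sum]
    refine Finset.sum_congr rfl fun s _ => ?_
    rw [mul_pow, sq_abs, Real.sq_sqrt (mul_nonneg (h.nonneg s) h.acc_nonneg)]
    ring
  refine h1.trans ?_
  rw [Finset.sum_add_distrib]
  have h4 : ∑ s, 2 * √(p s * κ) * |g s - m| = 2 * ∑ s, √(p s * κ) * |g s - m| := by
    rw [Finset.mul_sum]
    exact Finset.sum_congr rfl fun s _ => by ring
  rw [h4]
  simp only [Finset.sum_const, Finset.card_univ, Fintype.card_fin, nsmul_eq_mul]
  linarith

/-- The empirical bonus dominates the deviation allowed by Bernstein's inequality. -/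
theorem le_bonus (h : IsClose p q κ) (hS : 1 ≤ S) {f : Fin S → ℝ} {H D : ℝ}
    (hf : ∀ s, f s ∈ Set.Icc 0 H) (hDH : D ≤ H) (hH : 0 ≤ H)
    (hdev : |wmean q f - wmean p f| ≤ 2 * √(wvar p f * κ) + D * κ) :
    |wmean q f - wmean p f| ≤ √(8 * (κ * wvar q f)) + 6 * S * H * κ := by
  have hκ := h.acc_nonneg
  have hS' : (1 : ℝ) ≤ S := by exact_mod_cast hS
  have hv := wvar_nonneg h.est_nonneg f
  have h1 := wvar_le_two_mul_wvar h.sum_eq_one h.est_nonneg h.est_sum_eq_one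
    (mul_nonneg (by norm_num : (0 : ℝ) ≤ 6) hκ) h.le_est hf
  have h2 : 2 * √(wvar p f * κ) ≤ √(8 * (κ * wvar q f)) + √(24 * S) * (H * κ) := by
    have e1 : 2 * √(wvar p f * κ) = √(4 * (wvar p f * κ)) := by
      rw [Real.sqrt_mul (by norm_num : (0 : ℝ) ≤ 4)]
      congr 1
      rw [show (4 : ℝ) = 2 ^ 2 by norm_num, Real.sqrt_sq (by norm_num)]
    have e2 : √(24 * S) * (H * κ) = √(24 * S * (H * κ) ^ 2) := by
      rw [Real.sqrt_mul (show (0 : ℝ) ≤ 24 * S by positivity) ((H * κ) ^ 2),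
        Real.sqrt_sq (by positivity)]
    rw [e1, e2]
    refine le_trans (Real.sqrt_le_sqrt ?_) (sqrt_add_le_add (by positivity) (by positivity))
    nlinarith [mul_le_mul_of_nonneg_right h1 hκ]
  have h3 : √(24 * S) ≤ 6 * S - 1 := by
    rw [Real.sqrt_le_left (by linarith)]
    nlinarith
  have h4 := mul_le_mul_of_nonneg_right h3 (mul_nonneg hH hκ)
  have h5 := mul_le_mul_of_nonneg_right hDH hκ
  linarith

/-- The total bonus and estimation error for a data-dependent `h = f + g`: the leading term only
involves the fixed function `f`. -/
theorem abs_wmean_sub_add_bonus_le (h : IsClose p q κ) (hS : 1 ≤ S) {f g : Fin S → ℝ} {H D : ℝ}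
    (hfg : ∀ s, f s + g s ∈ Set.Icc 0 H) (hf : ∀ s, f s ∈ Set.Icc 0 H) (hDH : D ≤ H)
    (hH : 0 ≤ H) (hdev : |wmean q f - wmean p f| ≤ 2 * √(wvar p f * κ) + D * κ) :
    |wmean q (fun s => f s + g s) - wmean p (fun s => f s + g s)| +
      (√(8 * (κ * wvar q (fun s => f s + g s))) + 6 * S * H * κ) ≤
      8 * √(κ * wvar p f) + 8 * S * √(κ * wvar p g) + 13 * S * H * κ := by
  have hκ := h.acc_nonneg
  have hS' : (1 : ℝ) ≤ S := by exact_mod_cast hS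
  have hvf := wvar_nonneg h.nonneg f
  have hvg := wvar_nonneg h.nonneg g
  have hgm : ∀ s, g s ∈ Set.Icc (-H) H := fun s =>
    ⟨by linarith [(hfg s).1, (hf s).2], by linarith [(hfg s).2, (hf s).1]⟩
  have hm := wmean_mem_Icc h.nonneg h.sum_eq_one hgm
  have h1 := h.abs_wmean_sub_le (g := g) (B := 2 * H) fun s => abs_le.2
    ⟨by linarith [(hgm s).1, hm.2], by linarith [(hgm s).2, hm.1]⟩
  have h2 := wvar_le_two_mul_wvar h.est_sum_eq_one h.nonneg h.sum_eq_one
    (mul_nonneg (by norm_num : (0 : ℝ) ≤ 2) hκ) h.est_le hfg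
  have h3 := wvar_add_le h.nonneg f g
  have sq : ∀ c x : ℝ, 0 ≤ c → √(c ^ 2 * x) = c * √x := fun c x hc => by
    rw [Real.sqrt_mul (by positivity), Real.sqrt_sq hc]
  have h4 : √(8 * (κ * wvar q (fun s => f s + g s))) ≤
      6 * √(κ * wvar p f) + 6 * √(κ * wvar p g) + 4 * S * (H * κ) := by
    have e3 : 4 * (S : ℝ) * (H * κ) = √((4 * (S : ℝ) * (H * κ)) ^ 2) :=
      (Real.sqrt_sq (by positivity)).symm
    rw [← sq 6 (κ * wvar p f) (by norm_num), ← sq 6 (κ * wvar p g) (by norm_num), e3]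
    refine le_trans (Real.sqrt_le_sqrt ?_) ((sqrt_add_le_add (by positivity) (by positivity)).trans
      (add_le_add (sqrt_add_le_add (by positivity) (by positivity)) le_rfl))
    have h5 : κ * wvar q (fun s => f s + g s) ≤
        4 * (κ * wvar p f) + 4 * (κ * wvar p g) + 2 * S * (H * κ) ^ 2 := by
      nlinarith [mul_le_mul_of_nonneg_left (h2.trans (add_le_add_left
        (mul_le_mul_of_nonneg_left h3 (by norm_num : (0 : ℝ) ≤ 2)) _)) hκ]
    have h6 : (S : ℝ) * (H * κ) ^ 2 ≤ S ^ 2 * (H * κ) ^ 2 :=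
      mul_le_mul_of_nonneg_right (by nlinarith) (sq_nonneg _)
    have h7 : 0 ≤ κ * wvar p f := by positivity
    have h8 : 0 ≤ κ * wvar p g := by positivity
    nlinarith
  have h9 : 2 * √(S * (κ * wvar p g)) ≤ 2 * S * √(κ * wvar p g) := by
    rw [mul_assoc, ← sq S _ (by linarith)]
    have : √((S : ℝ) * (κ * wvar p g)) ≤ √((S : ℝ) ^ 2 * (κ * wvar p g)) :=
      Real.sqrt_le_sqrt (mul_le_mul_of_nonneg_right (by nlinarith) (by positivity))
    linarith
  have h10 : |wmean q (fun s => f s + g s) - wmean p (fun s => f s + g s)| ≤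
      |wmean q f - wmean p f| + |wmean q g - wmean p g| := by
    rw [wmean_add, wmean_add]
    refine le_trans (le_of_eq ?_) (abs_add_le _ _)
    congr 1
    ring
  have h11 : 6 * √(κ * wvar p g) ≤ 6 * S * √(κ * wvar p g) :=
    mul_le_mul_of_nonneg_right (by linarith) (Real.sqrt_nonneg _)
  have h12 : D * κ ≤ S * H * κ := by
    refine mul_le_mul_of_nonneg_right (hDH.trans ?_) hκ
    nlinarith
  rw [mul_comm (wvar p f) κ] at hdev
  linarith

end IsClose

/-! ### Visit counts and lazily updated statistics -/

/-- Number of visits to the state-action pair `z` before time `t`. -/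
def visits {S A : ℕ} (ω : Trajectory S A) (t : ℕ) (z : Fin S × Fin A) : ℕ :=
  ((range t).filter fun u => ω u = z).card

/-- The number of samples used when `N` are available: the largest power of two that is at most
`N`, or `0` if `N = 0`. -/
def lazyCount (N : ℕ) : ℕ := 2 ^ N.size / 2

/-- Among the first `n` visits to `z` made before time `t`, the number of those followed by a
transition to `s'`. -/
def succCount {S A : ℕ} (ω : Trajectory S A) (t n : ℕ) (z : Fin S × Fin A) (s' : Fin S) : ℕ :=
  ((range t).filter fun u => ω u = z ∧ visits ω u z < n ∧ (ω (u + 1)).1 = s').card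

/-- Sample sizes and successor counts of all state-action pairs. -/
abbrev Stats (S A : ℕ) : Type := (Fin S × Fin A → ℕ) × (Fin S × Fin A → Fin S → ℕ)

/-- The statistics available at time `t`. Only the first `lazyCount N` of the `N` samples of each
pair are used, so that the statistics change only logarithmically often. -/
def stats {S A : ℕ} (ω : Trajectory S A) (t : ℕ) : Stats S A :=
  (fun z => lazyCount (visits ω t z), fun z => succCount ω t (lazyCount (visits ω t z)) z)

theorem visits_succ {S A : ℕ} (ω : Trajectory S A) (t : ℕ) (z : Fin S × Fin A) :
    visits ω (t + 1) z = visits ω t z + if ω t = z then 1 else 0 := by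
  unfold visits
  rw [Finset.range_add_one, Finset.filter_insert]
  split_ifs with h
  · rw [Finset.card_insert_of_notMem (by simp)]
  · rfl

theorem visits_zero {S A : ℕ} (ω : Trajectory S A) (z : Fin S × Fin A) : visits ω 0 z = 0 := by
  simp [visits]

theorem visits_mono {S A : ℕ} (ω : Trajectory S A) (z : Fin S × Fin A) :
    Monotone fun t => visits ω t z :=
  monotone_nat_of_le_succ fun t => by rw [visits_succ]; exact Nat.le_add_right _ _

theorem visits_le {S A : ℕ} (ω : Trajectory S A) (t : ℕ) (z : Fin S × Fin A) :
    visits ω t z ≤ t := by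
  simpa [visits] using Finset.card_filter_le (range t) fun u => ω u = z

theorem lazyCount_le (N : ℕ) : lazyCount N ≤ N := by
  rcases Nat.eq_zero_or_pos N with rfl | h
  · simp [lazyCount]
  · have h1 : 0 < N.size := Nat.size_pos.2 h
    have h2 : 2 ^ (N.size - 1) ≤ N := Nat.lt_size.1 (by omega)
    have h3 : 2 ^ N.size = 2 * 2 ^ (N.size - 1) := by
      rw [← pow_succ']
      congr 1
      omega
    rw [lazyCount, h3]
    omega

theorem succ_le_two_mul_lazyCount {N : ℕ} (h : 0 < N) : N + 1 ≤ 2 * lazyCount N := by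
  have h1 : 0 < N.size := Nat.size_pos.2 h
  have h3 : 2 ^ N.size = 2 * 2 ^ (N.size - 1) := by
    rw [← pow_succ']
    congr 1
    omega
  have h4 : N < 2 ^ N.size := Nat.lt_size_self N
  rw [lazyCount]
  omega

theorem lazyCount_zero : lazyCount 0 = 0 := by simp [lazyCount]

theorem visits_congr {S A : ℕ} {ω ω' : Trajectory S A} {t : ℕ} (h : ∀ u < t, ω u = ω' u)
    (z : Fin S × Fin A) : visits ω t z = visits ω' t z := by
  unfold visits
  congr 1
  exact Finset.filter_congr fun u hu => by rw [h u (Finset.mem_range.1 hu)]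

theorem stats_congr {S A : ℕ} {ω ω' : Trajectory S A} {t : ℕ} (h : ∀ u < t, ω u = ω' u)
    (ht : (ω t).1 = (ω' t).1) : stats ω t = stats ω' t := by
  have h1 : ∀ z, visits ω t z = visits ω' t z := visits_congr h
  have h2 : ∀ n z s', succCount ω t n z s' = succCount ω' t n z s' := by
    intro n z s'
    unfold succCount
    congr 1
    refine Finset.filter_congr fun u hu => ?_
    have hu' := Finset.mem_range.1 hu
    have e : (ω (u + 1)).1 = (ω' (u + 1)).1 := by
      rcases Nat.lt_or_eq_of_le (Nat.succ_le_of_lt hu') with h3 | h3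
      · rw [h (u + 1) h3]
      · have h4 : u + 1 = t := h3
        rw [h4, ht]
    rw [h u hu', visits_congr (fun v hv => h v (hv.trans hu')) z, e]
  unfold stats
  simp only [h1]
  congr 1
  funext z s'
  exact h2 _ z s'

theorem dependsOn_stats {S A : ℕ} (t : ℕ) :
    DependsOn (fun ω : Trajectory S A => stats ω t) (Set.Iic t) := fun ω ω' h =>
  stats_congr (fun u hu => h u (Set.mem_Iic.2 hu.le)) (by rw [h t (Set.mem_Iic.2 le_rfl)])

/-- The first `n` samples do not change any more once they have been collected. -/
theorem succCount_eq_of_le {S A : ℕ} (ω : Trajectory S A) {t T n : ℕ} (z : Fin S × Fin A)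
    (s' : Fin S) (htT : t ≤ T) (hn : n ≤ visits ω t z) :
    succCount ω t n z s' = succCount ω T n z s' := by
  unfold succCount
  congr 1
  ext u
  simp only [Finset.mem_filter, Finset.mem_range]
  constructor
  · rintro ⟨h1, h2⟩
    exact ⟨h1.trans_le htT, h2⟩
  · rintro ⟨h1, h2, h3, h4⟩
    refine ⟨?_, h2, h3, h4⟩
    by_contra hlt
    exact absurd (hn.trans (visits_mono ω z (not_lt.1 hlt))) (not_le.2 h3)

/-- The number of updates of the statistics before time `t`. -/
def updates {S A : ℕ} (ω : Trajectory S A) (t : ℕ) : ℕ := ∑ z, (visits ω t z).size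

theorem updates_mono {S A : ℕ} (ω : Trajectory S A) : Monotone (updates ω) := fun _ _ h =>
  Finset.sum_le_sum fun z _ => Nat.size_le_size (visits_mono ω z h)

theorem stats_succ_eq {S A : ℕ} (ω : Trajectory S A) (t : ℕ)
    (h : updates ω (t + 1) = updates ω t) : stats ω (t + 1) = stats ω t := by
  have h1 : ∀ z, (visits ω (t + 1) z).size = (visits ω t z).size := by
    intro z
    have := (Finset.sum_eq_sum_iff_of_le fun z _ =>
      Nat.size_le_size (visits_mono ω z (Nat.le_succ t))).1 h.symm
    exact (this z (mem_univ z)).symm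
  have h2 : ∀ z, lazyCount (visits ω (t + 1) z) = lazyCount (visits ω t z) := fun z => by
    rw [lazyCount, h1, lazyCount]
  unfold stats
  simp only [h2]
  congr 1
  funext z s'
  exact (succCount_eq_of_le ω z s' (Nat.le_succ t) (lazyCount_le _)).symm

theorem natSize_le_log (n : ℕ) (hn : 1 ≤ n) : (n.size : ℝ) ≤ 1 + 2 * Real.log n := by
  have h1 : 0 < n.size := Nat.size_pos.2 hn
  have h2 : 2 ^ (n.size - 1) ≤ n := Nat.lt_size.1 (by omega)
  have h3 : ((2 : ℝ)) ^ (n.size - 1) ≤ n := by exact_mod_cast h2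
  have h4 := Real.log_le_log (by positivity) h3
  rw [Real.log_pow] at h4
  have h5 : (1 / 2 : ℝ) ≤ Real.log 2 := by linarith [Real.log_two_gt_d9]
  have h6 : ((n.size - 1 : ℕ) : ℝ) = n.size - 1 := by
    rw [Nat.cast_sub h1]; simp
  rw [h6] at h4
  have h7 : (0 : ℝ) ≤ n.size - 1 := by
    rw [← h6]; positivity
  nlinarith

theorem updates_le {S A : ℕ} (ω : Trajectory S A) (T : ℕ) (hT : 1 ≤ T) :
    (updates ω T : ℝ) ≤ S * A * (1 + 2 * Real.log T) := by
  have h1 : updates ω T ≤ ∑ _z : Fin S × Fin A, T.size :=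
    Finset.sum_le_sum fun z _ => Nat.size_le_size (visits_le ω T z)
  simp only [Finset.sum_const, Finset.card_univ, Fintype.card_prod, Fintype.card_fin,
    smul_eq_mul] at h1
  calc (updates ω T : ℝ) ≤ ((S * A * T.size : ℕ) : ℝ) := by exact_mod_cast h1
    _ = S * A * T.size := by push_cast; ring
    _ ≤ _ := mul_le_mul_of_nonneg_left (natSize_le_log T hT) (by positivity)

/-- Sums of functions that change only when the statistics are updated telescope, up to the number
of updates. -/
theorem sum_telescope_le {S A : ℕ} (ω : Trajectory S A) (f : Stats S A → Fin S → ℝ) {B : ℝ}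
    (hB : ∀ d s, |f d s| ≤ B) (T : ℕ) :
    ∑ t ∈ range T, (f (stats ω t) (ω (t + 1)).1 - f (stats ω t) (ω t).1) ≤
      2 * B * (1 + updates ω T) := by
  have key : ∀ T, ∑ t ∈ range T, (f (stats ω t) (ω (t + 1)).1 - f (stats ω t) (ω t).1) ≤
      f (stats ω T) (ω T).1 - f (stats ω 0) (ω 0).1 + 2 * B * updates ω T := by
    intro T
    induction T with
    | zero => simp [updates, visits_zero]
    | succ n ih =>
      rw [Finset.sum_range_succ]
      have hB0 : 0 ≤ B := (abs_nonneg _).trans (hB (stats ω 0) (ω 0).1)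
      have h1 : f (stats ω n) (ω (n + 1)).1 - f (stats ω (n + 1)) (ω (n + 1)).1 ≤
          2 * B * ((updates ω (n + 1) : ℝ) - updates ω n) := by
        rcases (updates_mono ω (Nat.le_succ n)).eq_or_lt with h | h
        · rw [stats_succ_eq ω n h.symm, h]
          simp
        · have h2 : (updates ω n : ℝ) + 1 ≤ updates ω (n + 1) := by exact_mod_cast h
          have h3 := (abs_le.1 (hB (stats ω n) (ω (n + 1)).1)).2
          have h4 := (abs_le.1 (hB (stats ω (n + 1)) (ω (n + 1)).1)).1
          nlinarith
      linarith
  have h3 := (abs_le.1 (hB (stats ω T) (ω T).1)).2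
  have h4 := (abs_le.1 (hB (stats ω 0) (ω 0).1)).1
  linarith [key T]

/-- Summation along a trajectory, regrouped by state-action pair. -/
theorem sum_visits_eq {S A : ℕ} (ω : Trajectory S A) (F : Fin S × Fin A → ℕ → ℝ) (T : ℕ) :
    ∑ t ∈ range T, F (ω t) (visits ω t (ω t)) = ∑ z, ∑ i ∈ range (visits ω T z), F z i := by
  induction T with
  | zero => simp [visits_zero]
  | succ n ih =>
    rw [Finset.sum_range_succ, ih]
    have : ∀ z, ∑ i ∈ range (visits ω (n + 1) z), F z i =
        ∑ i ∈ range (visits ω n z), F z i + if ω n = z then F z (visits ω n z) else 0 := by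
      intro z
      rw [visits_succ]
      split_ifs
      · rw [Finset.sum_range_succ]
      · simp
    rw [Finset.sum_congr rfl fun z _ => this z, Finset.sum_add_distrib]
    simp

theorem sum_inv_lazyCount_le (N : ℕ) :
    ∑ i ∈ range N, (1 : ℝ) / lazyCount i ≤ 2 * harmonic N := by
  rw [harmonic]
  push_cast
  rw [Finset.mul_sum]
  refine Finset.sum_le_sum fun i _ => ?_
  rcases Nat.eq_zero_or_pos i with rfl | h
  · simp [lazyCount_zero]
  · have h1 : ((i : ℝ) + 1) ≤ 2 * lazyCount i := by exact_mod_cast succ_le_two_mul_lazyCount h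
    have h2 : (0 : ℝ) < i + 1 := by positivity
    rw [← div_eq_mul_inv, div_le_div_iff₀ (by linarith) h2]
    linarith

theorem sum_sqrt_inv_lazyCount_le (N : ℕ) :
    ∑ i ∈ range N, √((1 : ℝ) / lazyCount i) ≤ √8 * √N := by
  induction N with
  | zero => simp
  | succ n ih =>
    rw [Finset.sum_range_succ]
    have hn : (0 : ℝ) < (n : ℝ) + 1 := by positivity
    have h1 : √((1 : ℝ) / lazyCount n) ≤ √2 / √(n + 1) := by
      rw [← Real.sqrt_div (by norm_num)]
      apply Real.sqrt_le_sqrt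
      rcases Nat.eq_zero_or_pos n with rfl | h
      · simp [lazyCount_zero]
      · have h1 : ((n : ℝ) + 1) ≤ 2 * lazyCount n := by exact_mod_cast succ_le_two_mul_lazyCount h
        rw [div_le_div_iff₀ (by linarith) hn]
        linarith
    have h2 : √2 / √((n : ℝ) + 1) ≤ √8 * √((n : ℝ) + 1) - √8 * √n := by
      have e : √(8 : ℝ) = 2 * √2 := by
        rw [show (8 : ℝ) = 2 ^ 2 * 2 by norm_num, Real.sqrt_mul (by norm_num),
          Real.sqrt_sq (by norm_num)]
      rw [e, div_le_iff₀ (Real.sqrt_pos.2 hn)]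
      have s1 := Real.sq_sqrt hn.le
      have s2 := Real.sq_sqrt (Nat.cast_nonneg n : (0 : ℝ) ≤ n)
      have s3 : (0 : ℝ) < √2 := by positivity
      have s4 := sq_nonneg (√((n : ℝ) + 1) - √n)
      have s5 : 1 ≤ 2 * (√((n : ℝ) + 1) - √n) * √((n : ℝ) + 1) := by nlinarith
      nlinarith
    push_cast
    linarith

/-! ### The learner -/

/-- Empirical transition probabilities. -/
def phat {S A : ℕ} (d : Stats S A) (z : Fin S × Fin A) (s' : Fin S) : ℝ := d.2 z s' / d.1 z

/-- The exploration bonus for the function `f` at the pair `z`, at confidence level `e^{-x}` and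
for functions with values in `[0, H]`: an empirical Bernstein bound, or the trivial bound `H` if
there is no sample. -/
def bonus {S A : ℕ} (H x : ℝ) (d : Stats S A) (z : Fin S × Fin A) (f : Fin S → ℝ) : ℝ :=
  if d.1 z = 0 then H
  else √(8 * (x / d.1 z * wvar (phat d z) f)) + 6 * S * H * (x / d.1 z)

/-- A gain-bias pair is plausible if it satisfies one half of the optimality equation, up to the
exploration bonus. -/
def IsPlausible {S A : ℕ} (r : Fin S → Fin A → ℝ) (H x : ℝ) (d : Stats S A)
    (p : ℝ × (Fin S → ℝ)) : Prop :=
  p.1 ≤ 1 ∧ (∀ s, p.2 s ∈ Set.Icc 0 H) ∧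
    ∀ s, ∃ a, p.2 s + p.1 ≤ r s a + wmean (phat d (s, a)) p.2 + bonus H x d (s, a) p.2

/-- Plausible pairs whose gain is maximal up to `ε`. -/
def IsOptimistic {S A : ℕ} (r : Fin S → Fin A → ℝ) (H x ε : ℝ) (d : Stats S A)
    (p : ℝ × (Fin S → ℝ)) : Prop :=
  IsPlausible r H x d p ∧ ∀ p', IsPlausible r H x d p' → p'.1 ≤ p.1 + ε

theorem bonus_nonneg {S A : ℕ} {H x : ℝ} (hH : 0 ≤ H) (hx : 0 ≤ x) (d : Stats S A)
    (z : Fin S × Fin A) (f : Fin S → ℝ) : 0 ≤ bonus H x d z f := by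
  unfold bonus
  split_ifs
  · exact hH
  · positivity

theorem exists_isOptimistic {S A : ℕ} [Nonempty (Fin A)] {r : Fin S → Fin A → ℝ}
    (hr : ∀ s a, r s a ∈ Set.Icc (0 : ℝ) 1) {H x ε : ℝ} (hH : 0 ≤ H) (hx : 0 ≤ x) (hε : 0 < ε)
    (d : Stats S A) : ∃ p, IsOptimistic r H x ε d p := by
  have h0 : IsPlausible r H x d (0, fun _ => 0) := by
    refine ⟨zero_le_one, fun _ => ⟨le_rfl, hH⟩, fun s => ⟨Classical.arbitrary _, ?_⟩⟩
    have h1 := (hr s (Classical.arbitrary _)).1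
    have h2 := bonus_nonneg hH hx d (s, Classical.arbitrary (Fin A)) fun _ => 0
    simp only [wmean, mul_zero, Finset.sum_const_zero]
    linarith
  have hbdd : BddAbove (Prod.fst '' {p | IsPlausible r H x d p}) := by
    refine ⟨1, ?_⟩
    rintro _ ⟨p, hp, rfl⟩
    exact hp.1
  obtain ⟨_, ⟨p, hp, rfl⟩, hlt⟩ := exists_lt_of_lt_csSup
    (Set.Nonempty.image Prod.fst (show {p | IsPlausible r H x d p}.Nonempty from ⟨_, h0⟩))
    (sub_lt_self (sSup _) hε)
  refine ⟨p, hp, fun p' hp' => ?_⟩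
  have := le_csSup hbdd ⟨p', hp', rfl⟩
  linarith

/-- The optimistic gain-bias pair computed from the statistics. -/
def optimisticPair {S A : ℕ} (r : Fin S → Fin A → ℝ) (H x ε : ℝ) (d : Stats S A) :
    ℝ × (Fin S → ℝ) := Classical.epsilon (IsOptimistic r H x ε d)

/-- The action realizing the plausibility inequality for the optimistic pair. -/
def greedyAction {S A : ℕ} [Nonempty (Fin A)] (r : Fin S → Fin A → ℝ) (H x ε : ℝ)
    (d : Stats S A) (s : Fin S) : Fin A :=
  Classical.epsilon fun a => (optimisticPair r H x ε d).2 s + (optimisticPair r H x ε d).1 ≤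
    r s a + wmean (phat d (s, a)) (optimisticPair r H x ε d).2 +
      bonus H x d (s, a) (optimisticPair r H x ε d).2

theorem isOptimistic_optimisticPair {S A : ℕ} [Nonempty (Fin A)] {r : Fin S → Fin A → ℝ}
    (hr : ∀ s a, r s a ∈ Set.Icc (0 : ℝ) 1) {H x ε : ℝ} (hH : 0 ≤ H) (hx : 0 ≤ x) (hε : 0 < ε)
    (d : Stats S A) : IsOptimistic r H x ε d (optimisticPair r H x ε d) :=
  Classical.epsilon_spec (exists_isOptimistic hr hH hx hε d)

theorem greedyAction_spec {S A : ℕ} [Nonempty (Fin A)] {r : Fin S → Fin A → ℝ}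
    (hr : ∀ s a, r s a ∈ Set.Icc (0 : ℝ) 1) {H x ε : ℝ} (hH : 0 ≤ H) (hx : 0 ≤ x) (hε : 0 < ε)
    (d : Stats S A) (s : Fin S) :
    (optimisticPair r H x ε d).2 s + (optimisticPair r H x ε d).1 ≤
      r s (greedyAction r H x ε d s) +
        wmean (phat d (s, greedyAction r H x ε d s)) (optimisticPair r H x ε d).2 +
      bonus H x d (s, greedyAction r H x ε d s) (optimisticPair r H x ε d).2 :=
  Classical.epsilon_spec ((isOptimistic_optimisticPair hr hH hx hε d).1.2.2 s)

/-- The observed history together with the current state, as a trajectory. The entries that are not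
observed are irrelevant. -/
def observed {S A : ℕ} [Nonempty (Fin A)] {n : ℕ} (hist : Fin n → Fin S × Fin A) (s : Fin S) :
    Trajectory S A :=
  fun u => if h : u < n then hist ⟨u, h⟩ else (s, Classical.arbitrary _)

/-- The optimistic learner. -/
def optimisticLearner {S A : ℕ} [Nonempty (Fin A)] (r : Fin S → Fin A → ℝ) (H x ε : ℝ) :
    Learner S A :=
  fun n hist s => PMF.pure (greedyAction r H x ε (stats (observed hist s) n) s)

theorem ae_eq_greedyAction {S A : ℕ} [Nonempty (Fin A)] (r : Fin S → Fin A → ℝ) (H x ε : ℝ)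
    (P : Transition S A) (s : Fin S) :
    ∀ᵐ ω ∂(trajLaw P (optimisticLearner r H x ε) s), ∀ t : ℕ,
      (ω t).2 = greedyAction r H x ε (stats ω t) (ω t).1 := by
  filter_upwards [ae_action_eq P
    (fun n hist s => greedyAction r H x ε (stats (observed hist s) n) s) s] with ω hω t
  rw [hω t]
  congr 1
  apply stats_congr
  · intro u hu
    simp [observed, hu]
  · simp [observed]

/-! ### Concentration of the empirical transition probabilities -/

/-- The function `f` of the next state, at the first `n` visits to `z`. -/
def visitFun {S A : ℕ} (z : Fin S × Fin A) (n : ℕ) (f : Fin S → ℝ) (t : ℕ)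
    (ω : Trajectory S A) (s' : Fin S) : ℝ :=
  if ω t = z ∧ visits ω t z < n then f s' else 0

theorem dependsOn_visitFun {S A : ℕ} (z : Fin S × Fin A) (n : ℕ) (f : Fin S → ℝ) (t : ℕ) :
    DependsOn (visitFun z n f t) (Set.Iic t) := by
  intro ω ω' h
  funext s'
  simp only [visitFun, h t (Set.mem_Iic.2 le_rfl),
    visits_congr (fun u hu => h u (Set.mem_Iic.2 (le_of_lt hu))) z]

theorem sum_visit_indicator {S A : ℕ} (ω : Trajectory S A) (z : Fin S × Fin A) (n T : ℕ) :
    ∑ t ∈ range T, (if ω t = z ∧ visits ω t z < n then (1 : ℝ) else 0) =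
      (min n (visits ω T z) : ℕ) := by
  induction T with
  | zero => simp [visits_zero]
  | succ m ih =>
    rw [Finset.sum_range_succ, ih, visits_succ]
    by_cases h1 : ω m = z <;> by_cases h2 : visits ω m z < n
    · rw [if_pos ⟨h1, h2⟩, if_pos h1, min_eq_right h2.le, min_eq_right h2]
      push_cast
      ring
    · rw [if_neg (fun h => h2 h.2), if_pos h1, min_eq_left (not_lt.1 h2),
        min_eq_left ((not_lt.1 h2).trans (Nat.le_succ _)), add_zero]
    · rw [if_neg (fun h => h1 h.1), if_neg h1]
      simp
    · rw [if_neg (fun h => h1 h.1), if_neg h1]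
      simp

theorem sum_mdiff_visitFun {S A : ℕ} (P : Transition S A) (ω : Trajectory S A)
    (z : Fin S × Fin A) (n : ℕ) (f : Fin S → ℝ) (T : ℕ) :
    ∑ t ∈ range T, mdiff P (visitFun z n f) t ω =
      ∑ s', succCount ω T n z s' * f s' - (min n (visits ω T z) : ℕ) * kmean P z f := by
  have h1 : ∀ t, mdiff P (visitFun z n f) t ω =
      (∑ s', (if ω t = z ∧ visits ω t z < n ∧ (ω (t + 1)).1 = s' then (1 : ℝ) else 0) * f s') -
      (if ω t = z ∧ visits ω t z < n then (1 : ℝ) else 0) * kmean P z f := by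
    intro t
    by_cases h : ω t = z ∧ visits ω t z < n
    · have e : visitFun z n f t ω = f := by
        funext s'
        simp only [visitFun, if_pos h]
      rw [mdiff, e, if_pos h, h.1, one_mul]
      congr 1
      simp [h.2]
    · have e : visitFun z n f t ω = fun _ => 0 := by
        funext s'
        simp only [visitFun, if_neg h]
      rw [mdiff, e, if_neg h, kmean_const]
      rw [Finset.sum_eq_zero]
      · simp
      · intro s' _
        rw [if_neg (fun h' => h ⟨h'.1, h'.2.1⟩), zero_mul]
  rw [Finset.sum_congr rfl fun t _ => h1 t, Finset.sum_sub_distrib, ← Finset.sum_mul,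
    sum_visit_indicator, Finset.sum_comm]
  congr 1
  refine Finset.sum_congr rfl fun s' _ => ?_
  rw [← Finset.sum_mul]
  congr 1
  simp [succCount]

theorem sum_kvar_visitFun {S A : ℕ} (P : Transition S A) (ω : Trajectory S A)
    (z : Fin S × Fin A) (n : ℕ) (f : Fin S → ℝ) (T : ℕ) :
    ∑ t ∈ range T, kvar P (ω t) (visitFun z n f t ω) ≤ n * kvar P z f := by
  have h1 : ∀ t, kvar P (ω t) (visitFun z n f t ω) =
      (if ω t = z ∧ visits ω t z < n then (1 : ℝ) else 0) * kvar P z f := by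
    intro t
    by_cases h : ω t = z ∧ visits ω t z < n
    · have e : visitFun z n f t ω = f := by
        funext s'
        simp only [visitFun, if_pos h]
      rw [e, if_pos h, h.1, one_mul]
    · have e : visitFun z n f t ω = fun _ => 0 := by
        funext s'
        simp only [visitFun, if_neg h]
      rw [e, if_neg h, zero_mul, kvar_eq_sub]
      have := kmean_const P (ω t) 0
      simp [this]
  rw [Finset.sum_congr rfl fun t _ => h1 t, ← Finset.sum_mul, sum_visit_indicator]
  refine mul_le_mul_of_nonneg_right ?_ (kvar_nonneg _ _ _)
  exact_mod_cast min_le_left _ _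

theorem sum_succCount {S A : ℕ} (ω : Trajectory S A) (z : Fin S × Fin A) (n T : ℕ) :
    ∑ s', succCount ω T n z s' = min n (visits ω T z) := by
  have h1 : ∀ s', (succCount ω T n z s' : ℝ) = ∑ t ∈ range T,
      if ω t = z ∧ visits ω t z < n ∧ (ω (t + 1)).1 = s' then (1 : ℝ) else 0 := fun s' => by
    simp [succCount]
  have h2 : (∑ s', (succCount ω T n z s' : ℝ)) = (min n (visits ω T z) : ℕ) := by
    rw [Finset.sum_congr rfl fun s' _ => h1 s', Finset.sum_comm, ← sum_visit_indicator]
    refine Finset.sum_congr rfl fun t _ => ?_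
    by_cases h : ω t = z ∧ visits ω t z < n
    · simp [h.1, h.2]
    · rw [if_neg h]
      refine Finset.sum_eq_zero fun s' _ => ?_
      rw [if_neg fun h' => h ⟨h'.1, h'.2.1⟩]
  exact_mod_cast h2

/-- Bernstein's inequality for the first `n` transitions from `z`. -/
theorem bernstein_visits {S A : ℕ} (P : Transition S A) (L : Learner S A) (s : Fin S)
    (z : Fin S × Fin A) (n : ℕ) {f : Fin S → ℝ} {B x : ℝ} (hB : 0 < B) (hx : 0 < x)
    (hf : ∀ s s', |f s - f s'| ≤ B) (T : ℕ) :
    (trajLaw P L s).real {ω | ¬ ∑ t ∈ range T, mdiff P (visitFun z n f) t ω ≤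
      2 * √(n * kvar P z f * x) + B * x} ≤ Real.exp (-x) := by
  set v := n * kvar P z f with hv
  have hv0 : 0 ≤ v := mul_nonneg (Nat.cast_nonneg _) (kvar_nonneg _ _ _)
  -- The minimiser `√(x / v)` of `l * v + x / l` if it is at most `1 / B`, and `1 / B` otherwise.
  obtain ⟨l, hl, hlB, hlv⟩ : ∃ l : ℝ, 0 < l ∧ l * B ≤ 1 ∧
      l * v + x / l ≤ 2 * √(v * x) + B * x := by
    by_cases h : B ^ 2 * x ≤ v
    · have hvpos : 0 < v := lt_of_lt_of_le (by positivity) h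
      have sx := Real.sq_sqrt hx.le
      have sv := Real.sq_sqrt hvpos.le
      have px := Real.sqrt_pos.2 hx
      have pv := Real.sqrt_pos.2 hvpos
      refine ⟨√x / √v, by positivity, ?_, ?_⟩
      · rw [div_mul_eq_mul_div, div_le_one pv]
        apply le_of_sq_le_sq _ pv.le
        rw [mul_pow, sx, sv]
        linarith
      · rw [Real.sqrt_mul hv0]
        have e1 : √x / √v * v = √v * √x := by
          rw [div_mul_eq_mul_div, div_eq_iff pv.ne']
          nlinarith
        have e2 : x / (√x / √v) = √v * √x := by
          rw [div_div_eq_mul_div, div_eq_iff px.ne']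
          nlinarith
        rw [e1, e2]
        nlinarith
    · push Not at h
      refine ⟨1 / B, by positivity, by rw [one_div_mul_cancel hB.ne'], ?_⟩
      have e : x / (1 / B) = B * x := by field_simp
      rw [e]
      have h2 : 1 / B * v ≤ √(v * x) := by
        apply Real.le_sqrt_of_sq_le
        rw [mul_pow, one_div, inv_pow, ← div_eq_inv_mul, div_le_iff₀ (by positivity)]
        nlinarith
      have := Real.sqrt_nonneg (v * x)
      linarith
  refine le_trans (measureReal_mono ?_) (freedman P L s (visitFun z n f) (dependsOn_visitFun z n f)
    l B x hl hlB ?_ T)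
  · intro ω hω hle
    refine hω (hle.trans (le_trans ?_ hlv))
    have := mul_le_mul_of_nonneg_left (sum_kvar_visitFun P ω z n f T) hl.le
    linarith
  · intro t ω s1 s2
    unfold visitFun
    split_ifs
    · exact hf s1 s2
    · simpa using hB.le

/-! ### The good event -/

/-- The functions of the next state whose empirical means have to be accurate: the indicators of the
states and the optimal bias function `h`. -/
def testFun {S : ℕ} (h : Fin S → ℝ) : Option (Fin S) → Fin S → ℝ
  | none => h
  | some s' => fun s => if s = s' then 1 else 0

/-- A bound on the range of `testFun`. -/
def testRange {S : ℕ} (D : ℝ) : Option (Fin S) → ℝ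
  | none => D
  | some _ => 1

/-- Difference of the optimistic bias function and of the true one. -/
def biasError {S A : ℕ} (r : Fin S → Fin A → ℝ) (H x ε : ℝ) (h : Fin S → ℝ) (d : Stats S A)
    (s : Fin S) : ℝ := (optimisticPair r H x ε d).2 s - h s

/-- The trajectories on which all the concentration inequalities used in the regret analysis hold.
The parameters `l₁`, `l₂`, `l₃` are the tilting parameters in Freedman's inequality. -/
structure IsGood {S A : ℕ} (P : Transition S A) (r : Fin S → Fin A → ℝ) (H x ε D : ℝ)
    (h : Fin S → ℝ) (l₁ l₂ l₃ : ℝ) (T : ℕ) (ω : Trajectory S A) : Prop where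
  dev : ∀ z, ∀ n ≤ T, ∀ o, |∑ t ∈ range T, mdiff P (visitFun z n (testFun h o)) t ω| ≤
    2 * √(n * kvar P z (testFun h o) * x) + testRange D o * x
  bias : ∑ t ∈ range T, mdiff P (fun _ _ s => -h s) t ω ≤
    l₁ * ∑ t ∈ range T, kvar P (ω t) (fun s => -h s) + x / l₁
  bias_sq : ∑ t ∈ range T, mdiff P (fun _ _ s => -h s ^ 2) t ω ≤
    l₂ * ∑ t ∈ range T, kvar P (ω t) (fun s => -h s ^ 2) + x / l₂
  error : ∑ t ∈ range T, mdiff P (fun t ω s => -biasError r H x ε h (stats ω t) s) t ω ≤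
    l₃ * ∑ t ∈ range T, kvar P (ω t) (fun s => -biasError r H x ε h (stats ω t) s) + x / l₃
  error_sq : ∑ t ∈ range T, mdiff P (fun t ω s => -biasError r H x ε h (stats ω t) s ^ 2) t ω ≤
    l₂ * ∑ t ∈ range T, kvar P (ω t) (fun s => -biasError r H x ε h (stats ω t) s ^ 2) + x / l₂

theorem mdiff_neg_visitFun {S A : ℕ} (P : Transition S A) (z : Fin S × Fin A) (n : ℕ)
    (f : Fin S → ℝ) (t : ℕ) (ω : Trajectory S A) :
    mdiff P (visitFun z n fun s => -f s) t ω = - mdiff P (visitFun z n f) t ω := by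
  have : visitFun z n (fun s => -f s) t ω = fun s => - visitFun z n f t ω s := by
    funext s
    unfold visitFun
    split_ifs <;> simp
  rw [mdiff, mdiff, this, kmean_neg]
  ring

theorem bernstein_visits_abs {S A : ℕ} (P : Transition S A) (L : Learner S A) (s : Fin S)
    (z : Fin S × Fin A) (n : ℕ) {f : Fin S → ℝ} {B x : ℝ} (hB : 0 < B) (hx : 0 < x)
    (hf : ∀ s s', |f s - f s'| ≤ B) (T : ℕ) :
    (trajLaw P L s).real {ω | ¬ |∑ t ∈ range T, mdiff P (visitFun z n f) t ω| ≤
      2 * √(n * kvar P z f * x) + B * x} ≤ 2 * Real.exp (-x) := by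
  have h1 := bernstein_visits P L s z n hB hx hf T
  have h2 := bernstein_visits P L s z n (f := fun s => -f s) hB hx
    (fun s s' => by rw [← abs_neg]; convert! hf s s' using 2; ring) T
  rw [kvar_neg] at h2
  simp only [mdiff_neg_visitFun, Finset.sum_neg_distrib] at h2
  have hsub : {ω | ¬ |∑ t ∈ range T, mdiff P (visitFun z n f) t ω| ≤
      2 * √(n * kvar P z f * x) + B * x} ⊆
      {ω | ¬ ∑ t ∈ range T, mdiff P (visitFun z n f) t ω ≤ 2 * √(n * kvar P z f * x) + B * x} ∪
      {ω | ¬ -∑ t ∈ range T, mdiff P (visitFun z n f) t ω ≤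
        2 * √(n * kvar P z f * x) + B * x} := by
    intro ω hω
    by_contra hne
    simp only [Set.mem_union, not_or, Set.mem_ofPred_eq, not_not] at hne
    exact hω (abs_le.2 ⟨by linarith [hne.2], hne.1⟩)
  have := (measureReal_mono (μ := trajLaw P L s) hsub).trans (measureReal_union_le _ _)
  linarith

theorem abs_sub_le_of_mem_Icc {a b x y : ℝ} (hx : x ∈ Set.Icc a b) (hy : y ∈ Set.Icc a b) :
    |x - y| ≤ b - a :=
  abs_le.2 ⟨by linarith [hx.1, hy.2], by linarith [hx.2, hy.1]⟩

section

variable {S A : ℕ} {P : Transition S A} {r : Fin S → Fin A → ℝ}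
  {H x ε D ρ : ℝ} {h : Fin S → ℝ}

theorem IsOptimalPair.biasError_mem [Nonempty (Fin A)] (hp : IsOptimalPair P r D ρ h)
    (hr : ∀ s a, r s a ∈ Set.Icc (0 : ℝ) 1) (hH : 0 ≤ H) (hx : 0 ≤ x) (hε : 0 < ε) (hDH : D ≤ H)
    (d : Stats S A) (s : Fin S) : biasError r H x ε h d s ∈ Set.Icc (-H) H := by
  have h1 := (isOptimistic_optimisticPair hr hH hx hε d).1.2.1 s
  have h2 := hp.nonneg s
  have h3 := hp.le s
  exact ⟨by unfold biasError; linarith [h1.1], by unfold biasError; linarith [h1.2]⟩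

/-- The good event fails with probability at most `e^{-x}` times the number of inequalities. -/
theorem measure_not_isGood_le [Nonempty (Fin A)] (hp : IsOptimalPair P r D ρ h)
    (hr : ∀ s a, r s a ∈ Set.Icc (0 : ℝ) 1) (hD : 0 < D) (hx : 0 < x) (hε : 0 < ε) (hDH : D ≤ H)
    (L : Learner S A) (s : Fin S) {l₁ l₂ l₃ : ℝ} (hl₁ : 0 < l₁) (hl₂ : 0 < l₂) (hl₃ : 0 < l₃)
    (hl₁D : l₁ * D ≤ 1) (hl₂H : l₂ * H ^ 2 ≤ 1) (hl₃H : l₃ * (2 * H) ≤ 1) (T : ℕ) :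
    (trajLaw P L s).real {ω | ¬ IsGood P r H x ε D h l₁ l₂ l₃ T ω} ≤
      (2 * (S * A * (T + 1) * (S + 1)) + 4) * Real.exp (-x) := by
  have hH : 0 < H := hD.trans_le hDH
  have hhm : ∀ s, h s ∈ Set.Icc 0 D := fun s => ⟨hp.nonneg s, hp.le s⟩
  have hg := hp.biasError_mem hr hH.le hx.le hε hDH
  have htest : ∀ (o : Option (Fin S)) s s', |testFun h o s - testFun h o s'| ≤ testRange D o := by
    intro o s s'
    cases o with
    | none =>
      have := abs_sub_le_of_mem_Icc (hhm s) (hhm s')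
      rwa [sub_zero] at this
    | some y =>
      have : ∀ s, testFun h (some y) s ∈ Set.Icc (0 : ℝ) 1 := fun s => by
        simp only [testFun]
        split_ifs <;> simp
      have := abs_sub_le_of_mem_Icc (this s) (this s')
      rwa [sub_zero] at this
  have hrange : ∀ o : Option (Fin S), 0 < testRange D o := fun o => by
    cases o
    · exact hD
    · exact one_pos
  have hbstat : ∀ (f : Stats S A → Fin S → ℝ) (t : ℕ),
      DependsOn (fun (ω : Trajectory S A) (s : Fin S) => f (stats ω t) s) (Set.Iic t) :=
    fun f t ω ω' h => by
      have := dependsOn_stats t h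
      simp only at this
      simp only [this]
  let E₀ : (Fin S × Fin A) × Fin (T + 1) × Option (Fin S) → Set (Trajectory S A) := fun q =>
    {ω | ¬ |∑ t ∈ range T, mdiff P (visitFun q.1 q.2.1 (testFun h q.2.2)) t ω| ≤
      2 * √((q.2.1 : ℕ) * kvar P q.1 (testFun h q.2.2) * x) + testRange D q.2.2 * x}
  let E₁ : Set (Trajectory S A) := {ω | ¬ ∑ t ∈ range T, mdiff P (fun _ _ s => -h s) t ω ≤
    l₁ * ∑ t ∈ range T, kvar P (ω t) (fun s => -h s) + x / l₁}
  let E₂ : Set (Trajectory S A) := {ω | ¬ ∑ t ∈ range T, mdiff P (fun _ _ s => -h s ^ 2) t ω ≤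
    l₂ * ∑ t ∈ range T, kvar P (ω t) (fun s => -h s ^ 2) + x / l₂}
  let E₃ : Set (Trajectory S A) := {ω | ¬ ∑ t ∈ range T,
      mdiff P (fun t ω s => -biasError r H x ε h (stats ω t) s) t ω ≤
    l₃ * ∑ t ∈ range T, kvar P (ω t) (fun s => -biasError r H x ε h (stats ω t) s) + x / l₃}
  let E₄ : Set (Trajectory S A) := {ω | ¬ ∑ t ∈ range T,
      mdiff P (fun t ω s => -biasError r H x ε h (stats ω t) s ^ 2) t ω ≤
    l₂ * ∑ t ∈ range T, kvar P (ω t) (fun s => -biasError r H x ε h (stats ω t) s ^ 2) + x / l₂}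
  have hE₀ : (trajLaw P L s).real (⋃ q, E₀ q) ≤
      2 * (S * A * (T + 1) * (S + 1)) * Real.exp (-x) := by
    refine (measureReal_iUnion_fintype_le _).trans ?_
    refine (Finset.sum_le_sum fun q _ => bernstein_visits_abs P L s q.1 q.2.1 (hrange q.2.2) hx
      (htest q.2.2) T).trans (le_of_eq ?_)
    simp only [Finset.sum_const, Finset.card_univ, Fintype.card_prod, Fintype.card_fin,
      Fintype.card_option, nsmul_eq_mul]
    push_cast
    ring
  have hE₁ : (trajLaw P L s).real E₁ ≤ Real.exp (-x) :=
    freedman P L s (fun _ _ s => -h s) (fun _ _ _ _ => rfl) l₁ D x hl₁ hl₁D (fun t ω s s' => by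
      have := abs_sub_le_of_mem_Icc (hhm s') (hhm s)
      rw [sub_zero] at this
      convert! this using 2
      ring) T
  have hE₂ : (trajLaw P L s).real E₂ ≤ Real.exp (-x) :=
    freedman P L s (fun _ _ s => -h s ^ 2) (fun _ _ _ _ => rfl) l₂ (H ^ 2) x hl₂ hl₂H
      (fun t ω s s' => by
      have hsq : ∀ s, h s ^ 2 ∈ Set.Icc 0 (H ^ 2) := fun s =>
        ⟨sq_nonneg _, pow_le_pow_left₀ (hp.nonneg s) ((hp.le s).trans hDH) 2⟩
      have := abs_sub_le_of_mem_Icc (hsq s') (hsq s)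
      rw [sub_zero] at this
      convert! this using 2
      ring) T
  have hE₃ : (trajLaw P L s).real E₃ ≤ Real.exp (-x) :=
    freedman P L s (fun t ω s => -biasError r H x ε h (stats ω t) s)
      (hbstat fun d s => -biasError r H x ε h d s) l₃ (2 * H) x hl₃ hl₃H (fun t ω s s' => by
      have := abs_sub_le_of_mem_Icc (hg (stats ω t) s') (hg (stats ω t) s)
      rw [sub_neg_eq_add, ← two_mul] at this
      convert! this using 2
      ring) T
  have hE₄ : (trajLaw P L s).real E₄ ≤ Real.exp (-x) :=
    freedman P L s (fun t ω s => -biasError r H x ε h (stats ω t) s ^ 2)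
      (hbstat fun d s => -biasError r H x ε h d s ^ 2) l₂ (H ^ 2) x hl₂ hl₂H (fun t ω s s' => by
      have hsq : ∀ s, biasError r H x ε h (stats ω t) s ^ 2 ∈ Set.Icc 0 (H ^ 2) := fun s =>
        ⟨sq_nonneg _, sq_le_sq' (hg (stats ω t) s).1 (hg (stats ω t) s).2⟩
      have := abs_sub_le_of_mem_Icc (hsq s') (hsq s)
      rw [sub_zero] at this
      convert! this using 2
      ring) T
  have hsub : {ω | ¬ IsGood P r H x ε D h l₁ l₂ l₃ T ω} ⊆
      (⋃ q, E₀ q) ∪ (E₁ ∪ (E₂ ∪ (E₃ ∪ E₄))) := by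
    intro ω hω
    by_contra hne
    simp only [Set.mem_union, not_or, Set.mem_iUnion, not_exists, E₀, E₁, E₂, E₃, E₄,
      Set.mem_ofPred_eq, not_not] at hne
    exact hω ⟨fun z n hn o => hne.1 (z, ⟨n, Nat.lt_succ_of_le hn⟩, o), hne.2.1, hne.2.2.1,
      hne.2.2.2.1, hne.2.2.2.2⟩
  have e1 := (measureReal_mono (μ := trajLaw P L s) hsub).trans (measureReal_union_le _ _)
  have e2 := measureReal_union_le (μ := trajLaw P L s) E₁ (E₂ ∪ (E₃ ∪ E₄))
  have e3 := measureReal_union_le (μ := trajLaw P L s) E₂ (E₃ ∪ E₄)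
  have e4 := measureReal_union_le (μ := trajLaw P L s) E₃ E₄
  linarith

/-! ### Accuracy of the estimates on the good event -/

theorem sum_phat_mul {S A : ℕ} (d : Stats S A) (z : Fin S × Fin A) (f : Fin S → ℝ) :
    wmean (phat d z) f = (∑ s', (d.2 z s' : ℝ) * f s') / d.1 z := by
  rw [wmean, Finset.sum_div]
  exact Finset.sum_congr rfl fun s' _ => by rw [phat]; ring

theorem wmean_phat_sub_kmean (P : Transition S A) (ω : Trajectory S A) {t T : ℕ} (htT : t ≤ T)
    (z : Fin S × Fin A) (hn : (stats ω t).1 z ≠ 0) (f : Fin S → ℝ) :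
    wmean (phat (stats ω t) z) f - kmean P z f =
      (∑ u ∈ range T, mdiff P (visitFun z ((stats ω t).1 z) f) u ω) / (stats ω t).1 z := by
  have hle : (stats ω t).1 z ≤ visits ω t z := lazyCount_le _
  have hmin : min ((stats ω t).1 z) (visits ω T z) = (stats ω t).1 z :=
    min_eq_left (hle.trans (visits_mono ω z htT))
  have hn' : (((stats ω t).1 z : ℕ) : ℝ) ≠ 0 := by exact_mod_cast hn
  have hs : ∀ s', (stats ω t).2 z s' = succCount ω T ((stats ω t).1 z) z s' := fun s' =>
    succCount_eq_of_le ω z s' htT hle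
  rw [sum_mdiff_visitFun, hmin, sum_phat_mul, sub_div, mul_div_cancel_left₀ _ hn']
  simp only [hs]

theorem IsGood.abs_wmean_sub_le {l₁ l₂ l₃ : ℝ} {T : ℕ} {ω : Trajectory S A}
    (hG : IsGood P r H x ε D h l₁ l₂ l₃ T ω) {t : ℕ} (htT : t ≤ T)
    (z : Fin S × Fin A) (hn : (stats ω t).1 z ≠ 0) (o : Option (Fin S)) :
    |wmean (phat (stats ω t) z) (testFun h o) - kmean P z (testFun h o)| ≤
      2 * √(kvar P z (testFun h o) * (x / (stats ω t).1 z)) +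
        testRange D o * (x / (stats ω t).1 z) := by
  rw [wmean_phat_sub_kmean P ω htT z hn]
  have hle : (stats ω t).1 z ≤ T :=
    ((lazyCount_le _).trans (visits_le ω t z)).trans htT
  have hn' : (0 : ℝ) < ((stats ω t).1 z : ℕ) := by exact_mod_cast Nat.pos_of_ne_zero hn
  set n := (stats ω t).1 z
  have h1 := hG.dev z n hle o
  rw [abs_div, abs_of_pos hn', div_le_iff₀ hn']
  refine h1.trans (le_of_eq ?_)
  have e : (n : ℝ) * kvar P z (testFun h o) * x =
      (n : ℝ) ^ 2 * (kvar P z (testFun h o) * (x / n)) := by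
    field_simp
  rw [e, Real.sqrt_mul (by positivity), Real.sqrt_sq hn'.le]
  field_simp

theorem IsGood.isClose {l₁ l₂ l₃ : ℝ} {T : ℕ} {ω : Trajectory S A} (hx : 0 ≤ x)
    (hG : IsGood P r H x ε D h l₁ l₂ l₃ T ω) {t : ℕ} (htT : t ≤ T)
    (z : Fin S × Fin A) (hn : (stats ω t).1 z ≠ 0) :
    IsClose (fun s' => (P z.1 z.2 s').toReal) (phat (stats ω t) z) (x / (stats ω t).1 z) := by
  have hn' : (0 : ℝ) < ((stats ω t).1 z : ℕ) := by exact_mod_cast Nat.pos_of_ne_zero hn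
  refine ⟨fun _ => ENNReal.toReal_nonneg, PMF.sum_toReal_eq_one _, fun s' => ?_, ?_,
    by positivity, fun s' => ?_⟩
  · unfold phat
    positivity
  · have h1 : ∑ s', (stats ω t).2 z s' = (stats ω t).1 z :=
      (sum_succCount ω z _ t).trans (min_eq_left (lazyCount_le _))
    have h2 := sum_phat_mul (stats ω t) z fun _ => 1
    simp only [wmean, mul_one] at h2
    rw [h2, ← Nat.cast_sum, h1, div_self hn'.ne']
  · have h1 := hG.abs_wmean_sub_le htT z hn (some s')
    have e1 : wmean (phat (stats ω t) z) (testFun h (some s')) = phat (stats ω t) z s' := by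
      simp [wmean, testFun]
    have e2 : kmean P z (testFun h (some s')) = (P z.1 z.2 s').toReal := by
      simp [kmean, testFun]
    have e3 : kvar P z (testFun h (some s')) ≤ (P z.1 z.2 s').toReal := by
      have e4 : (fun s => testFun h (some s') s ^ 2) = testFun h (some s') := by
        funext s
        simp only [testFun]
        split_ifs <;> simp
      rw [kvar_eq_sub, e4, e2]
      linarith [sq_nonneg (P z.1 z.2 s').toReal]
    rw [e1, e2] at h1
    refine h1.trans ?_
    simp only [testRange, one_mul]
    have := Real.sqrt_le_sqrt (mul_le_mul_of_nonneg_right e3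
      (show 0 ≤ x / ((stats ω t).1 z : ℝ) by positivity))
    linarith

/-- Optimism: on the good event the true gain and bias are plausible. -/
theorem IsGood.isPlausible {l₁ l₂ l₃ : ℝ} {T : ℕ} {ω : Trajectory S A} (hS : 1 ≤ S) (hx : 0 ≤ x)
    (hDH : D ≤ H) (hp : IsOptimalPair P r D ρ h)
    (hG : IsGood P r H x ε D h l₁ l₂ l₃ T ω) {t : ℕ} (htT : t ≤ T) :
    IsPlausible r H x (stats ω t) (ρ, h) := by
  have hm : ∀ s, h s ∈ Set.Icc 0 H := fun s => ⟨hp.nonneg s, (hp.le s).trans hDH⟩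
  have hH : 0 ≤ H := (hm ⟨0, hS⟩).1.trans (hm ⟨0, hS⟩).2
  refine ⟨hp.gain_le, hm, fun s => ?_⟩
  obtain ⟨a, ha⟩ := hp.exists_action s
  refine ⟨a, ha.trans ?_⟩
  suffices kmean P (s, a) h ≤ wmean (phat (stats ω t) (s, a)) h +
      bonus H x (stats ω t) (s, a) h by
    simp only
    linarith
  by_cases hn : (stats ω t).1 (s, a) = 0
  · have e1 : wmean (phat (stats ω t) (s, a)) h = 0 := by
      rw [sum_phat_mul, hn]
      simp
    rw [e1, bonus, if_pos hn, zero_add, ← kmean_const P (s, a) H]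
    exact kmean_mono P _ fun s => (hm s).2
  · have h1 := (hG.isClose hx htT (s, a) hn).le_bonus hS hm hDH hH
      (hG.abs_wmean_sub_le htT (s, a) hn none)
    have h2 := (abs_le.1 h1).1
    rw [bonus, if_neg hn]
    have e : wmean (fun s' => (P s a s').toReal) h = kmean P (s, a) h := rfl
    simp only [e] at h2
    linarith

/-- Upper bound on the bonus plus the estimation error at the pair `z`. -/
def widthBound {S A : ℕ} (P : Transition S A) (H x : ℝ) (h g : Fin S → ℝ) (d : Stats S A)
    (z : Fin S × Fin A) : ℝ :=
  8 * √(x / d.1 z * kvar P z h) + 8 * S * √(x / d.1 z * kvar P z g) + 13 * S * H * (x / d.1 z) +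
    if d.1 z = 0 then H else 0

theorem IsGood.width_le [Nonempty (Fin A)] {l₁ l₂ l₃ : ℝ} {T : ℕ} {ω : Trajectory S A}
    (hS : 1 ≤ S) (hx : 0 ≤ x)
    (hr : ∀ s a, r s a ∈ Set.Icc (0 : ℝ) 1) (hε : 0 < ε)
    (hDH : D ≤ H) (hp : IsOptimalPair P r D ρ h)
    (hG : IsGood P r H x ε D h l₁ l₂ l₃ T ω) {t : ℕ} (htT : t ≤ T) (z : Fin S × Fin A) :
    wmean (phat (stats ω t) z) (optimisticPair r H x ε (stats ω t)).2 +
      bonus H x (stats ω t) z (optimisticPair r H x ε (stats ω t)).2 ≤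
    kmean P z (optimisticPair r H x ε (stats ω t)).2 +
      widthBound P H x h (biasError r H x ε h (stats ω t)) (stats ω t) z := by
  have hm : ∀ s, h s ∈ Set.Icc 0 H := fun s => ⟨hp.nonneg s, (hp.le s).trans hDH⟩
  have hH : 0 ≤ H := (hm ⟨0, hS⟩).1.trans (hm ⟨0, hS⟩).2
  have ho := (isOptimistic_optimisticPair hr hH hx hε (stats ω t)).1.2.1
  have e : (optimisticPair r H x ε (stats ω t)).2 =
      fun s => h s + biasError r H x ε h (stats ω t) s := by
    funext s
    simp [biasError]
  set f := (optimisticPair r H x ε (stats ω t)).2 with hf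
  set g := biasError r H x ε h (stats ω t) with hg
  by_cases hn : (stats ω t).1 z = 0
  · have e1 : wmean (phat (stats ω t) z) f = 0 := by
      rw [sum_phat_mul, hn]
      simp
    have h1 := kmean_mono P z (f := fun _ => 0) (g := f) fun s => (ho s).1
    rw [kmean_const] at h1
    rw [e1, bonus, if_pos hn, widthBound, if_pos hn, hn]
    simp only [Nat.cast_zero, div_zero, zero_mul, Real.sqrt_zero, mul_zero]
    linarith
  · have h1 := (hG.isClose hx htT z hn).abs_wmean_sub_add_bonus_le hS (f := h) (g := g)
      (fun s => by have := ho s; rw [e] at this; exact this) hm hDH hH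
      (hG.abs_wmean_sub_le htT z hn none)
    rw [← e] at h1
    have h2 := le_abs_self (wmean (phat (stats ω t) z) f -
      wmean (fun s' => (P z.1 z.2 s').toReal) f)
    rw [bonus, if_neg hn, widthBound, if_neg hn, add_zero]
    have e1 : ∀ f, wmean (fun s' => (P z.1 z.2 s').toReal) f = kmean P z f := fun _ => rfl
    have e2 : ∀ f, wvar (fun s' => (P z.1 z.2 s').toReal) f = kvar P z f := fun _ => rfl
    simp only [e1, e2] at h1 h2
    linarith

end

/-! ### The regret on the good event -/

theorem sum_sqrt_lazy_le {S A : ℕ} (P : Transition S A) {x : ℝ} (hx : 0 ≤ x) (h : Fin S → ℝ)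
    (T : ℕ) (ω : Trajectory S A) :
    ∑ t ∈ range T, √(x / (stats ω t).1 (ω t) * kvar P (ω t) h) ≤
      √8 * √(x * (S * A) * ∑ t ∈ range T, kvar P (ω t) h) := by
  have e1 : ∀ t, √(x / (stats ω t).1 (ω t) * kvar P (ω t) h) =
      (fun z (i : ℕ) => √(x * kvar P z h) * √((1 : ℝ) / lazyCount i)) (ω t)
        (visits ω t (ω t)) := by
    intro t
    have hv := kvar_nonneg P (ω t) h
    simp only
    rw [← Real.sqrt_mul (by positivity)]
    congr 1
    simp only [stats]
    ring
  have e2 : ∑ t ∈ range T, kvar P (ω t) h = ∑ z, visits ω T z * kvar P z h := by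
    rw [sum_visits_eq ω (fun z _ => kvar P z h) T]
    simp
  rw [Finset.sum_congr rfl fun t _ => e1 t,
    sum_visits_eq ω fun z (i : ℕ) => √(x * kvar P z h) * √((1 : ℝ) / lazyCount i)]
  calc ∑ z, ∑ i ∈ range (visits ω T z), √(x * kvar P z h) * √((1 : ℝ) / lazyCount i)
      ≤ ∑ z, √8 * √(x * kvar P z h * visits ω T z) := by
        refine Finset.sum_le_sum fun z _ => ?_
        rw [← Finset.mul_sum, Real.sqrt_mul (mul_nonneg hx (kvar_nonneg P z h))]
        have := mul_le_mul_of_nonneg_left (sum_sqrt_inv_lazyCount_le (visits ω T z))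
          (Real.sqrt_nonneg (x * kvar P z h))
        linarith
    _ = √8 * ∑ z, √(x * kvar P z h * visits ω T z) := by rw [Finset.mul_sum]
    _ ≤ _ := by
        refine mul_le_mul_of_nonneg_left (Real.le_sqrt_of_sq_le ?_) (Real.sqrt_nonneg _)
        refine sq_sum_le_card_mul_sum_sq.trans (le_of_eq ?_)
        have e3 : ∀ z, √(x * kvar P z h * visits ω T z) ^ 2 = x * (visits ω T z * kvar P z h) :=
          fun z => by
            rw [Real.sq_sqrt (mul_nonneg (mul_nonneg hx (kvar_nonneg P z h)) (Nat.cast_nonneg _))]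
            ring
        rw [Finset.sum_congr rfl fun z _ => e3 z, ← Finset.mul_sum, ← e2]
        simp only [Finset.card_univ, Fintype.card_prod, Fintype.card_fin]
        push_cast
        ring

theorem sum_inv_lazy_le {S A : ℕ} (T : ℕ) (ω : Trajectory S A) :
    ∑ t ∈ range T, (1 : ℝ) / (stats ω t).1 (ω t) ≤ 2 * (S * A) * (1 + Real.log T) := by
  have e := sum_visits_eq ω (fun _ i => (1 : ℝ) / lazyCount i) T
  have e1 : ∑ t ∈ range T, (1 : ℝ) / (stats ω t).1 (ω t) =
      ∑ z, ∑ i ∈ range (visits ω T z), (1 : ℝ) / lazyCount i := e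
  rw [e1]
  have hlog : 0 ≤ Real.log T := Real.log_natCast_nonneg T
  calc ∑ z, ∑ i ∈ range (visits ω T z), (1 : ℝ) / lazyCount i
      ≤ ∑ _z : Fin S × Fin A, 2 * (1 + Real.log T) := by
        refine Finset.sum_le_sum fun z _ => (sum_inv_lazyCount_le _).trans ?_
        refine mul_le_mul_of_nonneg_left ((harmonic_le_one_add_log _).trans ?_) zero_le_two
        rcases Nat.eq_zero_or_pos (visits ω T z) with h | h
        · rw [h]
          simpa using hlog
        · have := Real.log_le_log (by exact_mod_cast h : (0 : ℝ) < visits ω T z)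
            (by exact_mod_cast visits_le ω T z : (visits ω T z : ℝ) ≤ T)
          linarith
    _ = _ := by
        simp only [Finset.sum_const, Finset.card_univ, Fintype.card_prod, Fintype.card_fin,
          nsmul_eq_mul]
        push_cast
        ring

theorem sum_unvisited_le {S A : ℕ} {H : ℝ} (hH : 0 ≤ H) (T : ℕ) (ω : Trajectory S A) :
    ∑ t ∈ range T, (if (stats ω t).1 (ω t) = 0 then H else 0) ≤ H * (S * A) := by
  have e := sum_visits_eq ω (fun _ i => if lazyCount i = 0 then H else 0) T
  have e1 : ∑ t ∈ range T, (if (stats ω t).1 (ω t) = 0 then H else 0) =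
      ∑ z, ∑ i ∈ range (visits ω T z), (if lazyCount i = 0 then H else 0) := e
  rw [e1]
  have key : ∀ N, ∑ i ∈ range N, (if lazyCount i = 0 then H else 0) ≤ H := by
    intro N
    calc ∑ i ∈ range N, (if lazyCount i = 0 then H else 0)
        ≤ ∑ i ∈ range N, (if i = 0 then H else 0) := by
          refine Finset.sum_le_sum fun i _ => ?_
          rcases Nat.eq_zero_or_pos i with h | h
          · rw [if_pos h]
            split_ifs
            · exact le_rfl
            · exact hH
          · have := succ_le_two_mul_lazyCount h
            rw [if_neg (by omega), if_neg (by omega)]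
      _ ≤ H := by
          rw [Finset.sum_ite_eq' (range N) 0 fun _ => H]
          split_ifs
          · exact le_rfl
          · exact hH
  calc _ ≤ ∑ _z : Fin S × Fin A, H := Finset.sum_le_sum fun z _ => key _
    _ = _ := by
      simp only [Finset.sum_const, Finset.card_univ, Fintype.card_prod, Fintype.card_fin,
          nsmul_eq_mul]
      push_cast
      ring

theorem sum_widthBound_le {S A : ℕ} (P : Transition S A) {H x : ℝ} (hH : 0 ≤ H) (hx : 0 ≤ x)
    (h : Fin S → ℝ) (g : Stats S A → Fin S → ℝ) (T : ℕ) (ω : Trajectory S A) :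
    ∑ t ∈ range T, widthBound P H x h (g (stats ω t)) (stats ω t) (ω t) ≤
      23 * √(x * (S * A) * ∑ t ∈ range T, kvar P (ω t) h) +
      8 * S * √(x * (2 * (S * A) * (1 + Real.log T)) *
        ∑ t ∈ range T, kvar P (ω t) (g (stats ω t))) +
      13 * S * H * (x * (2 * (S * A) * (1 + Real.log T))) + H * (S * A) := by
  have h1 := sum_sqrt_lazy_le P hx h T ω
  have h2 : ∑ t ∈ range T, √(x / (stats ω t).1 (ω t) * kvar P (ω t) (g (stats ω t))) ≤
      √(x * (2 * (S * A) * (1 + Real.log T)) *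
        ∑ t ∈ range T, kvar P (ω t) (g (stats ω t))) := by
    have hn : ∀ t, 0 ≤ x / ((stats ω t).1 (ω t) : ℝ) := fun t => by positivity
    have hsum : ∑ t ∈ range T, x / ((stats ω t).1 (ω t) : ℝ) ≤
        x * (2 * (S * A) * (1 + Real.log T)) := by
      have e : ∀ t, x / ((stats ω t).1 (ω t) : ℝ) = x * (1 / ((stats ω t).1 (ω t) : ℝ)) :=
        fun t => by ring
      rw [Finset.sum_congr rfl fun t _ => e t, ← Finset.mul_sum]
      exact mul_le_mul_of_nonneg_left (sum_inv_lazy_le T ω) hx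
    rw [Finset.sum_congr rfl fun t _ => Real.sqrt_mul (hn t) _]
    refine (Real.sum_sqrt_mul_sqrt_le (range T) hn fun t => kvar_nonneg P (ω t) _).trans ?_
    rw [← Real.sqrt_mul (Finset.sum_nonneg fun t _ => hn t)]
    exact Real.sqrt_le_sqrt (mul_le_mul_of_nonneg_right hsum
      (Finset.sum_nonneg fun t _ => kvar_nonneg P (ω t) _))
  have h3 : ∑ t ∈ range T, x / ((stats ω t).1 (ω t) : ℝ) ≤
      x * (2 * (S * A) * (1 + Real.log T)) := by
    have e : ∀ t, x / ((stats ω t).1 (ω t) : ℝ) = x * (1 / ((stats ω t).1 (ω t) : ℝ)) :=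
      fun t => by ring
    rw [Finset.sum_congr rfl fun t _ => e t, ← Finset.mul_sum]
    exact mul_le_mul_of_nonneg_left (sum_inv_lazy_le T ω) hx
  have h4 := sum_unvisited_le hH T ω
  have h5 : 8 * √8 ≤ (23 : ℝ) := by
    have : √(8 : ℝ) ≤ 23 / 8 := by
      rw [Real.sqrt_le_left (by norm_num)]
      norm_num
    linarith
  have h6 := mul_le_mul_of_nonneg_right h5
    (Real.sqrt_nonneg (x * (S * A) * ∑ t ∈ range T, kvar P (ω t) h))
  have h7 := mul_le_mul_of_nonneg_left h2 (show (0 : ℝ) ≤ 8 * S by positivity)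
  have h8 := mul_le_mul_of_nonneg_left h3 (show (0 : ℝ) ≤ 13 * S * H by positivity)
  unfold widthBound
  rw [Finset.sum_add_distrib, Finset.sum_add_distrib, Finset.sum_add_distrib, ← Finset.mul_sum,
    ← Finset.mul_sum, ← Finset.mul_sum]
  linarith

/-- The system of inequalities that ties together, on the good event, the regret `R`, the sum `B`
of the widths of the confidence intervals, the drift `E` of the bias error, and the sums `G` and `W`
of the variances of the bias error and of the optimal bias function. -/
structure RegretSystem (S A H x D ε l₁ l₂ l₃ τ lg Φ R B E G W : ℝ) : Prop where
  error_var_nonneg : 0 ≤ G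
  var_nonneg : 0 ≤ W
  error_var_crude : G ≤ (2 * H) ^ 2 * τ
  var_crude : W ≤ D ^ 2 * τ
  width : B ≤ 23 * √(x * (S * A) * W) + 8 * S * √(x * (2 * (S * A) * (1 + lg)) * G) +
      13 * S * H * (x * (2 * (S * A) * (1 + lg))) + H * (S * A)
  drift : E ≤ l₃ * G + x / l₃ + 2 * H * (1 + Φ)
  error_var : G ≤ l₂ * (τ * H ^ 4) + x / l₂ + 2 * H ^ 2 * (1 + Φ) + 2 * H * (E + 2 * (B + ε * τ))
  var : W ≤ l₂ * (τ * H ^ 4) + x / l₂ + D ^ 2 + 2 * D * (τ + (E + ε * τ + B))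
  regret : R ≤ E + ε * τ + B + l₁ * W + x / l₁ + D

theorem sum_sub_next_le {S A : ℕ} (P : Transition S A) (ω : Trajectory S A)
    (f : ℕ → Fin S → ℝ) (T : ℕ) :
    ∑ t ∈ range T, (kmean P (ω t) (f t) - f t (ω t).1) =
      ∑ t ∈ range T, mdiff P (fun t _ s => -f t s) t ω +
        ∑ t ∈ range T, (f t (ω (t + 1)).1 - f t (ω t).1) := by
  rw [← Finset.sum_add_distrib]
  refine Finset.sum_congr rfl fun t _ => ?_
  rw [mdiff, kmean_neg]
  ring

theorem sum_range_sub_const {S A : ℕ} (ω : Trajectory S A) (f : Fin S → ℝ) (T : ℕ) :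
    ∑ t ∈ range T, (f (ω (t + 1)).1 - f (ω t).1) = f (ω T).1 - f (ω 0).1 :=
  Finset.sum_range_sub (fun t => f (ω t).1) T

theorem kmean_mem_Icc {S A : ℕ} (P : Transition S A) (z : Fin S × Fin A) {f : Fin S → ℝ}
    {a c : ℝ} (hf : ∀ s, f s ∈ Set.Icc a c) : kmean P z f ∈ Set.Icc a c := by
  refine ⟨?_, ?_⟩
  · rw [← kmean_const P z a]
    exact kmean_mono P z fun s => (hf s).1
  · rw [← kmean_const P z c]
    exact kmean_mono P z fun s => (hf s).2

theorem kvar_neg_sq_le {S A : ℕ} (P : Transition S A) (z : Fin S × Fin A) {f : Fin S → ℝ}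
    {B : ℝ} (hf : ∀ s, f s ∈ Set.Icc (-B) B) : kvar P z (fun s => -f s ^ 2) ≤ B ^ 4 := by
  have hsq : ∀ s, -f s ^ 2 ∈ Set.Icc (-B ^ 2) 0 := fun s =>
    ⟨neg_le_neg (sq_le_sq' (hf s).1 (hf s).2), neg_nonpos.2 (sq_nonneg _)⟩
  have := kvar_le_sq P z (f := fun s => -f s ^ 2) (B := B ^ 2) fun s s' => by
    have := abs_sub_le_of_mem_Icc (hsq s) (hsq s')
    rwa [zero_sub, neg_neg] at this
  rwa [← pow_mul] at this

theorem sum_drift_le {S A : ℕ} (P : Transition S A) (ω : Trajectory S A)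
    (g : Stats S A → Fin S → ℝ) {B X : ℝ} (hg : ∀ d s, g d s ∈ Set.Icc (-B) B) (T : ℕ)
    (hX : ∑ t ∈ range T, mdiff P (fun t ω s => -g (stats ω t) s) t ω ≤ X) :
    ∑ t ∈ range T, (kmean P (ω t) (g (stats ω t)) - g (stats ω t) (ω t).1) ≤
      X + 2 * B * (1 + updates ω T) := by
  have h1 : ∑ t ∈ range T, (kmean P (ω t) (g (stats ω t)) - g (stats ω t) (ω t).1) =
      ∑ t ∈ range T, mdiff P (fun t ω s => -g (stats ω t) s) t ω +
        ∑ t ∈ range T, (g (stats ω t) (ω (t + 1)).1 - g (stats ω t) (ω t).1) :=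
    sum_sub_next_le P ω (fun t => g (stats ω t)) T
  have h3 := sum_telescope_le ω g (fun d s => abs_le.2 (hg d s)) T
  linarith

/-- The total variance of a slowly changing function is controlled by its total drift, since
`Var g = (P g² - g²) + (g - P g) (g + P g)`. -/
theorem sum_kvar_le_of_drift {S A : ℕ} (P : Transition S A) (ω : Trajectory S A)
    (g : Stats S A → Fin S → ℝ) {B X : ℝ} (hg : ∀ d s, g d s ∈ Set.Icc (-B) B) (T : ℕ)
    (hX : ∑ t ∈ range T, mdiff P (fun t ω s => -g (stats ω t) s ^ 2) t ω ≤ X) :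
    ∑ t ∈ range T, kvar P (ω t) (g (stats ω t)) ≤ X + 2 * B ^ 2 * (1 + updates ω T) +
      2 * B * ∑ t ∈ range T, |kmean P (ω t) (g (stats ω t)) - g (stats ω t) (ω t).1| := by
  have hgsq : ∀ d s, |g d s ^ 2| ≤ B ^ 2 := fun d s => by
    rw [abs_of_nonneg (sq_nonneg _)]
    exact sq_le_sq' (hg d s).1 (hg d s).2
  have h1 : ∑ t ∈ range T,
        (kmean P (ω t) (fun s => g (stats ω t) s ^ 2) - g (stats ω t) (ω t).1 ^ 2) =
      ∑ t ∈ range T, mdiff P (fun t ω s => -g (stats ω t) s ^ 2) t ω +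
        ∑ t ∈ range T, (g (stats ω t) (ω (t + 1)).1 ^ 2 - g (stats ω t) (ω t).1 ^ 2) :=
    sum_sub_next_le P ω (fun t s => g (stats ω t) s ^ 2) T
  have h3 := sum_telescope_le ω (fun d s => g d s ^ 2) hgsq T
  have h6 : ∑ t ∈ range T, kvar P (ω t) (g (stats ω t)) ≤
      ∑ t ∈ range T, (kmean P (ω t) (fun s => g (stats ω t) s ^ 2) - g (stats ω t) (ω t).1 ^ 2) +
      2 * B * ∑ t ∈ range T, |kmean P (ω t) (g (stats ω t)) - g (stats ω t) (ω t).1| := by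
    rw [Finset.mul_sum, ← Finset.sum_add_distrib]
    refine Finset.sum_le_sum fun t _ => ?_
    rw [kvar_eq_sub]
    have m1 := kmean_mem_Icc P (ω t) (hg (stats ω t))
    have m2 := hg (stats ω t) (ω t).1
    generalize kmean P (ω t) (g (stats ω t)) = m at *
    generalize g (stats ω t) (ω t).1 = y at *
    have m4 : |m + y| ≤ 2 * B :=
      abs_le.2 ⟨by linarith [m1.1, m2.1], by linarith [m1.2, m2.2]⟩
    have m5 : y ^ 2 - m ^ 2 ≤ 2 * B * |m - y| := by
      calc y ^ 2 - m ^ 2 = -((m + y) * (m - y)) := by ring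
        _ ≤ |(m + y) * (m - y)| := neg_le_abs _
        _ = |m + y| * |m - y| := abs_mul _ _
        _ ≤ _ := mul_le_mul_of_nonneg_right m4 (abs_nonneg _)
    linarith
  linarith

/-- The gap of the action taken at time `t` in the optimality equation. -/
def gap {S A : ℕ} (P : Transition S A) (r : Fin S → Fin A → ℝ) (ρ : ℝ) (h : Fin S → ℝ)
    (z : Fin S × Fin A) : ℝ := h z.1 + ρ - r z.1 z.2 - kmean P z h

/-- The total variance of the optimal bias is of order `D T`, and not `D² T`, up to the gaps. -/
theorem IsOptimalPair.sum_kvar_le {S A : ℕ} {P : Transition S A} {r : Fin S → Fin A → ℝ}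
    {D ρ X : ℝ} {h : Fin S → ℝ} (hp : IsOptimalPair P r D ρ h)
    (hr : ∀ s a, r s a ∈ Set.Icc (0 : ℝ) 1) (T : ℕ) (ω : Trajectory S A)
    (hX : ∑ t ∈ range T, mdiff P (fun _ _ s => -h s ^ 2) t ω ≤ X) :
    ∑ t ∈ range T, kvar P (ω t) h ≤
      X + D ^ 2 + 2 * D * (T + ∑ t ∈ range T, gap P r ρ h (ω t)) := by
  have hhm : ∀ s, h s ∈ Set.Icc 0 D := fun s => ⟨hp.nonneg s, hp.le s⟩
  have h1 : ∑ t ∈ range T, (kmean P (ω t) (fun s => h s ^ 2) - h (ω t).1 ^ 2) =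
      ∑ t ∈ range T, mdiff P (fun _ _ s => -h s ^ 2) t ω +
        ∑ t ∈ range T, (h (ω (t + 1)).1 ^ 2 - h (ω t).1 ^ 2) :=
    sum_sub_next_le P ω (fun _ s => h s ^ 2) T
  rw [sum_range_sub_const ω (fun s => h s ^ 2)] at h1
  have h6 : ∑ t ∈ range T, kvar P (ω t) h ≤
      ∑ t ∈ range T, (kmean P (ω t) (fun s => h s ^ 2) - h (ω t).1 ^ 2) +
      2 * D * (T + ∑ t ∈ range T, gap P r ρ h (ω t)) := by
    have e1 : (T : ℝ) + ∑ t ∈ range T, gap P r ρ h (ω t) =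
        ∑ t ∈ range T, (1 + gap P r ρ h (ω t)) := by
      rw [Finset.sum_add_distrib]
      simp
    rw [e1, Finset.mul_sum, ← Finset.sum_add_distrib]
    refine Finset.sum_le_sum fun t _ => ?_
    rw [kvar_eq_sub]
    have m1 := kmean_mem_Icc P (ω t) hhm
    have m2 := hhm (ω t).1
    have m0 := hp.ge_action (ω t).1 (ω t).2
    have m3 : h (ω t).1 - kmean P (ω t) h ≤ 1 + gap P r ρ h (ω t) := by
      have := (hr (ω t).1 (ω t).2).2
      unfold gap
      linarith [hp.gain_nonneg]
    have m6 : 0 ≤ gap P r ρ h (ω t) := by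
      unfold gap
      linarith
    generalize gap P r ρ h (ω t) = δ at *
    generalize kmean P (ω t) h = m at *
    generalize h (ω t).1 = y at *
    have m4 : y ^ 2 - m ^ 2 ≤ 2 * D * (1 + δ) := by
      calc y ^ 2 - m ^ 2 = (y + m) * (y - m) := by ring
        _ ≤ (y + m) * (1 + δ) := mul_le_mul_of_nonneg_left m3 (by linarith [m1.1, m2.1])
        _ ≤ _ := mul_le_mul_of_nonneg_right (by linarith [m1.2, m2.2]) (by linarith)
    linarith
  have h8 : h (ω T).1 ^ 2 ≤ D ^ 2 := pow_le_pow_left₀ (hhm _).1 (hhm _).2 2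
  have h9 : 0 ≤ h (ω 0).1 ^ 2 := sq_nonneg _
  linarith

/-- The regret is the sum of the gaps up to a martingale. -/
theorem IsOptimalPair.regret_le {S A : ℕ} {P : Transition S A} {r : Fin S → Fin A → ℝ}
    {D ρ X : ℝ} {h : Fin S → ℝ} (hp : IsOptimalPair P r D ρ h) (T : ℕ) (ω : Trajectory S A)
    (hX : ∑ t ∈ range T, mdiff P (fun _ _ s => -h s) t ω ≤ X) :
    T * ρ - totalReward r T ω ≤ ∑ t ∈ range T, gap P r ρ h (ω t) + X + D := by
  have h1 : ∑ t ∈ range T, (kmean P (ω t) h - h (ω t).1) =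
      ∑ t ∈ range T, mdiff P (fun _ _ s => -h s) t ω +
        ∑ t ∈ range T, (h (ω (t + 1)).1 - h (ω t).1) :=
    sum_sub_next_le P ω (fun _ s => h s) T
  rw [sum_range_sub_const ω h] at h1
  have h3 : T * ρ - totalReward r T ω =
      ∑ t ∈ range T, gap P r ρ h (ω t) + ∑ t ∈ range T, (kmean P (ω t) h - h (ω t).1) := by
    rw [← Finset.sum_add_distrib, totalReward]
    have : (T : ℝ) * ρ = ∑ _t ∈ range T, ρ := by simp
    rw [this, ← Finset.sum_sub_distrib]
    refine Finset.sum_congr rfl fun t _ => ?_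
    unfold gap
    ring
  rw [h3]
  linarith [hp.le (ω T).1, hp.nonneg (ω 0).1]

/-- By optimism, the gap of the greedy action is at most the drift of the bias error plus the width
of the confidence interval. -/
theorem IsGood.gap_le {S A : ℕ} [Nonempty (Fin A)] {P : Transition S A}
    {r : Fin S → Fin A → ℝ} {H x ε D ρ : ℝ} {h : Fin S → ℝ} {l₁ l₂ l₃ : ℝ} {T : ℕ}
    {ω : Trajectory S A} (hS : 1 ≤ S) (hx : 0 ≤ x) (hr : ∀ s a, r s a ∈ Set.Icc (0 : ℝ) 1)
    (hε : 0 < ε) (hH : 0 ≤ H) (hDH : D ≤ H)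
    (hp : IsOptimalPair P r D ρ h) (hG : IsGood P r H x ε D h l₁ l₂ l₃ T ω) {t : ℕ} (ht : t ≤ T)
    (hact : (ω t).2 = greedyAction r H x ε (stats ω t) (ω t).1) :
    gap P r ρ h (ω t) ≤ kmean P (ω t) (biasError r H x ε h (stats ω t)) -
      biasError r H x ε h (stats ω t) (ω t).1 + ε +
      widthBound P H x h (biasError r H x ε h (stats ω t)) (stats ω t) (ω t) := by
  have h1 := greedyAction_spec hr hH hx hε (stats ω t) (ω t).1
  rw [← hact] at h1
  have h2 := (isOptimistic_optimisticPair hr hH hx hε (stats ω t)).2 _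
    (hG.isPlausible hS hx hDH hp ht)
  have h3 := hG.width_le hS hx hr hε hDH hp ht (ω t)
  have h4 : kmean P (ω t) (biasError r H x ε h (stats ω t)) =
      kmean P (ω t) (optimisticPair r H x ε (stats ω t)).2 - kmean P (ω t) h :=
    kmean_sub P (ω t) _ _
  have h5 : biasError r H x ε h (stats ω t) (ω t).1 =
      (optimisticPair r H x ε (stats ω t)).2 (ω t).1 - h (ω t).1 := rfl
  rw [h4, h5]
  unfold gap
  simp only [Prod.mk.eta] at h1 h2
  linarith

theorem widthBound_nonneg {S A : ℕ} (P : Transition S A) {H x : ℝ} (hH : 0 ≤ H) (hx : 0 ≤ x)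
    (h g : Fin S → ℝ) (d : Stats S A) (z : Fin S × Fin A) : 0 ≤ widthBound P H x h g d z := by
  unfold widthBound
  have : 0 ≤ x / (d.1 z : ℝ) := by positivity
  split_ifs <;> positivity

theorem IsGood.regretSystem {S A : ℕ} [Nonempty (Fin A)] {P : Transition S A}
    {r : Fin S → Fin A → ℝ} {H x ε D ρ : ℝ} {h : Fin S → ℝ} {l₁ l₂ l₃ : ℝ} {T : ℕ}
    {ω : Trajectory S A} (hS : 1 ≤ S) (hx : 0 ≤ x) (hr : ∀ s a, r s a ∈ Set.Icc (0 : ℝ) 1)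
    (hε : 0 < ε) (hD : 0 ≤ D) (hDH : D ≤ H) (hl₂ : 0 < l₂)
    (hp : IsOptimalPair P r D ρ h) (hG : IsGood P r H x ε D h l₁ l₂ l₃ T ω)
    (hact : ∀ t : ℕ, (ω t).2 = greedyAction r H x ε (stats ω t) (ω t).1) :
    ∃ B E G W : ℝ, RegretSystem S A H x D ε l₁ l₂ l₃ T (Real.log T) (updates ω T)
      (T * ρ - totalReward r T ω) B E G W := by
  have hH : 0 ≤ H := hD.trans hDH
  have hhm : ∀ s, h s ∈ Set.Icc 0 D := fun s => ⟨hp.nonneg s, hp.le s⟩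
  have hgm := hp.biasError_mem hr hH hx hε hDH
  have hgap : ∀ t ∈ range T, _ := fun t ht =>
    hG.gap_le hS hx hr hε hH hDH hp (Finset.mem_range.1 ht).le (hact t)
  have hgap0 : ∀ t, 0 ≤ gap P r ρ h (ω t) := fun t => by
    have := hp.ge_action (ω t).1 (ω t).2
    unfold gap
    linarith
  have hb0 : ∀ t, 0 ≤ widthBound P H x h (biasError r H x ε h (stats ω t)) (stats ω t) (ω t) :=
    fun t => widthBound_nonneg P hH hx _ _ _ _
  have herr := hG.error
  have herrsq := hG.error_sq
  have hwidth := sum_widthBound_le P hH hx h (biasError r H x ε h) T ω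
  -- From here on the bias error is an arbitrary slowly changing function.
  generalize biasError r H x ε h = g at *
  simp only [kvar_neg] at herr
  have hdrift := sum_drift_le P ω g hgm T herr
  have hvarg := sum_kvar_le_of_drift P ω g hgm T herrsq
  have hvarh := hp.sum_kvar_le hr T ω hG.bias_sq
  have hreg := hp.regret_le T ω hG.bias
  simp only [kvar_neg] at hreg
  have hsumgap : ∑ t ∈ range T, gap P r ρ h (ω t) ≤
      ∑ t ∈ range T, (kmean P (ω t) (g (stats ω t)) - g (stats ω t) (ω t).1) + ε * T +
        ∑ t ∈ range T, widthBound P H x h (g (stats ω t)) (stats ω t) (ω t) := by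
    refine (Finset.sum_le_sum hgap).trans (le_of_eq ?_)
    rw [Finset.sum_add_distrib, Finset.sum_add_distrib]
    simp [mul_comm]
  have hsumabs : ∑ t ∈ range T, |kmean P (ω t) (g (stats ω t)) - g (stats ω t) (ω t).1| ≤
      ∑ t ∈ range T, (kmean P (ω t) (g (stats ω t)) - g (stats ω t) (ω t).1) +
        2 * (∑ t ∈ range T, widthBound P H x h (g (stats ω t)) (stats ω t) (ω t) + ε * T) := by
    calc _ ≤ ∑ t ∈ range T, (kmean P (ω t) (g (stats ω t)) - g (stats ω t) (ω t).1 +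
          2 * (widthBound P H x h (g (stats ω t)) (stats ω t) (ω t) + ε)) := by
          refine Finset.sum_le_sum fun t ht => ?_
          have h1 := hgap t ht
          have h2 := hgap0 t
          have h3 := hb0 t
          exact abs_le.2 ⟨by linarith, by linarith⟩
      _ = _ := by
          rw [Finset.sum_add_distrib, ← Finset.mul_sum, Finset.sum_add_distrib]
          simp [mul_comm]
  have hconst : ∀ c : ℝ, ∑ _t ∈ range T, c = T * c := fun c => by simp
  have hcrude : ∀ f : ℕ → Fin S → ℝ, (∀ t s, f t s ∈ Set.Icc (-H) H) →
      ∑ t ∈ range T, kvar P (ω t) (fun s => -f t s ^ 2) ≤ T * H ^ 4 := fun f hf => by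
    rw [← hconst]
    exact Finset.sum_le_sum fun t _ => kvar_neg_sq_le P (ω t) (hf t)
  have hcg := mul_le_mul_of_nonneg_left (hcrude (fun t => g (stats ω t)) fun t => hgm (stats ω t))
    hl₂.le
  have hch := mul_le_mul_of_nonneg_left (hcrude (fun _ => h) fun _ s =>
    ⟨by linarith [(hhm s).1], (hhm s).2.trans hDH⟩) hl₂.le
  refine ⟨∑ t ∈ range T, widthBound P H x h (g (stats ω t)) (stats ω t) (ω t),
    ∑ t ∈ range T, (kmean P (ω t) (g (stats ω t)) - g (stats ω t) (ω t).1),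
    ∑ t ∈ range T, kvar P (ω t) (g (stats ω t)),
    ∑ t ∈ range T, kvar P (ω t) h,
    Finset.sum_nonneg fun t _ => kvar_nonneg _ _ _, Finset.sum_nonneg fun t _ => kvar_nonneg _ _ _,
    ?_, ?_, hwidth, hdrift, ?_, ?_, ?_⟩
  · rw [mul_comm, ← hconst]
    refine Finset.sum_le_sum fun t _ => kvar_le_sq P (ω t) fun s s' => ?_
    have := abs_sub_le_of_mem_Icc (hgm (stats ω t) s) (hgm (stats ω t) s')
    linarith
  · rw [mul_comm, ← hconst]
    refine Finset.sum_le_sum fun t _ => kvar_le_sq P (ω t) fun s s' => ?_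
    have := abs_sub_le_of_mem_Icc (hhm s) (hhm s')
    linarith
  · have := mul_le_mul_of_nonneg_left hsumabs (show 0 ≤ 2 * H by linarith)
    linarith
  · have := mul_le_mul_of_nonneg_left hsumgap (show 0 ≤ 2 * D by linarith)
    linarith
  · linarith

/-! ### Solving the system of inequalities -/

/-- With `y = T^{1/64}`, and all the parameters of the problem at most `y`, the terms other than
`√(S A D T x)` in the regret are of lower order. -/
theorem RegretSystem.regret_le {S A H x D ε l₁ l₂ l₃ τ lg Φ R B E G W y : ℝ}
    (h : RegretSystem S A H x D ε l₁ l₂ l₃ τ lg Φ R B E G W) (hy : 1000 ≤ y)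
    (hH : H = y ^ 4) (hτ : τ = y ^ 64) (hε : ε = 1 / τ) (hl₁ : l₁ = x / √(x * (D * τ)))
    (hl₂ : l₂ = 1 / y ^ 32) (hl₃ : l₃ = 1 / y ^ 20) (hS : 1 ≤ S) (hA : 1 ≤ A) (hD : 1 ≤ D)
    (hx : 1 ≤ x) (hSA : S * A ≤ y) (hSy : S ≤ y) (hDy : D ≤ y) (hxy : x ≤ y ^ 2)
    (hlg0 : 0 ≤ lg) (hlg : 1 + lg ≤ y ^ 2) (hΦ : 1 + Φ ≤ y ^ 3) :
    R ≤ 491 * √(S * A * D * τ * x) := by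
  have hy0 : 0 < y := by linarith
  have hy1 : 1 ≤ y := by linarith
  have up : ∀ k j : ℕ, j = k + 1 → 1000 * y ^ k ≤ y ^ j := fun k j hj => by
    rw [hj, pow_succ']
    exact mul_le_mul_of_nonneg_right hy (by positivity)
  have mono : ∀ {i j : ℕ}, i ≤ j → y ^ i ≤ y ^ j := fun hij => pow_le_pow_right₀ hy1 hij
  have hτ0 : 0 < τ := by rw [hτ]; positivity
  have hετ : ε * τ = 1 := by rw [hε]; field_simp
  have hSA0 : 0 ≤ S * A := by positivity
  have sqrt_pow : ∀ {z : ℝ} (k j : ℕ), j = 2 * k → z ≤ y ^ j → √z ≤ y ^ k :=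
    fun {z} k j hj hz => by
      rw [Real.sqrt_le_left (by positivity), ← pow_mul, mul_comm, ← hj]
      exact hz
  have hG0 := h.error_var_nonneg
  have hW0 := h.var_nonneg
  -- The factor of the variance of the bias error.
  have hK : x * (2 * (S * A) * (1 + lg)) ≤ y ^ 6 := by
    calc x * (2 * (S * A) * (1 + lg)) ≤ y ^ 2 * (2 * y * y ^ 2) := by gcongr
      _ = 2 * y ^ 5 := by ring
      _ ≤ y ^ 6 := by linarith [up 5 6 rfl, pow_pos hy0 5]
  have hK0 : 0 ≤ x * (2 * (S * A) * (1 + lg)) := by positivity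
  have b3 : 13 * S * H * (x * (2 * (S * A) * (1 + lg))) ≤ y ^ 12 := by
    calc 13 * S * H * (x * (2 * (S * A) * (1 + lg))) ≤ 13 * y * y ^ 4 * y ^ 6 := by
          rw [hH]; gcongr
      _ = 13 * y ^ 11 := by ring
      _ ≤ y ^ 12 := by linarith [up 11 12 rfl, pow_pos hy0 11]
  have b4 : H * (S * A) ≤ y ^ 5 := by
    calc H * (S * A) ≤ y ^ 4 * y := by rw [hH]; gcongr
      _ = y ^ 5 := by ring
  -- First bound on the widths, from the trivial bounds on the variances.
  have hB : B ≤ y ^ 43 := by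
    have c1 : √(x * (S * A) * W) ≤ y ^ 35 := by
      apply sqrt_pow 35 70 rfl
      calc x * (S * A) * W ≤ y ^ 2 * y * (y ^ 2 * y ^ 64) := by
            have : W ≤ y ^ 2 * y ^ 64 := h.var_crude.trans (by rw [hτ]; gcongr)
            gcongr
        _ = y ^ 69 := by ring
        _ ≤ y ^ 70 := mono (by norm_num)
    have c2 : √(x * (2 * (S * A) * (1 + lg)) * G) ≤ y ^ 40 := by
      apply sqrt_pow 40 80 rfl
      calc x * (2 * (S * A) * (1 + lg)) * G ≤ y ^ 6 * ((2 * y ^ 4) ^ 2 * y ^ 64) := by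
            have : G ≤ (2 * y ^ 4) ^ 2 * y ^ 64 := by
              have := h.error_var_crude
              rwa [hH, hτ] at this
            gcongr
        _ = 4 * y ^ 78 := by ring
        _ ≤ y ^ 80 := by linarith [up 78 79 rfl, up 79 80 rfl, pow_pos hy0 78, pow_pos hy0 79]
    have c3 : 8 * S * √(x * (2 * (S * A) * (1 + lg)) * G) ≤ 8 * y ^ 41 := by
      calc _ ≤ 8 * y * y ^ 40 := by gcongr
        _ = 8 * y ^ 41 := by ring
    have := h.width
    linarith [up 42 43 rfl, up 41 42 rfl, mono (show 35 ≤ 42 by norm_num),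
      mono (show 12 ≤ 42 by norm_num),
      mono (show 5 ≤ 42 by norm_num), pow_pos hy0 42]
  -- The variance of the bias error is self-bounding.
  have hxl₂ : x / l₂ ≤ y ^ 34 := by
    rw [hl₂, div_div_eq_mul_div, div_one]
    calc x * y ^ 32 ≤ y ^ 2 * y ^ 32 := by gcongr
      _ = y ^ 34 := by ring
  have hl₂τ : l₂ * (τ * H ^ 4) = y ^ 48 := by
    rw [hl₂, hτ, hH]
    field_simp
  have hxl₃ : x / l₃ ≤ y ^ 22 := by
    rw [hl₃, div_div_eq_mul_div, div_one]
    calc x * y ^ 20 ≤ y ^ 2 * y ^ 20 := by gcongr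
      _ = y ^ 22 := by ring
  have hHΦ : 2 * H * (1 + Φ) ≤ 2 * y ^ 7 := by
    calc 2 * H * (1 + Φ) ≤ 2 * y ^ 4 * y ^ 3 := by rw [hH]; gcongr
      _ = 2 * y ^ 7 := by ring
  have hE1 : E ≤ l₃ * G + y ^ 23 := by
    have := h.drift
    linarith [up 22 23 rfl, mono (show 7 ≤ 22 by norm_num), pow_pos hy0 22]
  -- `G` occurs on both sides of its bound through `2 * H * E`, with coefficient
  -- `2 * H * l₃ ≤ 1 / 2`, so that it can be absorbed.
  have hG : G ≤ y ^ 49 := by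
    have c1 : 2 * H * E ≤ G / 2 + y ^ 28 := by
      calc 2 * H * E ≤ 2 * y ^ 4 * (l₃ * G + y ^ 23) := by rw [hH]; gcongr
        _ = 2 / y ^ 16 * G + 2 * y ^ 27 := by
            rw [hl₃]
            field_simp
        _ ≤ 1 / 2 * G + y ^ 28 := by
            have : 2 / y ^ 16 ≤ 1 / 2 := by
              rw [div_le_div_iff₀ (by positivity) (by norm_num)]
              linarith [up 0 1 rfl, mono (show 1 ≤ 16 by norm_num)]
            have := mul_le_mul_of_nonneg_right this hG0
            linarith [up 27 28 rfl, pow_pos hy0 27]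
        _ = G / 2 + y ^ 28 := by ring
    have c2 : 2 * H ^ 2 * (1 + Φ) ≤ 2 * y ^ 11 := by
      calc 2 * H ^ 2 * (1 + Φ) ≤ 2 * (y ^ 4) ^ 2 * y ^ 3 := by rw [hH]; gcongr
        _ = 2 * y ^ 11 := by ring
    have c3 : 4 * H * (B + ε * τ) ≤ 8 * y ^ 47 := by
      calc 4 * H * (B + ε * τ) ≤ 4 * y ^ 4 * (y ^ 43 + y ^ 43) := by
            rw [hετ, hH]
            have : (1 : ℝ) ≤ y ^ 43 := one_le_pow₀ hy1
            gcongr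
        _ = 8 * y ^ 47 := by ring
    have := h.error_var
    rw [hl₂τ] at this
    linarith [up 48 49 rfl, up 47 48 rfl, mono (show 34 ≤ 47 by norm_num),
      mono (show 28 ≤ 47 by norm_num),
      mono (show 11 ≤ 47 by norm_num), pow_pos hy0 47]
  have hE : E ≤ y ^ 30 := by
    have : l₃ * G ≤ y ^ 29 := by
      calc l₃ * G ≤ 1 / y ^ 20 * y ^ 49 := by rw [hl₃]; gcongr
        _ = y ^ 29 := by field_simp
    linarith [up 29 30 rfl, mono (show 23 ≤ 29 by norm_num), pow_pos hy0 29]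
  -- The variance of the optimal bias function has the right order.
  have hW : W ≤ 3 * (D * τ) := by
    have c1 : 2 * D * (τ + (E + ε * τ + B)) ≤ 2 * (D * τ) + 6 * y ^ 44 := by
      have : E + ε * τ + B ≤ 3 * y ^ 43 := by
        rw [hετ]
        linarith [mono (show 30 ≤ 43 by norm_num), (one_le_pow₀ hy1 : (1 : ℝ) ≤ y ^ 43)]
      calc 2 * D * (τ + (E + ε * τ + B)) = 2 * (D * τ) + 2 * D * (E + ε * τ + B) := by ring
        _ ≤ 2 * (D * τ) + 2 * D * (3 * y ^ 43) := by gcongr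
        _ ≤ 2 * (D * τ) + 2 * y * (3 * y ^ 43) := by gcongr
        _ = _ := by ring
    have c2 : D ^ 2 ≤ y ^ 2 := by gcongr
    have c3 : y ^ 64 ≤ D * τ := by
      rw [hτ]
      exact le_mul_of_one_le_left (by positivity) hD
    have := h.var
    rw [hl₂τ] at this
    linarith [up 48 49 rfl, mono (show 44 ≤ 48 by norm_num), mono (show 34 ≤ 48 by norm_num),
      mono (show 2 ≤ 48 by norm_num), mono (show 49 ≤ 64 by norm_num), pow_pos hy0 48]
  -- Second bound on the widths.
  set Q := √(S * A * D * τ * x) with hQ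
  have hQW : √(x * (S * A) * W) ≤ 2 * Q := by
    have : 2 * Q = √(4 * (S * A * D * τ * x)) := by
      rw [Real.sqrt_mul (by norm_num), hQ, show (4 : ℝ) = 2 ^ 2 by norm_num,
        Real.sqrt_sq (by norm_num)]
    rw [this]
    apply Real.sqrt_le_sqrt
    have := mul_le_mul_of_nonneg_left hW (show 0 ≤ x * (S * A) by positivity)
    have h0 : 0 ≤ S * A * D * τ * x := by positivity
    linarith
  have hB2 : B ≤ 46 * Q + y ^ 31 := by
    have c2 : √(x * (2 * (S * A) * (1 + lg)) * G) ≤ y ^ 28 := by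
      apply sqrt_pow 28 56 rfl
      calc x * (2 * (S * A) * (1 + lg)) * G ≤ y ^ 6 * y ^ 49 := by gcongr
        _ = y ^ 55 := by ring
        _ ≤ y ^ 56 := mono (by norm_num)
    have c3 : 8 * S * √(x * (2 * (S * A) * (1 + lg)) * G) ≤ 8 * y ^ 29 := by
      calc _ ≤ 8 * y * y ^ 28 := by gcongr
        _ = 8 * y ^ 29 := by ring
    have := h.width
    linarith [up 30 31 rfl, up 29 30 rfl, mono (show 12 ≤ 30 by norm_num),
      mono (show 5 ≤ 30 by norm_num),
      pow_pos hy0 30]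
  have hs : √(x * (D * τ)) ≤ Q := by
    apply Real.sqrt_le_sqrt
    have : 1 ≤ S * A := one_le_mul_of_one_le_of_one_le hS hA
    have h0 : 0 ≤ x * (D * τ) := by positivity
    calc x * (D * τ) ≤ S * A * (x * (D * τ)) := le_mul_of_one_le_left h0 this
      _ = _ := by ring
  have hs0 : 0 < √(x * (D * τ)) := Real.sqrt_pos.2 (by positivity)
  have hl₁W : l₁ * W ≤ 3 * √(x * (D * τ)) := by
    rw [hl₁, div_mul_eq_mul_div, div_le_iff₀ hs0]
    have e := Real.mul_self_sqrt (show 0 ≤ x * (D * τ) by positivity)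
    have := mul_le_mul_of_nonneg_left hW (show 0 ≤ x by linarith)
    rw [mul_assoc, e]
    linarith
  have hxl₁ : x / l₁ = √(x * (D * τ)) := by
    rw [hl₁]
    field_simp
  have hyQ : y ^ 32 ≤ Q := by
    apply Real.le_sqrt_of_sq_le
    have h1 : 1 ≤ S * A := one_le_mul_of_one_le_of_one_le hS hA
    have h2 : 1 ≤ S * A * D := one_le_mul_of_one_le_of_one_le h1 hD
    calc (y ^ 32) ^ 2 = τ := by rw [hτ]; ring
      _ ≤ S * A * D * τ := le_mul_of_one_le_left hτ0.le h2
      _ ≤ S * A * D * τ * x := le_mul_of_one_le_right (by positivity) hx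
  have := h.regret
  rw [hετ, hxl₁] at this
  have h30 := pow_pos hy0 30
  linarith [up 30 31 rfl, up 31 32 rfl, mono (show 1 ≤ 31 by norm_num),
    (one_le_pow₀ hy1 : (1 : ℝ) ≤ y ^ 31)]

/-! ### Choice of the parameters and the final bounds -/

/-- The logarithmic factor of the regret bound, which is also the confidence level (on the
exponential scale) at which each concentration inequality is used. -/
def logFactor (S A T : ℕ) (δ : ℝ) : ℝ :=
  Real.log ((S : ℝ) ^ 3 * (A : ℝ) ^ 2 * T * Real.log T / δ)

/-- The fractional power of the horizon that dominates all the parameters of the problem after the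
burn-in phase. -/
def horizonRoot (T : ℕ) : ℝ := (T : ℝ) ^ (1 / 64 : ℝ)

theorem horizonRoot_pow (T : ℕ) : horizonRoot T ^ 64 = T := by
  rw [horizonRoot, ← Real.rpow_natCast, ← Real.rpow_mul (Nat.cast_nonneg T)]
  norm_num

/-- Consequences of a large horizon: the horizon root `y` dominates the parameters, and the
logarithmic factor is at most `y ^ 2`. -/
structure LargeHorizon (S A T : ℕ) (D δ : ℝ) : Prop where
  root : 1000 ≤ horizonRoot T
  mul_le : (S * A : ℝ) ≤ horizonRoot T
  states_le : (S : ℝ) ≤ horizonRoot T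
  actions_le : (A : ℝ) ≤ horizonRoot T
  diameter_le : D ≤ horizonRoot T
  log_nonneg : 1 ≤ Real.log T
  one_add_log_le : 1 + Real.log T ≤ horizonRoot T ^ 2
  log_le : Real.log T ≤ 64 * horizonRoot T
  log_eq : Real.log T = 64 * Real.log (horizonRoot T)
  factor_eq : logFactor S A T δ = 3 * Real.log S + 2 * Real.log A + Real.log T +
    Real.log (Real.log T) + Real.log (1 / δ)
  one_le_factor : 1 ≤ logFactor S A T δ
  factor_le : logFactor S A T δ ≤ horizonRoot T ^ 2

theorem largeHorizon {S A T : ℕ} {D δ : ℝ} (hS : 20 ≤ S) (hA : 20 ≤ A) (hD : 20 ≤ D)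
    (hδ : 0 < δ) (hδ1 : δ < 1)
    (hT : (1000 * S * A * D * (1 + Real.log (1 / δ))) ^ 64 ≤ (T : ℝ)) :
    LargeHorizon S A T D δ := by
  set y := horizonRoot T with hy
  set L := Real.log (1 / δ) with hL
  have hS' : (20 : ℝ) ≤ S := by exact_mod_cast hS
  have hA' : (20 : ℝ) ≤ A := by exact_mod_cast hA
  have hL0 : 0 ≤ L := Real.log_nonneg (by rw [le_div_iff₀ hδ]; linarith)
  have hy0 : 0 ≤ y := Real.rpow_nonneg (Nat.cast_nonneg T) _
  have hM : 1000 * S * A * D * (1 + L) ≤ y := by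
    rw [← horizonRoot_pow T] at hT
    exact le_of_pow_le_pow_left₀ (by norm_num) hy0 hT
  have hDLn : 0 ≤ D * L := by positivity
  have hM0 : 1 ≤ 1000 * D * (1 + L) := by linarith
  have hSA : (S * A : ℝ) ≤ y := by
    calc (S * A : ℝ) ≤ S * A * (1000 * D * (1 + L)) :=
          le_mul_of_one_le_right (by positivity) hM0
      _ ≤ y := by linarith
  have hSA1 : (1 : ℝ) ≤ S * A := one_le_mul_of_one_le_of_one_le (by linarith) (by linarith)
  have hDL : 1000 * D * (1 + L) ≤ y := by
    calc 1000 * D * (1 + L) ≤ S * A * (1000 * D * (1 + L)) :=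
          le_mul_of_one_le_left (by linarith) hSA1
      _ ≤ y := by linarith
  have hSy : (S : ℝ) ≤ y := (le_mul_of_one_le_right (by linarith) (by linarith)).trans hSA
  have hAy : (A : ℝ) ≤ y := (le_mul_of_one_le_left (by linarith) (by linarith)).trans hSA
  have hDy : D ≤ y := by linarith
  have hLy : L ≤ y := by linarith [le_mul_of_one_le_left hL0 (show 1 ≤ D by linarith)]
  have hy1000 : 1000 ≤ y := by linarith
  have hypos : 0 < y := by linarith
  have hysq : 1000 * y ≤ y ^ 2 := by
    rw [sq]
    exact mul_le_mul_of_nonneg_right hy1000 hypos.le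
  have hlog : Real.log T = 64 * Real.log y := by
    rw [← horizonRoot_pow T, Real.log_pow]
    norm_num [hy]
  have hlogle : ∀ z : ℝ, 0 < z → Real.log z ≤ z := fun z hz => by
    linarith [Real.log_le_sub_one_of_pos hz]
  have hlog2 : ∀ z : ℝ, 2 ≤ z → 1 / 2 ≤ Real.log z := fun z hz => by
    have := Real.log_le_log two_pos hz
    linarith [Real.log_two_gt_d9]
  have hlg1 : 1 ≤ Real.log T := by
    rw [hlog]
    linarith [hlog2 y (by linarith)]
  have hlgy : Real.log T ≤ 64 * y := by
    rw [hlog]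
    linarith [hlogle y hypos]
  have hTpos : (0 : ℝ) < T := by
    rw [← horizonRoot_pow T]
    positivity
  have hx : logFactor S A T δ = 3 * Real.log S + 2 * Real.log A + Real.log T +
      Real.log (Real.log T) + L := by
    have s0 : (S : ℝ) ≠ 0 := by positivity
    have a0 : (A : ℝ) ≠ 0 := by positivity
    have l0 : Real.log T ≠ 0 := by linarith
    rw [logFactor, div_eq_mul_one_div, Real.log_mul (by positivity) (by positivity),
      Real.log_mul (by positivity) l0, Real.log_mul (by positivity) hTpos.ne',
      Real.log_mul (by positivity) (by positivity), Real.log_pow, Real.log_pow]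
    norm_num [hL]
  have hll0 : 0 ≤ Real.log (Real.log T) := Real.log_nonneg hlg1
  refine ⟨hy1000, hSA, hSy, hAy, hDy, hlg1, by linarith, hlgy, hlog, hx, ?_, ?_⟩
  · rw [hx]
    linarith [hlog2 S (by linarith), hlog2 A (by linarith)]
  · rw [hx]
    have h1 := hlogle S (by linarith)
    have h2 := hlogle A (by linarith)
    have h3 := hlogle (Real.log T) (by linarith)
    linarith

/-- The learner of the theorem, for the horizon `T` and the confidence parameter `δ`. The cap on the
span of the bias functions is a small power of the horizon, hence larger than the unknown diameter
after the burn-in phase. -/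
def tunedLearner {S A : ℕ} [Nonempty (Fin A)] (r : Fin S → Fin A → ℝ) (T : ℕ) (δ : ℝ) :
    Learner S A :=
  optimisticLearner r (horizonRoot T ^ 4) (logFactor S A T δ) (1 / T)

theorem measurable_totalReward {S A : ℕ} (r : Fin S → Fin A → ℝ) (T : ℕ) :
    Measurable (totalReward r T) :=
  Finset.measurable_sum _ fun t _ =>
    (measurable_of_countable fun z : Fin S × Fin A => r z.1 z.2).comp (measurable_pi_apply t)

theorem measurable_regret {S A : ℕ} (P : Transition S A) (r : Fin S → Fin A → ℝ) (s : Fin S)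
    (T : ℕ) : Measurable (regret P r s T) :=
  (measurable_totalReward r T).const_sub _

theorem tunedLearner_regret_le {S A : ℕ} [Nonempty (Fin A)] {r : Fin S → Fin A → ℝ}
    (hS : 20 ≤ S) (hA : 20 ≤ A) (hr : ∀ s a, r s a ∈ Set.Icc (0 : ℝ) 1) {P : Transition S A}
    {D : ℝ} (hP : diameter P = ENNReal.ofReal D) (hD : 20 ≤ D) (s : Fin S) {T : ℕ} {δ : ℝ}
    (hδ : 0 < δ) (hlarge : LargeHorizon S A T D δ) :
    1 - δ ≤ (trajLaw P (tunedLearner r T δ) s).real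
      {ω | regret P r s T ω ≤ 491 * √(S * A * D * T * logFactor S A T δ)} := by
  have : Nonempty (Fin S) := ⟨s⟩
  obtain ⟨ρ, h, hp⟩ := exists_isOptimalPair P hr (by linarith) hP
  set y := horizonRoot T with hy
  set x := logFactor S A T δ with hx
  have hS' : (20 : ℝ) ≤ S := by exact_mod_cast hS
  have hA' : (20 : ℝ) ≤ A := by exact_mod_cast hA
  have hy1 : 1 ≤ y := by linarith [hlarge.root]
  have hy0 : 0 < y := by linarith
  have hτ : (T : ℝ) = y ^ 64 := (horizonRoot_pow T).symm
  have hT0 : (0 : ℝ) < T := by rw [hτ]; positivity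
  have hT1 : 1 ≤ T := by exact_mod_cast hT0
  have hx1 := hlarge.one_le_factor
  have hε : (0 : ℝ) < 1 / T := by positivity
  have hDH : D ≤ y ^ 4 := hlarge.diameter_le.trans (le_self_pow₀ hy1 (by norm_num))
  have hx0 : 0 < x := by linarith
  have hsq : 0 < √(x * (D * T)) := Real.sqrt_pos.2 (by positivity)
  -- `l₁` balances `l₁ * W` and `x / l₁` for `W` of order `D * T`; `l₂` and `l₃` are powers of `T`
  -- for which the martingale terms of the bias error are of lower order than `√T`.
  set l₁ := x / √(x * (D * T)) with hl₁
  set l₂ := 1 / y ^ 32 with hl₂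
  set l₃ := 1 / y ^ 20 with hl₃
  have hl₁D : l₁ * D ≤ 1 := by
    rw [hl₁, div_mul_eq_mul_div, div_le_one hsq]
    apply Real.le_sqrt_of_sq_le
    have : x * D ≤ T := by
      calc x * D ≤ y ^ 2 * y := by
            have := hlarge.factor_le
            have := hlarge.diameter_le
            gcongr
        _ = y ^ 3 := by ring
        _ ≤ T := by rw [hτ]; exact pow_le_pow_right₀ hy1 (by norm_num)
    have := mul_le_mul_of_nonneg_left this (show 0 ≤ x * D by positivity)
    linarith
  have hl₂H : l₂ * (y ^ 4) ^ 2 ≤ 1 := by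
    rw [hl₂, div_mul_eq_mul_div, one_mul, ← pow_mul, div_le_one (by positivity)]
    exact pow_le_pow_right₀ hy1 (by norm_num)
  have hl₃H : l₃ * (2 * y ^ 4) ≤ 1 := by
    rw [hl₃, div_mul_eq_mul_div, one_mul, div_le_one (by positivity)]
    calc 2 * y ^ 4 ≤ y * y ^ 4 := by
          have := hlarge.root
          gcongr
          linarith
      _ = y ^ 5 := by ring
      _ ≤ y ^ 20 := pow_le_pow_right₀ hy1 (by norm_num)
  set μ := trajLaw P (tunedLearner r T δ) s with hμ
  have hbad : μ.real {ω | ¬ IsGood P r (y ^ 4) x (1 / T) D h l₁ l₂ l₃ T ω} ≤ δ := by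
    refine (measure_not_isGood_le hp hr (by linarith) hx0 hε hDH (tunedLearner r T δ) s
      (by positivity) (by positivity) (by positivity) hl₁D hl₂H hl₃H T).trans ?_
    have hlg := hlarge.log_nonneg
    have hpos : 0 < (S : ℝ) ^ 3 * (A : ℝ) ^ 2 * T * Real.log T / δ := by positivity
    rw [hx, logFactor, Real.exp_neg, Real.exp_log hpos, inv_div, mul_div_assoc',
      div_le_iff₀ (by positivity), mul_comm]
    refine mul_le_mul_of_nonneg_left ?_ hδ.le
    have hT1' : (1 : ℝ) ≤ T := by exact_mod_cast hT1
    calc 2 * (S * A * ((T : ℝ) + 1) * (S + 1)) + 4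
        ≤ 2 * (S * A * (T + T) * (S + S)) + 4 * (S * A * T * S) := by
          have h1 : (1 : ℝ) ≤ S * A * T * S :=
            one_le_mul_of_one_le_of_one_le (one_le_mul_of_one_le_of_one_le
              (one_le_mul_of_one_le_of_one_le (by linarith) (by linarith)) hT1') (by linarith)
          have h2 : (1 : ℝ) ≤ S := by linarith
          have h3 : 2 * (S * A * ((T : ℝ) + 1) * (S + 1)) ≤ 2 * (S * A * (T + T) * (S + S)) := by
            gcongr
          linarith
      _ = 12 * (S ^ 2 * A * T) := by ring
      _ ≤ S * A * (S ^ 2 * A * T) := by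
          gcongr
          nlinarith
      _ = S ^ 3 * A ^ 2 * T * 1 := by ring
      _ ≤ S ^ 3 * A ^ 2 * T * Real.log T := by gcongr
  have hmeas : MeasurableSet {ω | regret P r s T ω ≤ 491 * √(S * A * D * T * x)} :=
    measurableSet_le (measurable_regret P r s T) measurable_const
  have hle : μ.real {ω | regret P r s T ω ≤ 491 * √(S * A * D * T * x)}ᶜ ≤
      μ.real {ω | ¬ IsGood P r (y ^ 4) x (1 / T) D h l₁ l₂ l₃ T ω} := by
    refine ENNReal.toReal_mono (measure_ne_top _ _) (measure_mono_ae ?_)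
    filter_upwards [ae_eq_greedyAction r (y ^ 4) x (1 / T) P s] with ω hω hreg hgood
    refine hreg ?_
    obtain ⟨B, E, G, W, hsys⟩ := hgood.regretSystem (by omega) hx0.le hr hε (by linarith) hDH
      (by positivity) hp hω
    have h1 := hsys.regret_le hlarge.root rfl hτ rfl rfl rfl rfl (by linarith) (by linarith)
      (by linarith) hx1 hlarge.mul_le hlarge.states_le hlarge.diameter_le hlarge.factor_le
      (by linarith [hlarge.log_nonneg]) hlarge.one_add_log_le (by
        have h2 := updates_le ω T hT1
        have h3 := hlarge.log_le
        have h4 := hlarge.mul_le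
        have h5 := hlarge.log_nonneg
        have h6 := hlarge.root
        calc 1 + (updates ω T : ℝ) ≤ 1 + y * (1 + 2 * (64 * y)) := by
              refine add_le_add le_rfl (h2.trans ?_)
              gcongr
          _ ≤ 200 * y ^ 2 := by nlinarith
          _ ≤ y * y ^ 2 := by gcongr; linarith
          _ = y ^ 3 := by ring)
    have h7 := mul_le_mul_of_nonneg_left (hp.optAverageReward_le s) hT0.le
    refine le_trans ?_ h1
    unfold regret
    linarith
  have hcompl := probReal_compl_eq_one_sub (μ := μ) hmeas
  linarith

theorem regret_le_horizon {S A : ℕ} [Nonempty (Fin A)] {r : Fin S → Fin A → ℝ}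
    (hr : ∀ s a, r s a ∈ Set.Icc (0 : ℝ) 1) {P : Transition S A} {D : ℝ}
    (hP : diameter P = ENNReal.ofReal D) (hD : 0 ≤ D) (s : Fin S) (T : ℕ) (ω : Trajectory S A) :
    regret P r s T ω ≤ T := by
  have : Nonempty (Fin S) := ⟨s⟩
  obtain ⟨ρ, h, hp⟩ := exists_isOptimalPair P hr hD hP
  have h1 := (hp.optAverageReward_le s).trans hp.gain_le
  have h2 : 0 ≤ totalReward r T ω := Finset.sum_nonneg fun t _ => (hr _ _).1
  have h3 := mul_le_mul_of_nonneg_left h1 (Nat.cast_nonneg T : (0 : ℝ) ≤ T)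
  unfold regret
  linarith

/-- A function bounded by `M` that exceeds `b` with probability at most `δ` has mean at most
`b + M δ`. -/
theorem integral_le_add_mul {Ω : Type*} [MeasurableSpace Ω] (μ : Measure Ω)
    [IsProbabilityMeasure μ] {f : Ω → ℝ} (hf : Measurable f) (hfi : Integrable f μ) {b M δ : ℝ}
    (hb : 0 ≤ b) (hM : 0 ≤ M) (hfM : ∀ ω, f ω ≤ M) (h : 1 - δ ≤ μ.real {ω | f ω ≤ b}) :
    ∫ ω, f ω ∂μ ≤ b + M * δ := by
  have hmeas : MeasurableSet {ω | f ω ≤ b} := measurableSet_le hf measurable_const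
  have hcompl := probReal_compl_eq_one_sub (μ := μ) hmeas
  calc ∫ ω, f ω ∂μ ≤ ∫ ω, (b + {ω | f ω ≤ b}ᶜ.indicator (fun _ => M) ω) ∂μ := by
        refine integral_mono hfi ((integrable_const b).add
          ((integrable_const M).indicator hmeas.compl)) fun ω => ?_
        by_cases hω : f ω ≤ b
        · have : ω ∉ {ω | f ω ≤ b}ᶜ := fun h => h hω
          simpa [Set.indicator_of_notMem this] using hω
        · have : ω ∈ {ω | f ω ≤ b}ᶜ := hω
          simp only [Set.indicator_of_mem this]
          linarith [hfM ω]
    _ = b + M * μ.real {ω | f ω ≤ b}ᶜ := by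
        rw [integral_add (integrable_const b) ((integrable_const M).indicator hmeas.compl),
          integral_indicator_const M hmeas.compl]
        simp [mul_comm]
    _ ≤ b + M * δ := by
        have : μ.real {ω | f ω ≤ b}ᶜ ≤ δ := by linarith
        linarith [mul_le_mul_of_nonneg_left this hM]

theorem integrable_regret {S A : ℕ} (P : Transition S A) (r : Fin S → Fin A → ℝ) (s : Fin S)
    (T : ℕ) (μ : Measure (Trajectory S A)) [IsFiniteMeasure μ] :
    Integrable (regret P r s T) μ := by
  refine DependsOn.integrable_traj (n := T) (fun ω ω' h => ?_) μ
  unfold regret totalReward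
  congr 1
  exact Finset.sum_congr rfl fun t ht => by rw [h t (Finset.mem_range.1 ht).le]

theorem LargeHorizon.factor_le_mul_log {S A T : ℕ} {D : ℝ} (hS : 20 ≤ S) (hA : 20 ≤ A)
    (h : LargeHorizon S A T D (1 / T)) : logFactor S A T (1 / T) ≤ 4 * Real.log T := by
  have h1 : Real.log S ≤ Real.log (horizonRoot T) :=
    Real.log_le_log (by positivity) h.states_le
  have h2 : Real.log A ≤ Real.log (horizonRoot T) :=
    Real.log_le_log (by positivity) h.actions_le
  have h3 := Real.log_le_sub_one_of_pos (show 0 < Real.log T by linarith [h.log_nonneg])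
  have h4 := h.log_eq
  rw [h.factor_eq, one_div_one_div]
  linarith [h.log_nonneg]

end

theorem corollary1 :
    ∃ (p₂ : MvPolynomial (Fin 4) ℝ) (C : ℝ) (k : ℕ),
      ∀ (S A : ℕ), 20 ≤ S → 20 ≤ A →
      ∀ r : Fin S → Fin A → ℝ, (∀ s a, r s a ∈ Set.Icc (0 : ℝ) 1) →
      ∃ L : ℕ → ℝ → Learner S A,
      ∀ (P : Transition S A) (D : ℝ), diameter P = ENNReal.ofReal D → 20 ≤ D →
      ∀ (s : Fin S) (T : ℕ),
        (∀ δ : ℝ, 0 < δ → δ < 1 →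
          MvPolynomial.eval ![(S : ℝ), (A : ℝ), D, Real.log (1 / δ)] p₂ ≤ (T : ℝ) →
          1 - δ ≤ (trajLaw P (L T δ) s).real
            {ω | regret P r s T ω ≤
              491 * Real.sqrt (S * A * D * T *
                Real.log ((S : ℝ) ^ 3 * (A : ℝ) ^ 2 * T * Real.log T / δ))}) ∧
        (MvPolynomial.eval ![(S : ℝ), (A : ℝ), D, Real.log T] p₂ ≤ (T : ℝ) →
          ∫ ω, regret P r s T ω ∂(trajLaw P (L T (1 / (T : ℝ))) s) ≤
            C * Real.sqrt (S * A * D * T) * Real.log T ^ k) := by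
  let p₂ : MvPolynomial (Fin 4) ℝ := (MvPolynomial.C 1000 * MvPolynomial.X 0 * MvPolynomial.X 1 *
    MvPolynomial.X 2 * (1 + MvPolynomial.X 3)) ^ 64
  have hp₂ : ∀ a b c d : ℝ, MvPolynomial.eval ![a, b, c, d] p₂ =
      (1000 * a * b * c * (1 + d)) ^ 64 := fun a b c d => by
    simp [p₂]
  refine ⟨p₂, 983, 1, fun S A hS hA r hr => ?_⟩
  have : Nonempty (Fin A) := ⟨⟨0, by omega⟩⟩
  refine ⟨tunedLearner r, fun P D hP hD s T => ⟨fun δ hδ hδ1 hT => ?_, fun hT => ?_⟩⟩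
  · rw [hp₂] at hT
    exact tunedLearner_regret_le hS hA hr hP hD s hδ (largeHorizon hS hA hD hδ hδ1 hT)
  · rw [hp₂] at hT
    have hS' : (20 : ℝ) ≤ S := by exact_mod_cast hS
    have hA' : (20 : ℝ) ≤ A := by exact_mod_cast hA
    have hlog0 : 0 ≤ Real.log T := Real.log_natCast_nonneg T
    have hT2 : (2 : ℝ) ≤ T := by
      refine le_trans ?_ hT
      have h1 : (1000 : ℝ) ≤ 1000 * S * A * D * (1 + Real.log T) := by
        have h2 : (1 : ℝ) ≤ S * A * D * (1 + Real.log T) :=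
          one_le_mul_of_one_le_of_one_le (one_le_mul_of_one_le_of_one_le
            (one_le_mul_of_one_le_of_one_le (by linarith) (by linarith)) (by linarith))
            (by linarith)
        linarith
      calc (2 : ℝ) ≤ 1000 * S * A * D * (1 + Real.log T) := by linarith
        _ ≤ _ := le_self_pow₀ (by linarith) (by norm_num)
    have hδ : (0 : ℝ) < 1 / T := by positivity
    have hδ1 : (1 : ℝ) / T < 1 := by
      rw [div_lt_one (by linarith)]
      linarith
    have hlarge : LargeHorizon S A T D (1 / T) :=
      largeHorizon hS hA hD hδ hδ1 (by rwa [one_div_one_div])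
    have hprob := tunedLearner_regret_le hS hA hr hP hD s hδ hlarge
    have hint := integral_le_add_mul (trajLaw P (tunedLearner r T (1 / T)) s)
      (measurable_regret P r s T) (integrable_regret P r s T _) (by positivity)
      (Nat.cast_nonneg T) (regret_le_horizon hr hP (by linarith) s T) hprob
    refine hint.trans ?_
    have hlg := hlarge.log_nonneg
    have hsq : 1 ≤ √(S * A * D * T) := by
      rw [Real.one_le_sqrt]
      exact one_le_mul_of_one_le_of_one_le (one_le_mul_of_one_le_of_one_le
        (one_le_mul_of_one_le_of_one_le (by linarith) (by linarith)) (by linarith)) (by linarith)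
    have h1 : √(S * A * D * T * logFactor S A T (1 / T)) ≤ 2 * √(S * A * D * T) * Real.log T := by
      rw [Real.sqrt_mul (by positivity)]
      have h2 : √(logFactor S A T (1 / T)) ≤ 2 * Real.log T := by
        rw [Real.sqrt_le_left (by positivity)]
        have := hlarge.factor_le_mul_log hS hA
        nlinarith
      have := mul_le_mul_of_nonneg_left h2 (Real.sqrt_nonneg (S * A * D * T))
      linarith
    have h3 : (T : ℝ) * (1 / T) = 1 := by
      field_simp
    have h4 : 1 ≤ √(S * A * D * T) * Real.log T := one_le_mul_of_one_le_of_one_le hsq hlg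
    rw [h3, pow_one]
    linarith
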